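/- Let $G=(V,E)$ be a finite loopless undirected multigraph in which every edge $e=uv$ has two non-negative real activation costs $c_e^u,c_e^v$, and let $s\neq t$ be two nodes. For $F\subseteq E$ and $v\in V$ let $\ell_F(v)=\max\{c_e^v : e\in F \text{ is incident to } v\}$ (zero if no edge of $F$ is incident to $v$); the activation cost of $F$ is $\ell_F(V)=\sum_{v\in V}\ell_F(v)$. A set of $st$-paths is edge disjoint if no two of them share an edge, and internally disjoint if no two of them share an edge or a node other than $s,t$. Consider the following problems. - Activation 2-DP Augmentation: given also an edge set $E_0\subseteq E$ of activation cost zero that contains an $st$-path (for instance the edge set of a zero-cost $st$-path $P$), find $F\subseteq E\setminus E_0$ of minimum activation cost such that $E_0\cup F$ contains two internally disjoint $st$-paths. - Activation 2-DP: find $F\subseteq E$ of minimum activation cost that contains two internally disjoint $st$-paths. - Activation 2-EDP: find $F\subseteq E$ of minimum activation cost that contains two edge disjoint $st$-paths. Then Activation 2-DP Augmentation is solved exactly by a polynomial time algorithm, and each of Activation 2-DP and Activation 2-EDP admits a polynomial time algorithm with approximation ratio $1.5$, i.e. one that returns a feasible $F$ with $\ell_F(V)\le \frac32\,\ell_{F'}(V)$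 for every feasible $F'$. If there is no feasible edge set, the algorithms report so. Here a polynomial time algorithm is a single program of a random access machine with integer and real cells, whose unit-cost operations are reading and writing of (multi-dimensional) array entries, addition, subtraction and comparison, that halts on every instance after a number of steps bounded by a fixed polynomial in $|V|+|E|$. -/

import Mathlib

open scoped NNReal

/-! ## Machine model

Programs of a random access machine with integer cells and real cells.  On integers and on reals
the machine can only add, subtract and compare: there is no multiplication, division or rounding,
and the only real constant is `0`.  Hence unit costs are realistic: on rational inputs, the bit
lengths of all numbers that occur within `T` steps are polynomial in `T` and in the bit length of
the input. -/

/-- A memory: `nat a [i₁, …, iₖ]` is the entry `(i₁, …, iₖ)` of the integer array number `a`, and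
`real a [i₁, …, iₖ]` that of the real array number `a`.  A scalar variable is the entry `[]`. -/
structure Mem where
  nat : ℕ → List ℕ → ℕ
  real : ℕ → List ℕ → ℝ

/-- Write `x` to an integer cell. -/
def Mem.setNat (σ : Mem) (a : ℕ) (i : List ℕ) (x : ℕ) : Mem :=
  { σ with nat := Function.update σ.nat a (Function.update (σ.nat a) i x) }

/-- Write `x` to a real cell. -/
def Mem.setReal (σ : Mem) (a : ℕ) (i : List ℕ) (x : ℝ) : Mem :=
  { σ with real := Function.update σ.real a (Function.update (σ.real a) i x) }

/-- Integer expressions; `read a idx` is the entry of array `a` at the index given by `idx`. -/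
inductive NExp : Type
  | const (c : ℕ) : NExp
  | read (a : ℕ) {k : ℕ} (idx : Fin k → NExp) : NExp
  | add (x y : NExp) : NExp
  | sub (x y : NExp) : NExp

/-- Value of an integer expression (subtraction is truncated at `0`). -/
def NExp.eval (σ : Mem) : NExp → ℕ
  | const c => c
  | read a idx => σ.nat a (List.ofFn fun j => (idx j).eval σ)
  | add x y => x.eval σ + y.eval σ
  | sub x y => x.eval σ - y.eval σ

/-- Real expressions. -/
inductive RExp : Type
  | zero : RExp
  | read (a : ℕ) {k : ℕ} (idx : Fin k → NExp) : RExp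
  | add (x y : RExp) : RExp
  | sub (x y : RExp) : RExp

/-- Value of a real expression. -/
noncomputable def RExp.eval (σ : Mem) : RExp → ℝ
  | zero => 0
  | read a idx => σ.real a (List.ofFn fun j => (idx j).eval σ)
  | add x y => x.eval σ + y.eval σ
  | sub x y => x.eval σ - y.eval σ

/-- Tests: comparisons of integers, comparisons of reals, and their Boolean combinations. -/
inductive Test : Type
  | natLE (x y : NExp) : Test
  | realLE (x y : RExp) : Test
  | neg (b : Test) : Test
  | conj (b b' : Test) : Test

/-- Truth of a test in a memory. -/
def Test.Holds (σ : Mem) : Test → Prop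
  | natLE x y => x.eval σ ≤ y.eval σ
  | realLE x y => x.eval σ ≤ y.eval σ
  | neg b => ¬ b.Holds σ
  | conj b b' => b.Holds σ ∧ b'.Holds σ

/-- Programs: assignments to integer and real cells, sequencing, branching and loops. -/
inductive Prog : Type
  | skip : Prog
  | natSet (a : ℕ) {k : ℕ} (idx : Fin k → NExp) (x : NExp) : Prog
  | realSet (a : ℕ) {k : ℕ} (idx : Fin k → NExp) (x : RExp) : Prog
  | seq (p q : Prog) : Prog
  | ite (b : Test) (p q : Prog) : Prog
  | loop (b : Test) (p : Prog) : Prog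

/-- `Exec p σ T τ`: started in memory `σ`, the program `p` halts after exactly `T` steps in memory
`τ`.  Each executed assignment and each evaluated test is one step (the expressions in it have a
fixed size, as the program does not depend on the input).  `loop b p` repeats `p` while `b`
holds. -/
inductive Exec : Prog → Mem → ℕ → Mem → Prop
  | skip (σ : Mem) : Exec .skip σ 1 σ
  | natSet (σ : Mem) (a : ℕ) {k : ℕ} (idx : Fin k → NExp) (x : NExp) :
      Exec (.natSet a idx x) σ 1
        (σ.setNat a (List.ofFn fun j => (idx j).eval σ) (x.eval σ))
  | realSet (σ : Mem) (a : ℕ) {k : ℕ} (idx : Fin k → NExp) (x : RExp) :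
      Exec (.realSet a idx x) σ 1
        (σ.setReal a (List.ofFn fun j => (idx j).eval σ) (x.eval σ))
  | seq {p q : Prog} {σ τ υ : Mem} {T U : ℕ} (hp : Exec p σ T τ) (hq : Exec q τ U υ) :
      Exec (.seq p q) σ (T + U) υ
  | iteTrue {b : Test} {p q : Prog} {σ τ : Mem} {T : ℕ} (hb : b.Holds σ)
      (hp : Exec p σ T τ) : Exec (.ite b p q) σ (T + 1) τ
  | iteFalse {b : Test} {p q : Prog} {σ τ : Mem} {T : ℕ} (hb : ¬ b.Holds σ)
      (hq : Exec q σ T τ) : Exec (.ite b p q) σ (T + 1) τ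
  | loopDone {b : Test} {p : Prog} {σ : Mem} (hb : ¬ b.Holds σ) : Exec (.loop b p) σ 1 σ
  | loopStep {b : Test} {p : Prog} {σ τ υ : Mem} {T U : ℕ} (hb : b.Holds σ)
      (hp : Exec p σ T τ) (hl : Exec (.loop b p) τ U υ) :
      Exec (.loop b p) σ (T + U + 1) υ

/-! ## Activation networks -/

/-- A finite loopless undirected multigraph with node set `Fin n` and edge set `Fin m` (the edge
`e` has the ends `fst e` and `snd e`; parallel edges are allowed), with a source `s`, a sink `t` and
non-negative activation costs.  `cost e v` is the activation cost of `e` at its end `v`; it is only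
used when `v` is an end of `e`. -/
structure Network where
  n : ℕ
  m : ℕ
  fst : Fin m → Fin n
  snd : Fin m → Fin n
  fst_ne_snd : ∀ e, fst e ≠ snd e
  cost : Fin m → Fin n → ℝ≥0
  s : Fin n
  t : Fin n
  s_ne_t : s ≠ t

namespace Network

/-- The activation cost `max {c_e^v : e ∈ F, v is an end of e}` of the edge set `F` at the node
`v`; it is `0` if no edge of `F` is incident to `v`. -/
def level (N : Network) (F : Finset (Fin N.m)) (v : Fin N.n) : ℝ≥0 :=
  (F.filter fun e => N.fst e = v ∨ N.snd e = v).sup fun e => N.cost e v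

/-- The activation cost of an edge set. -/
def activationCost (N : Network) (F : Finset (Fin N.m)) : ℝ≥0 :=
  ∑ v, N.level F v

/-- `u` and `v` are the two ends of `e`. -/
def Joins (N : Network) (e : Fin N.m) (u v : Fin N.n) : Prop :=
  (N.fst e = u ∧ N.snd e = v) ∨ (N.fst e = v ∧ N.snd e = u)

/-- Walks of the multigraph. -/
inductive Walk (N : Network) : Fin N.n → Fin N.n → Type
  | nil (u : Fin N.n) : Walk N u u
  | cons {u v w : Fin N.n} (e : Fin N.m) (h : N.Joins e u v) (p : Walk N v w) : Walk N u w

/-- The edges of a walk, in order. -/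
def Walk.edges {N : Network} {u v : Fin N.n} : N.Walk u v → List (Fin N.m)
  | .nil _ => []
  | .cons e _ p => e :: p.edges

/-- The nodes of a walk, in order. -/
def Walk.support {N : Network} {u v : Fin N.n} : N.Walk u v → List (Fin N.n)
  | .nil u => [u]
  | .cons (u := u) _ _ p => u :: p.support

/-- A path is a walk that repeats no node. -/
def Walk.IsPath {N : Network} {u v : Fin N.n} (p : N.Walk u v) : Prop :=
  p.support.Nodup

/-- The edge set `F` contains `k` pairwise edge-disjoint `st`-paths. -/
def ContainsEDP (N : Network) (k : ℕ) (F : Finset (Fin N.m)) : Prop :=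
  ∃ p : Fin k → N.Walk N.s N.t,
    (∀ i, (p i).IsPath ∧ ∀ e ∈ (p i).edges, e ∈ F) ∧
    ∀ i j, i ≠ j → (p i).edges.Disjoint (p j).edges

/-- The edge set `F` contains `k` pairwise internally disjoint `st`-paths: any two of them have no
edge in common (so that one `st`-edge does not count twice) and no node in common other than `s`
and `t`. -/
def ContainsDP (N : Network) (k : ℕ) (F : Finset (Fin N.m)) : Prop :=
  ∃ p : Fin k → N.Walk N.s N.t,
    (∀ i, (p i).IsPath ∧ ∀ e ∈ (p i).edges, e ∈ F) ∧
    ∀ i j, i ≠ j → (p i).edges.Disjoint (p j).edges ∧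
      ∀ v ∈ (p i).support, v ∈ (p j).support → v = N.s ∨ v = N.t

/-- The input memory for a network with a distinguished edge set `E₀`.  Integer scalars `0, 1, 2, 3`:
numbers of nodes and edges, source, sink; integer arrays `4, 5, 6`: first end, second end, membership
in `E₀` of each edge; real arrays `0, 1`: activation cost of each edge at its first and second end.
All other cells are `0`. -/
noncomputable def load (N : Network) (E₀ : Finset (Fin N.m)) : Mem where
  nat
    | 0, [] => N.n
    | 1, [] => N.m
    | 2, [] => N.s
    | 3, [] => N.t
    | 4, [e] => if h : e < N.m then N.fst ⟨e, h⟩ else 0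
    | 5, [e] => if h : e < N.m then N.snd ⟨e, h⟩ else 0
    | 6, [e] => if h : e < N.m then (if ⟨e, h⟩ ∈ E₀ then 1 else 0) else 0
    | _, _ => 0
  real
    | 0, [e] => if h : e < N.m then (N.cost ⟨e, h⟩ (N.fst ⟨e, h⟩) : ℝ) else 0
    | 1, [e] => if h : e < N.m then (N.cost ⟨e, h⟩ (N.snd ⟨e, h⟩) : ℝ) else 0
    | _, _ => 0

/-- The edge set that a final memory describes: the edges whose entry in integer array `8` is
`1`. -/
def output (N : Network) (τ : Mem) : Finset (Fin N.m) :=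
  Finset.univ.filter fun e => τ.nat 8 [e.val] = 1

end Network

/-! ## Optimization problems -/

/-- A problem that asks, in the network of an instance, for a feasible edge set of minimum
activation cost. -/
structure ActivationProblem where
  Inst : Type
  net : Inst → Network
  input : Inst → Mem
  Feasible : (I : Inst) → Finset (Fin (net I).m) → Prop

/-- `F` is feasible, and its activation cost is at most `ρ` times that of any feasible edge set. -/
def ActivationProblem.IsApprox (Q : ActivationProblem) (ρ : ℝ≥0) (I : Q.Inst)
    (F : Finset (Fin (Q.net I).m)) : Prop :=
  Q.Feasible I F ∧
    ∀ F', Q.Feasible I F' → (Q.net I).activationCost F ≤ ρ * (Q.net I).activationCost F'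

/-- The problem admits a polynomial time algorithm with approximation ratio `ρ`: one program that on
every instance halts within a number of steps that is polynomial in the number of nodes and edges;
in the end, integer scalar `7` is `1` and array `8` describes a `ρ`-approximate solution, or
integer scalar `7` is `0` and the instance has no feasible solution. -/
def ActivationProblem.ApproxInPolyTime (Q : ActivationProblem) (ρ : ℝ≥0) : Prop :=
  ∃ (A : Prog) (b : Polynomial ℕ), ∀ I : Q.Inst, ∃ (T : ℕ) (τ : Mem),
    Exec A (Q.input I) T τ ∧ T ≤ b.eval ((Q.net I).n + (Q.net I).m) ∧
    ((τ.nat 7 [] = 1 ∧ Q.IsApprox ρ I ((Q.net I).output τ)) ∨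
      (τ.nat 7 [] = 0 ∧ ∀ F, ¬ Q.Feasible I F))

/-- The problem is solved exactly by a polynomial time algorithm. -/
def ActivationProblem.SolvableInPolyTime (Q : ActivationProblem) : Prop :=
  Q.ApproxInPolyTime 1

/-- An instance of the augmentation problem: a network with an edge set `E₀` of activation cost
zero that contains an `st`-path (for example, the edge set of an `st`-path). -/
structure AugInstance where
  net : Network
  E₀ : Finset (Fin net.m)
  cost_zero : net.activationCost E₀ = 0
  contains_path : net.ContainsDP 1 E₀

/-- Activation 2-DP Augmentation: find `F ⊆ E \ E₀` such that `E₀ ∪ F` contains two internally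
disjoint `st`-paths. -/
noncomputable def activation2DPAugmentation : ActivationProblem where
  Inst := AugInstance
  net I := I.net
  input I := I.net.load I.E₀
  Feasible I F := Disjoint F I.E₀ ∧ I.net.ContainsDP 2 (I.E₀ ∪ F)

/-- Activation 2-DP: find `F ⊆ E` that contains two internally disjoint `st`-paths. -/
noncomputable def activation2DP : ActivationProblem where
  Inst := Network
  net N := N
  input N := N.load ∅
  Feasible N F := N.ContainsDP 2 F

/-- Activation 2-EDP: find `F ⊆ E` that contains two edge-disjoint `st`-paths. -/
noncomputable def activation2EDP : ActivationProblem where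
  Inst := Network
  net N := N
  input N := N.load ∅
  Feasible N F := N.ContainsEDP 2 F

/-! All three problems rest on one subroutine. It takes a cheapest path `P` from `S` to `T` in an
edge set `A₁` and augments it by edges of `A₂`, so that afterwards neither an edge nor an inner node
separates `T` from `S`. An augmentation is a sequence of ears: it starts in `S`, walks off `P`, and
whenever it lands on `P` it goes on from a strictly earlier node of `P`, until it reaches `T`. By a
cut argument such a sequence exists in every edge set without a separating edge or node
(`exists_earRoute`). Conversely, `P` together with any such sequence has no separating edge or node
(`augProblem_sound_conn`), and Menger's theorem for two paths (`exists_disjoint_walks`, applied to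
an incidence graph) then yields the disjoint paths.

Activation costs are not additive over edges. What helps is that in a sequence without shortcuts
every node is entered at most once and charged at most once as the start of an ear. Both happen at
the same node only if it ends an ear and starts the ear after the next one (`charge_le`). So it
suffices to remember, besides the current dart, the last dart that arrived on `P`, and a cheapest
sequence becomes a shortest route over pairs of darts. After the path has been paid for, the
sequence is priced at reduced costs. The result costs at most as much as any path in `A₁` plus any
edge set in `A₂` without separating edge or node (`core_sound`, `core_complete`). If the path is
free, this is optimal, which settles the augmentation problem.

For two internally disjoint paths the levels at `s` and `t` are guessed. A level is attained by some
edge, so a guess is a dart. Edges above the guess are forbidden, and costs at the two ends are set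
to zero and paid separately. Of two internally disjoint paths in an optimal solution, one pays at
most half of the levels at the inner nodes, so path plus augmentation cost at most `1/2 + 1 = 3/2`
of these levels (`CoreResult.le_innerCost`). For two edge-disjoint paths, an edge set without
bridges between `s` and `t` falls apart at its cut nodes into a chain of blocks
(`EConn2.block_induction`). Each block is treated as before, with guessed levels at the cut nodes
too, and the best chain of links is again a shortest route, now over darts (`EConn2.exists_chain`,
`chainProblem_sound`).

All optimizations are layered shortest route computations (`RouteTables.isBest`). On the machine
they are lists of statements, each filling a fresh array and reading only what is final. Hence every
statement holds as an equation in the final memory (`exec_compile`), and correctness becomes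
reasoning about these equations. -/

/-! ## Equation programs

A program is given by a list of statements, each of which fills the cells of one array; in the end,
all these statements hold as equations between the arrays. -/

/-- The loop variable number `i`: it is kept in entry `i` of integer array `9`. -/
def NExp.var (i : ℕ) : NExp := .read 9 ![.const i]

/-- The scalar kept in the integer array `a`. -/
def NExp.scalar (a : ℕ) : NExp := .read a ![]

/-- The memory `σ` with the loop variables set to `x`. -/
def Mem.view (σ : Mem) (x : List ℕ) : Mem :=
  { σ with nat := Function.update σ.nat 9 fun l => if l.length = 1 then x.getD (l.headD 0) 0 else 0 }

theorem Mem.view_nat_self (σ : Mem) (x : List ℕ) (i : ℕ) : (σ.view x).nat 9 [i] = x.getD i 0 := by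
  simp [Mem.view]

theorem Mem.view_nat_ne (σ : Mem) (x : List ℕ) {a : ℕ} (h : a ≠ 9) : (σ.view x).nat a = σ.nat a := by
  simp [Mem.view, h]

theorem Mem.view_real (σ : Mem) (x : List ℕ) : (σ.view x).real = σ.real := rfl

/-- Unlisted loop variables read as `0`, so a loop that starts its counter at `0` and resets it on
exit does not disturb the view. -/
theorem Mem.view_append_zero (σ : Mem) (x : List ℕ) : σ.view (x ++ [0]) = σ.view x := by
  have : ∀ i, (x ++ [0]).getD i 0 = x.getD i 0 := by
    intro i
    rcases lt_trichotomy i x.length with h | h | h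
    · simp [List.getD, List.getElem?_append_left h]
    · subst h; simp
    · rw [List.getD_eq_default _ _ (by simp; omega), List.getD_eq_default _ _ (by omega)]
  unfold Mem.view
  simp only [this]

theorem Mem.view_setNat_counter (σ : Mem) (x : List ℕ) (j k : ℕ) :
    (σ.view (x ++ [j])).setNat 9 [x.length] k = σ.view (x ++ [k]) := by
  simp only [Mem.view, Mem.setNat, Function.update_self, Function.update_idem]
  congr 2
  funext l
  by_cases h : l = [x.length]
  · subst h; simp
  · rw [Function.update_of_ne h]
    match l, h with
    | [], _ => simp
    | [i], h =>
      have hi : i ≠ x.length := by simpa using h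
      simp only [List.length_cons, List.length_nil, zero_add, if_true, List.headD_cons]
      rcases lt_or_gt_of_ne hi with h | h
      · simp [List.getD, List.getElem?_append_left h]
      · rw [List.getD_eq_default _ _ (by simp; omega), List.getD_eq_default _ _ (by simp; omega)]
    | _ :: _ :: _, _ => simp

theorem Mem.setNat_view (σ : Mem) (x : List ℕ) {a : ℕ} (h : a ≠ 9) (i : List ℕ) (v : ℕ) :
    (σ.view x).setNat a i v = (σ.setNat a i v).view x := by
  simp only [Mem.view, Mem.setNat, Function.update_of_ne h, Mem.mk.injEq, and_true]
  rw [Function.update_comm h]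

theorem Mem.setReal_view (σ : Mem) (x : List ℕ) (a : ℕ) (i : List ℕ) (v : ℝ) :
    (σ.view x).setReal a i v = (σ.setReal a i v).view x := rfl

theorem NExp.eval_var (σ : Mem) (x : List ℕ) (i : ℕ) :
    (NExp.var i).eval (σ.view x) = x.getD i 0 := by
  simp [NExp.var, NExp.eval, Mem.view]

theorem NExp.eval_scalar (σ : Mem) (a : ℕ) : (NExp.scalar a).eval σ = σ.nat a [] := by
  simp [NExp.scalar, NExp.eval]

/-! ### For loops -/

/-- `for i < b do p`, where `i` is the loop variable number `i` and the bound is the scalar `b`. -/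
def forLoop (i b : ℕ) (p : Prog) : Prog :=
  .seq (.loop (.natLE (.add (.var i) (.const 1)) (.scalar b))
      (.seq p (.natSet 9 ![.const i] (.add (.var i) (.const 1)))))
    (.natSet 9 ![.const i] (.const 0))

/-- `s j` is the memory after `j` rounds. The bound must keep its value throughout, because it is
read again before each round. -/
theorem exec_forLoop {b : ℕ} (hb : b ≠ 9) {p : Prog} {x : List ℕ} (s : ℕ → Mem) {B t : ℕ}
    (hB : ∀ j ≤ B, (s j).nat b [] = B)
    (hp : ∀ j < B, ∃ T ≤ t, Exec p ((s j).view (x ++ [j])) T ((s (j + 1)).view (x ++ [j]))) :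
    ∃ T ≤ B * (t + 2) + 2, Exec (forLoop x.length b p) ((s 0).view x) T ((s B).view x) := by
  -- Induction on the number `c` of rounds that remain.
  have key : ∀ c j, j + c = B → ∃ T ≤ c * (t + 2) + 1,
      Exec (.loop (.natLE (.add (.var x.length) (.const 1)) (.scalar b))
        (.seq p (.natSet 9 ![.const x.length] (.add (.var x.length) (.const 1)))))
        ((s j).view (x ++ [j])) T ((s B).view (x ++ [B])) := by
    intro c
    induction c with
    | zero =>
      intro j hj
      obtain rfl : j = B := by omega
      refine ⟨1, by omega, Exec.loopDone ?_⟩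
      simp [Test.Holds, NExp.eval, NExp.eval_var, NExp.eval_scalar, Mem.view_nat_ne _ _ hb, hB]
    | succ c ih =>
      intro j hj
      obtain ⟨T, hT, hE⟩ := hp j (by omega)
      obtain ⟨U, hU, hF⟩ := ih (j + 1) (by omega)
      refine ⟨(T + 1) + U + 1, by nlinarith, Exec.loopStep ?_ (Exec.seq hE ?_) hF⟩
      · simp [Test.Holds, NExp.eval, NExp.eval_var, NExp.eval_scalar, Mem.view_nat_ne _ _ hb,
          hB j (by omega)]
        omega
      · have := Exec.natSet ((s (j + 1)).view (x ++ [j])) 9 ![.const x.length]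
          (.add (.var x.length) (.const 1))
        simpa [NExp.eval, NExp.eval_var, Mem.view_setNat_counter] using this
  obtain ⟨T, hT, hE⟩ := key B 0 (by omega)
  refine ⟨T + 1, by omega, ?_⟩
  rw [Mem.view_append_zero] at hE
  refine Exec.seq hE ?_
  have := Exec.natSet ((s B).view (x ++ [B])) 9 ![.const x.length] (.const 0)
  simpa [NExp.eval, Mem.view_setNat_counter, Mem.view_append_zero] using this

/-- Nested for loops with the bounds `bs`; the outermost loop variable is number `i`. -/
def forLoops : ℕ → List ℕ → Prog → Prog
  | _, [], p => p
  | i, b :: bs, p => forLoop i b (forLoops (i + 1) bs p)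

/-- The values of the loop variables in nested loops with bounds `Bs`, in order. -/
def loopValues : List ℕ → List (List ℕ)
  | [] => [[]]
  | B :: Bs => (List.range B).flatMap fun j => (loopValues Bs).map (j :: ·)

theorem mem_loopValues {Bs z : List ℕ} : z ∈ loopValues Bs ↔ List.Forall₂ (· < ·) z Bs := by
  induction Bs generalizing z with
  | nil => simp [loopValues]
  | cons B Bs ih =>
    simp only [loopValues, List.mem_flatMap, List.mem_range, List.mem_map, ih]
    constructor
    · rintro ⟨j, hj, y, hy, rfl⟩
      exact .cons hj hy
    · rintro (_ | ⟨hj, hy⟩)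
      exact ⟨_, hj, _, hy, rfl⟩

/-- Distinctness ensures that no cell is written twice. That the first index never decreases is what
permits recursion along it in shifted arrays. -/
theorem pairwise_loopValues (Bs : List ℕ) :
    (loopValues Bs).Pairwise fun z z' => z ≠ z' ∧ z.headD 0 ≤ z'.headD 0 := by
  induction Bs with
  | nil => simp [loopValues]
  | cons B Bs ih =>
    rw [loopValues, List.pairwise_flatMap]
    constructor
    · intro j _
      rw [List.pairwise_map]
      exact ih.imp fun h => ⟨by simpa using h.1, by simp⟩
    · refine List.pairwise_lt_range.imp ?_
      intro i j hij z hz z' hz'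
      simp only [List.mem_map] at hz hz'
      obtain ⟨y, _, rfl⟩ := hz
      obtain ⟨y', _, rfl⟩ := hz'
      exact ⟨by simp; omega, by simp; omega⟩

/-- The nest acts as a left fold of `leaf`, the effect of the body, over all index vectors in
lexicographic order. The invariant `I` carries the bounds on which the running time of the body
depends. -/
theorem exec_forLoops (leaf : List ℕ → Mem → Mem) (bs : List ℕ) (h9 : 9 ∉ bs)
    (hleaf : ∀ z σ, ∀ b ∈ bs, (leaf z σ).nat b = σ.nat b) (p : Prog) {S t : ℕ} (I : Mem → Prop)
    (hI : ∀ z σ, I σ → I (leaf z σ))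
    (x : List ℕ) (σ : Mem) (hσ : I σ) (hS : ∀ b ∈ bs, σ.nat b [] ≤ S)
    (hp : ∀ σ z, I σ → z.length = x.length + bs.length →
      ∃ T ≤ t, Exec p (σ.view z) T ((leaf z σ).view z)) :
    ∃ T ≤ (t + 4) * (S + 5) ^ bs.length, Exec (forLoops x.length bs p) (σ.view x) T
      (((loopValues (bs.map fun b => σ.nat b [])).foldl (fun τ y => leaf (x ++ y) τ) σ).view x) := by
  -- The spare `4` absorbs the overhead of each surrounding loop: `B * (w - 2) + 6 ≤ (S + 5) * w` if
  -- `B ≤ S` and `4 ≤ w`.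
  suffices H : ∃ T, T + 4 ≤ (t + 4) * (S + 5) ^ bs.length ∧ Exec (forLoops x.length bs p) (σ.view x) T
      (((loopValues (bs.map fun b => σ.nat b [])).foldl (fun τ y => leaf (x ++ y) τ) σ).view x) by
    obtain ⟨T, hT, h⟩ := H
    exact ⟨T, by omega, h⟩
  induction bs generalizing x σ with
  | nil =>
    obtain ⟨T, hT, h⟩ := hp σ x hσ (by simp)
    exact ⟨T, by simpa using hT, by simpa [forLoops, loopValues] using h⟩
  | cons b bs ih =>
    have hfold : ∀ (l : List (List ℕ)) (g : List ℕ → List ℕ) (σ : Mem), ∀ c ∈ b :: bs,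
        (l.foldl (fun τ y => leaf (g y) τ) σ).nat c = σ.nat c := by
      intro l g
      induction l with
      | nil => simp
      | cons y l ihl =>
        intro σ c hc
        rw [List.foldl_cons, ihl _ c hc, hleaf _ _ c hc]
    have hfoldI : ∀ (l : List (List ℕ)) (g : List ℕ → List ℕ) (σ : Mem), I σ →
        I (l.foldl (fun τ y => leaf (g y) τ) σ) := by
      intro l g
      induction l with
      | nil => simp
      | cons y l ihl =>
        intro σ h
        exact ihl _ (hI _ _ h)
    set B := σ.nat b [] with hB
    set Z := loopValues (bs.map fun b => σ.nat b []) with hZ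
    let s : ℕ → Mem := fun j =>
      ((List.range j).flatMap fun j => Z.map (j :: ·)).foldl (fun τ y => leaf (x ++ y) τ) σ
    have hs : ∀ j, ∀ c ∈ b :: bs, (s j).nat c = σ.nat c := fun j => hfold _ _ _
    have hsucc : ∀ j, s (j + 1) = Z.foldl (fun τ y => leaf ((x ++ [j]) ++ y) τ) (s j) := by
      intro j
      simp [s, List.range_succ, List.foldl_map]
    obtain ⟨T, hT, hE⟩ := exec_forLoop (b := b) (p := forLoops (x.length + 1) bs p) (x := x)
      (by rintro rfl; simp at h9) s (B := B) (t := (t + 4) * (S + 5) ^ bs.length - 4)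
      (fun j _ => by rw [hs j b (by simp)]) (by
        intro j _
        obtain ⟨T, hT, hE⟩ := ih (by simp_all) (fun z σ c hc => hleaf z σ c (by simp [hc]))
          (x ++ [j]) (s j) (hfoldI _ _ _ hσ)
          (fun c hc => by rw [hs j c (by simp [hc])]; exact hS c (by simp [hc]))
          (fun σ z hσ hz => hp σ z hσ (by simp at hz; simp; omega))
        refine ⟨T, by omega, ?_⟩
        have e : (bs.map fun b => (s j).nat b []) = bs.map fun b => σ.nat b [] :=
          List.map_congr_left fun c hc => by rw [hs j c (by simp [hc])]
        rw [e, ← hZ, ← hsucc] at hE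
        simpa using hE)
    refine ⟨T, ?_, ?_⟩
    · have hBS : B ≤ S := hS b (by simp)
      have h4 : 4 ≤ (t + 4) * (S + 5) ^ bs.length :=
        le_trans (by omega) (Nat.le_mul_of_pos_right _ (by positivity))
      rw [List.length_cons, pow_succ, ← mul_assoc]
      generalize (t + 4) * (S + 5) ^ bs.length = w at *
      obtain ⟨w, rfl⟩ := Nat.exists_eq_add_of_le' h4
      simp only [Nat.add_sub_cancel] at hT
      nlinarith [Nat.mul_le_mul_right (w + 2) hBS]
    · have : s 0 = σ := by simp [s]
      rw [this] at hE
      simpa [forLoops, loopValues, s] using hE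

/-! ### Statements -/

/-- An integer expression with case distinctions. -/
inductive NBody : Type
  | ret (x : NExp) : NBody
  | ite (b : Test) (p q : NBody) : NBody

open Classical in
/-- Value of an integer body. -/
noncomputable def NBody.eval (σ : Mem) : NBody → ℕ
  | ret x => x.eval σ
  | ite b p q => if b.Holds σ then p.eval σ else q.eval σ

/-- The program that writes the value of the body to a cell. -/
def NBody.prog (a : ℕ) {k : ℕ} (idx : Fin k → NExp) : NBody → Prog
  | ret x => .natSet a idx x
  | ite b p q => .ite b (p.prog a idx) (q.prog a idx)

/-- The number of nodes of the body. -/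
def NBody.size : NBody → ℕ
  | ret _ => 1
  | ite _ p q => p.size + q.size + 1

/-- A real expression with case distinctions. -/
inductive RBody : Type
  | ret (x : RExp) : RBody
  | ite (b : Test) (p q : RBody) : RBody

open Classical in
/-- Value of a real body. -/
noncomputable def RBody.eval (σ : Mem) : RBody → ℝ
  | ret x => x.eval σ
  | ite b p q => if b.Holds σ then p.eval σ else q.eval σ

/-- The program that writes the value of the body to a cell. -/
def RBody.prog (a : ℕ) {k : ℕ} (idx : Fin k → NExp) : RBody → Prog
  | ret x => .realSet a idx x
  | ite b p q => .ite b (p.prog a idx) (q.prog a idx)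

/-- The number of nodes of the body. -/
def RBody.size : RBody → ℕ
  | ret _ => 1
  | ite _ p q => p.size + q.size + 1

theorem NBody.exec (a : ℕ) {k : ℕ} (idx : Fin k → NExp) (p : NBody) (σ : Mem) :
    ∃ T ≤ p.size, Exec (p.prog a idx) σ T
      (σ.setNat a (List.ofFn fun j => (idx j).eval σ) (p.eval σ)) := by
  induction p with
  | ret x => exact ⟨1, le_rfl, Exec.natSet σ a idx x⟩
  | ite b p q hp hq =>
    by_cases h : b.Holds σ
    · obtain ⟨T, hT, hE⟩ := hp
      refine ⟨T + 1, by simp [size]; omega, ?_⟩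
      simpa [eval, h, prog] using Exec.iteTrue (q := q.prog a idx) h hE
    · obtain ⟨T, hT, hE⟩ := hq
      refine ⟨T + 1, by simp [size]; omega, ?_⟩
      simpa [eval, h, prog] using Exec.iteFalse (p := p.prog a idx) h hE

theorem RBody.exec (a : ℕ) {k : ℕ} (idx : Fin k → NExp) (p : RBody) (σ : Mem) :
    ∃ T ≤ p.size, Exec (p.prog a idx) σ T
      (σ.setReal a (List.ofFn fun j => (idx j).eval σ) (p.eval σ)) := by
  induction p with
  | ret x => exact ⟨1, le_rfl, Exec.realSet σ a idx x⟩
  | ite b p q hp hq =>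
    by_cases h : b.Holds σ
    · obtain ⟨T, hT, hE⟩ := hp
      refine ⟨T + 1, by simp [size]; omega, ?_⟩
      simpa [eval, h, prog] using Exec.iteTrue (q := q.prog a idx) h hE
    · obtain ⟨T, hT, hE⟩ := hq
      refine ⟨T + 1, by simp [size]; omega, ?_⟩
      simpa [eval, h, prog] using Exec.iteFalse (p := p.prog a idx) h hE

open Classical in
/-- `j + 1` for the least `j < B` with `p j`, and `0` if there is none. -/
noncomputable def searchVal (p : ℕ → Prop) : ℕ → ℕ
  | 0 => 0
  | B + 1 => if searchVal p B = 0 ∧ p B then B + 1 else searchVal p B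

theorem searchVal_eq_zero {p : ℕ → Prop} {B : ℕ} : searchVal p B = 0 ↔ ∀ j < B, ¬ p j := by
  induction B with
  | zero => simp [searchVal]
  | succ B ih =>
    rw [searchVal]
    split_ifs with h
    · simp only [false_iff]
      exact fun h' => h' B (by omega) h.2
    · constructor
      · intro h0 j hj
        rcases Nat.lt_succ_iff_lt_or_eq.1 hj with hj | rfl
        · exact ih.1 h0 j hj
        · exact fun hp => h ⟨h0, hp⟩
      · exact fun h' => ih.2 fun j hj => h' j (by omega)

theorem searchVal_spec {p : ℕ → Prop} {B : ℕ} (h : searchVal p B ≠ 0) :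
    searchVal p B - 1 < B ∧ p (searchVal p B - 1) ∧ ∀ j < searchVal p B - 1, ¬ p j := by
  induction B with
  | zero => simp [searchVal] at h
  | succ B ih =>
    rw [searchVal] at h ⊢
    split_ifs with hc
    · exact ⟨by simp, by simpa using hc.2, by simpa using searchVal_eq_zero.1 hc.1⟩
    · rw [if_neg hc] at h
      obtain ⟨h1, h2, h3⟩ := ih h
      exact ⟨by omega, h2, h3⟩

theorem searchVal_congr {p q : ℕ → Prop} {B : ℕ} (h : ∀ j, p j ↔ q j) :
    searchVal p B = searchVal q B := by
  rw [show p = q from funext fun j => propext (h j)]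

open Classical in
/-- The minimum of `c` and the values `v j` over all `j < B` with `p j`. -/
noncomputable def minVal (p : ℕ → Prop) (v : ℕ → ℝ) (c : ℝ) : ℕ → ℝ
  | 0 => c
  | B + 1 => if p B ∧ ¬ minVal p v c B ≤ v B then v B else minVal p v c B

theorem minVal_le_init (p : ℕ → Prop) (v : ℕ → ℝ) (c : ℝ) (B : ℕ) : minVal p v c B ≤ c := by
  induction B with
  | zero => simp [minVal]
  | succ B ih =>
    rw [minVal]
    split_ifs with h
    · exact (not_le.1 h.2).le.trans ih
    · exact ih

theorem minVal_le {p : ℕ → Prop} {v : ℕ → ℝ} {c : ℝ} {B j : ℕ} (hj : j < B) (hp : p j) :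
    minVal p v c B ≤ v j := by
  induction B with
  | zero => omega
  | succ B ih =>
    rw [minVal]
    split_ifs with h
    · rcases Nat.lt_succ_iff_lt_or_eq.1 hj with hj | rfl
      · exact (not_le.1 h.2).le.trans (ih hj)
      · exact le_rfl
    · rcases Nat.lt_succ_iff_lt_or_eq.1 hj with hj | rfl
      · exact ih hj
      · by_contra h'
        exact h ⟨hp, h'⟩

theorem minVal_mem (p : ℕ → Prop) (v : ℕ → ℝ) (c : ℝ) (B : ℕ) :
    minVal p v c B = c ∨ ∃ j < B, p j ∧ minVal p v c B = v j := by
  induction B with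
  | zero => simp [minVal]
  | succ B ih =>
    rw [minVal]
    split_ifs with h
    · exact .inr ⟨B, by omega, h.1, rfl⟩
    · rcases ih with h | ⟨j, hj, h1, h2⟩
      · exact .inl h
      · exact .inr ⟨j, by omega, h1, h2⟩

/-- What a statement writes to each cell: an integer body; a real body; `j + 1` for the least `j`
below the scalar `b` that passes a test, or `0`; the minimum of `c` and all `v` for `j` below the
scalar `b` that pass a test. -/
inductive Rule : Type
  | nat (p : NBody) : Rule
  | real (p : RBody) : Rule
  | search (b : ℕ) (p : Test) : Rule
  | min (b : ℕ) (p : Test) (v : RExp) (c : RExp) : Rule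

/-- A statement fills array `a`: for all loop variables below the scalars `bounds`, the cell indexed
by the loop variables (the first one raised by `1` if `shift`) gets the value of the rule. -/
structure Stmt where
  a : ℕ
  shift : Bool
  bounds : List ℕ
  rule : Rule

/-- Does the statement fill a real array? -/
def Rule.isReal : Rule → Bool
  | nat _ => false
  | real _ => true
  | search _ _ => false
  | min _ _ _ _ => true

/-- The content of an integer or real cell. -/
def Mem.get (σ : Mem) (r : Bool) (a : ℕ) (l : List ℕ) : ℕ ⊕ ℝ :=
  if r then .inr (σ.real a l) else .inl (σ.nat a l)

/-- The value of a rule when the loop variables are `z`. -/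
noncomputable def Rule.val (σ : Mem) (z : List ℕ) : Rule → ℕ ⊕ ℝ
  | nat p => .inl (p.eval (σ.view z))
  | real p => .inr (p.eval (σ.view z))
  | search b p => .inl (searchVal (fun j => p.Holds (σ.view (z ++ [j]))) (σ.nat b []))
  | min b p v c => .inr (minVal (fun j => p.Holds (σ.view (z ++ [j])))
      (fun j => v.eval (σ.view (z ++ [j]))) (c.eval (σ.view z)) (σ.nat b []))

/-- Write an integer or real value. -/
def Mem.set (σ : Mem) (a : ℕ) (l : List ℕ) : ℕ ⊕ ℝ → Mem
  | .inl v => σ.setNat a l v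
  | .inr v => σ.setReal a l v

/-- The cell in which a statement writes when the loop variables are `z`. -/
def cellIndex (shift : Bool) (z : List ℕ) : List ℕ :=
  if shift then z.modifyHead (· + 1) else z

/-- The index expressions for the written cell. -/
def cellExp (shift : Bool) (k : ℕ) (j : Fin k) : NExp :=
  if shift ∧ j.val = 0 then .add (.var 0) (.const 1) else .var j

theorem eval_cellExp (shift : Bool) {k : ℕ} (σ : Mem) (z w : List ℕ) (hz : z.length = k) :
    (List.ofFn fun j => (cellExp shift k j).eval (σ.view (z ++ w))) = cellIndex shift z := by
  subst hz
  have hget : ∀ j < z.length, (NExp.var j).eval (σ.view (z ++ w)) = z.getD j 0 := by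
    intro j hj
    simp [NExp.eval_var, List.getD, List.getElem?_append_left hj]
  apply List.ext_getElem
  · cases shift <;> simp [cellIndex]
  · intro i h1 h2
    have hi : i < z.length := by simpa using h1
    rw [List.getElem_ofFn]
    unfold cellExp cellIndex
    cases shift with
    | false => simp [hget i hi, List.getElem?_eq_getElem hi]
    | true =>
      cases z with
      | nil => simp at hi
      | cons a z =>
        cases i with
        | zero => simpa [NExp.eval] using hget 0 (by simp)
        | succ i =>
          have hi' : i < z.length := by simpa using hi
          have := hget (i + 1) hi
          simpa [List.getElem?_eq_getElem hi'] using this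

/-- The program of the innermost part of a statement. -/
def Rule.prog (a : ℕ) (shift : Bool) (k : ℕ) : Rule → Prog
  | nat p => p.prog a (cellExp shift k)
  | real p => p.prog a (cellExp shift k)
  | search b p =>
    .seq (.natSet a (cellExp shift k) (.const 0))
      (forLoop k b (.ite (.conj (.natLE (.read a (cellExp shift k)) (.const 0)) p)
        (.natSet a (cellExp shift k) (.add (.var k) (.const 1))) .skip))
  | min b p v c =>
    .seq (.realSet a (cellExp shift k) c)
      (forLoop k b (.ite (.conj p (.neg (.realLE (.read a (cellExp shift k)) v)))
        (.realSet a (cellExp shift k) v) .skip))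

/-- The program of a statement. -/
def Stmt.prog (s : Stmt) : Prog :=
  forLoops 0 s.bounds (s.rule.prog s.a s.shift s.bounds.length)

/-! ### What an expression reads -/

/-- Is this the constant `0`? -/
def NExp.isZero : NExp → Bool
  | const c => c == 0
  | _ => false

/-- Is this the loop variable number `0`? -/
def NExp.isVarZero : NExp → Bool
  | read a idx => a == 9 && (List.ofFn fun j => (idx j).isZero) == [true]
  | _ => false

/-- The arrays read by an expression: the first entry is `true` for real arrays, the last one is
`true` if the first index is the loop variable number `0`. -/
def NExp.uses : NExp → List (Bool × ℕ × Bool)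
  | const _ => []
  | read a idx => (false, a, (List.ofFn fun j => (idx j).isVarZero).headD false) ::
      (List.ofFn fun j => (idx j).uses).flatten
  | add x y => x.uses ++ y.uses
  | sub x y => x.uses ++ y.uses

/-- The arrays read by a real expression. -/
def RExp.uses : RExp → List (Bool × ℕ × Bool)
  | zero => []
  | read a idx => (true, a, (List.ofFn fun j => (idx j).isVarZero).headD false) ::
      (List.ofFn fun j => (idx j).uses).flatten
  | add x y => x.uses ++ y.uses
  | sub x y => x.uses ++ y.uses

/-- The arrays read by a test. -/
def Test.uses : Test → List (Bool × ℕ × Bool)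
  | natLE x y => x.uses ++ y.uses
  | realLE x y => x.uses ++ y.uses
  | neg b => b.uses
  | conj b b' => b.uses ++ b'.uses

/-- The arrays read by an integer body. -/
def NBody.uses : NBody → List (Bool × ℕ × Bool)
  | ret x => x.uses
  | ite b p q => b.uses ++ p.uses ++ q.uses

/-- The arrays read by a real body. -/
def RBody.uses : RBody → List (Bool × ℕ × Bool)
  | ret x => x.uses
  | ite b p q => b.uses ++ p.uses ++ q.uses

/-- The arrays read by a rule. -/
def Rule.uses : Rule → List (Bool × ℕ × Bool)
  | nat p => p.uses
  | real p => p.uses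
  | search b p => (false, b, false) :: p.uses
  | min b p v c => (false, b, false) :: (p.uses ++ v.uses ++ c.uses)

/-- The scalars that bound the inner loop of a rule. -/
def Rule.bounds : Rule → List ℕ
  | nat _ => []
  | real _ => []
  | search b _ => [b]
  | min b _ _ _ => [b]

/-- `σ` and `σ'` agree on all that is read according to `U`, if the loop variable number `0`
is `h`. -/
def Mem.SameOn (U : List (Bool × ℕ × Bool)) (h : ℕ) (σ σ' : Mem) : Prop :=
  ∀ u ∈ U, ∀ l, (u.2.2 = true → l.head? = some h) → σ.get u.1 u.2.1 l = σ'.get u.1 u.2.1 l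

theorem Mem.SameOn.mono {U V : List (Bool × ℕ × Bool)} {h : ℕ} {σ σ' : Mem}
    (H : Mem.SameOn V h σ σ') (hUV : ∀ u ∈ U, u ∈ V) : Mem.SameOn U h σ σ' :=
  fun u hu => H u (hUV u hu)

theorem NExp.eval_of_isVarZero {e : NExp} (he : e.isVarZero = true) (σ : Mem) (x : List ℕ) :
    e.eval (σ.view x) = x.getD 0 0 := by
  cases e with
  | const c => simp [isVarZero] at he
  | add x y => simp [isVarZero] at he
  | sub x y => simp [isVarZero] at he
  | read a idx =>
    rename_i k
    simp only [isVarZero, Bool.and_eq_true, beq_iff_eq] at he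
    obtain ⟨rfl, h⟩ := he
    have hk : k = 1 := by simpa using congrArg List.length h
    subst hk
    have h0 : (idx 0).isZero = true := by simpa using h
    have : (idx 0).eval (σ.view x) = 0 := by
      cases hc : idx 0 with
      | const c => rw [hc] at h0; simpa [isZero, eval] using h0
      | _ => rw [hc] at h0; simp [isZero] at h0
    simp [eval, this, Mem.view_nat_self]

theorem head_ofFn_eval {k : ℕ} {idx : Fin k → NExp}
    (h : (List.ofFn fun j => (idx j).isVarZero).headD false = true) (σ : Mem) (x : List ℕ) :
    (List.ofFn fun j => (idx j).eval (σ.view x)).head? = some (x.getD 0 0) := by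
  cases k with
  | zero => simp at h
  | succ k =>
    simp only [List.ofFn_succ, List.headD_cons] at h
    simp only [List.ofFn_succ, List.head?_cons, Option.some.injEq]
    exact NExp.eval_of_isVarZero h σ x

theorem NExp.eval_congr {σ σ' : Mem} {x : List ℕ} (e : NExp)
    (h : Mem.SameOn e.uses (x.getD 0 0) σ σ') : e.eval (σ.view x) = e.eval (σ'.view x) := by
  induction e with
  | const c => rfl
  | add e f he hf =>
    simp only [eval, he (h.mono fun u hu => by simp [uses, hu]),
      hf (h.mono fun u hu => by simp [uses, hu])]
  | sub e f he hf =>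
    simp only [eval, he (h.mono fun u hu => by simp [uses, hu]),
      hf (h.mono fun u hu => by simp [uses, hu])]
  | read a idx ih =>
    have hi : ∀ j, (idx j).eval (σ.view x) = (idx j).eval (σ'.view x) := fun j =>
      ih j (h.mono fun u hu => by
        simp only [uses, List.mem_cons, List.mem_flatten, List.mem_ofFn]
        exact .inr ⟨_, ⟨j, rfl⟩, hu⟩)
    simp only [eval, ← hi]
    -- Array `9` is replaced by the view, so it agrees in both memories whatever they contain.
    by_cases ha : a = 9
    · subst ha; simp [Mem.view]
    · rw [Mem.view_nat_ne _ _ ha, Mem.view_nat_ne _ _ ha]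
      have := h _ (by simp [uses]; exact .inl rfl) (List.ofFn fun j => (idx j).eval (σ.view x))
        (fun hu => head_ofFn_eval (by simpa using hu) σ x)
      simpa [Mem.get] using this

theorem RExp.eval_congr {σ σ' : Mem} {x : List ℕ} (e : RExp)
    (h : Mem.SameOn e.uses (x.getD 0 0) σ σ') : e.eval (σ.view x) = e.eval (σ'.view x) := by
  induction e with
  | zero => rfl
  | add e f he hf =>
    simp only [eval, he (h.mono fun u hu => by simp [uses, hu]),
      hf (h.mono fun u hu => by simp [uses, hu])]
  | sub e f he hf =>
    simp only [eval, he (h.mono fun u hu => by simp [uses, hu]),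
      hf (h.mono fun u hu => by simp [uses, hu])]
  | read a idx =>
    have hi : ∀ j, (idx j).eval (σ.view x) = (idx j).eval (σ'.view x) := fun j =>
      (idx j).eval_congr (h.mono fun u hu => by
        simp only [uses, List.mem_cons, List.mem_flatten, List.mem_ofFn]
        exact .inr ⟨_, ⟨j, rfl⟩, hu⟩)
    simp only [eval, ← hi, Mem.view_real]
    have := h _ (by simp [uses]; exact .inl rfl) (List.ofFn fun j => (idx j).eval (σ.view x))
      (fun hu => head_ofFn_eval (by simpa using hu) σ x)
    simpa [Mem.get] using this

theorem Test.holds_congr {σ σ' : Mem} {x : List ℕ} (b : Test)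
    (h : Mem.SameOn b.uses (x.getD 0 0) σ σ') : b.Holds (σ.view x) ↔ b.Holds (σ'.view x) := by
  induction b with
  | natLE e f =>
    simp only [Holds, e.eval_congr (h.mono fun u hu => by simp [uses, hu]),
      f.eval_congr (h.mono fun u hu => by simp [uses, hu])]
  | realLE e f =>
    simp only [Holds, e.eval_congr (h.mono fun u hu => by simp [uses, hu]),
      f.eval_congr (h.mono fun u hu => by simp [uses, hu])]
  | neg b ih => simp only [Holds, ih h]
  | conj b b' ih ih' =>
    simp only [Holds, ih (h.mono fun u hu => by simp [uses, hu]),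
      ih' (h.mono fun u hu => by simp [uses, hu])]

theorem NBody.eval_congr {σ σ' : Mem} {x : List ℕ} (p : NBody)
    (h : Mem.SameOn p.uses (x.getD 0 0) σ σ') : p.eval (σ.view x) = p.eval (σ'.view x) := by
  induction p with
  | ret e => exact e.eval_congr h
  | ite b p q hp hq =>
    have hb := b.holds_congr (h.mono fun u hu => by simp [uses, hu])
    simp only [eval, hp (h.mono fun u hu => by simp [uses, hu]),
      hq (h.mono fun u hu => by simp [uses, hu])]
    by_cases hc : b.Holds (σ.view x)
    · rw [if_pos hc, if_pos (hb.1 hc)]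
    · rw [if_neg hc, if_neg (mt hb.2 hc)]

theorem RBody.eval_congr {σ σ' : Mem} {x : List ℕ} (p : RBody)
    (h : Mem.SameOn p.uses (x.getD 0 0) σ σ') : p.eval (σ.view x) = p.eval (σ'.view x) := by
  induction p with
  | ret e => exact e.eval_congr h
  | ite b p q hp hq =>
    have hb := b.holds_congr (h.mono fun u hu => by simp [uses, hu])
    simp only [eval, hp (h.mono fun u hu => by simp [uses, hu]),
      hq (h.mono fun u hu => by simp [uses, hu])]
    by_cases hc : b.Holds (σ.view x)
    · rw [if_pos hc, if_pos (hb.1 hc)]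
    · rw [if_neg hc, if_neg (mt hb.2 hc)]

theorem Rule.val_congr {σ σ' : Mem} {z : List ℕ} (r : Rule)
    (h : ∀ w, Mem.SameOn r.uses ((z ++ w).getD 0 0) σ σ') : r.val σ z = r.val σ' z := by
  have h0 := h []
  rw [List.append_nil] at h0
  have hb : ∀ b, (false, b, false) ∈ r.uses → σ.nat b [] = σ'.nat b [] := fun b hb => by
    simpa [Mem.get] using h0 _ hb [] (by simp)
  cases r with
  | nat p => simp only [val, p.eval_congr h0]
  | real p => simp only [val, p.eval_congr h0]
  | search b p =>
    simp only [val, hb b (by simp [uses])]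
    congr 1
    exact searchVal_congr fun j => p.holds_congr ((h [j]).mono fun u hu => by simp [uses, hu])
  | min b p v c =>
    have h1 : ∀ j, p.Holds (σ.view (z ++ [j])) ↔ p.Holds (σ'.view (z ++ [j])) := fun j =>
      p.holds_congr ((h [j]).mono fun u hu => by simp [uses, hu])
    have h2 : ∀ j, v.eval (σ.view (z ++ [j])) = v.eval (σ'.view (z ++ [j])) := fun j =>
      v.eval_congr ((h [j]).mono fun u hu => by simp [uses, hu])
    simp only [val, hb b (by simp [uses]), h1, h2,
      c.eval_congr (h0.mono fun u hu => by simp [uses, hu])]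

/-! ### Execution of statements -/

theorem Rule.isRight_val (r : Rule) (σ : Mem) (z : List ℕ) : (r.val σ z).isRight = r.isReal := by
  cases r <;> rfl

theorem Mem.get_set (σ : Mem) (a : ℕ) (l : List ℕ) (v : ℕ ⊕ ℝ) (r : Bool) (a' : ℕ) (l' : List ℕ) :
    (σ.set a l v).get r a' l' =
      if r = v.isRight ∧ a' = a ∧ l' = l then v else σ.get r a' l' := by
  cases v with
  | inl v =>
    cases r with
    | true => simp [get, set, setNat]
    | false =>
      by_cases ha : a' = a
      · subst ha
        by_cases hl : l' = l
        · subst hl; simp [get, set, setNat]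
        · simp [get, set, setNat, hl]
      · simp [get, set, setNat, ha]
  | inr v =>
    cases r with
    | false => simp [get, set, setReal]
    | true =>
      by_cases ha : a' = a
      · subst ha
        by_cases hl : l' = l
        · subst hl; simp [get, set, setReal]
        · simp [get, set, setReal, hl]
      · simp [get, set, setReal, ha]

/-- Well-formedness of a single statement: it reads the array it fills only where its first index is
below that of the written cell. -/
def Stmt.wf (s : Stmt) : Bool :=
  (s.rule.isReal || s.a != 9) && (!s.shift || s.bounds != []) && !s.bounds.contains 9 &&
  (s.rule.isReal || !s.bounds.contains s.a) && !s.rule.bounds.contains 9 &&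
  s.rule.uses.all fun u => (u.1 != s.rule.isReal || u.2.1 != s.a) || (u.2.2 && s.shift)

/-- A write at `z'` goes to the layer with first index one above the head of `z'`, while the rule at
`z` reads its own array only in the layer of the head of `z`, which is lower. So neither its own
write nor a later one alters the value of the rule at `z`. -/
theorem sameOn_set {s : Stmt} (hs : s.wf = true) {z z' : List ℕ}
    (hz : z.length = s.bounds.length) (hz' : z'.length = s.bounds.length)
    (hle : z.headD 0 ≤ z'.headD 0) (w : List ℕ) (σ : Mem) (v : ℕ ⊕ ℝ)
    (hv : v.isRight = s.rule.isReal) :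
    Mem.SameOn s.rule.uses ((z ++ w).getD 0 0) (σ.set s.a (cellIndex s.shift z') v) σ := by
  simp only [Stmt.wf, Bool.and_eq_true, List.all_eq_true] at hs
  obtain ⟨⟨⟨⟨⟨_, hsh⟩, _⟩, _⟩, _⟩, hu⟩ := hs
  intro u hmem l hl
  rw [Mem.get_set, if_neg]
  rintro ⟨h1, h2, rfl⟩
  have := hu u hmem
  simp only [h1, h2, hv, bne_self_eq_false, Bool.false_or, Bool.and_eq_true] at this
  have hl := hl this.1
  rw [this.2] at hl hsh
  cases z with
  | nil =>
    have : s.bounds = [] := List.length_eq_zero_iff.1 hz.symm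
    simp [this] at hsh
  | cons i z =>
    cases z' with
    | nil => simp at hz' hz; omega
    | cons i' z' =>
      simp [cellIndex] at hl hle
      omega

/-- A bound on the number of steps of a rule, where `S` bounds all scalars that occur as bounds. -/
def Rule.steps (S : ℕ) : Rule → ℕ
  | nat p => p.size
  | real p => p.size
  | search _ _ => S * 4 + 3
  | min _ _ _ _ => S * 4 + 3

/-- Searches and minima keep their running value in the target cell. The rule does not read this
cell, so its tests and values mean the same in every round. -/
theorem Rule.exec {s : Stmt} (hs : s.wf = true) {z : List ℕ} (hz : z.length = s.bounds.length)
    (σ : Mem) {S : ℕ} (hS : ∀ b ∈ s.rule.bounds, σ.nat b [] ≤ S) :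
    ∃ T ≤ s.rule.steps S, Exec (s.rule.prog s.a s.shift s.bounds.length) (σ.view z) T
      ((σ.set s.a (cellIndex s.shift z) (s.rule.val σ z)).view z) := by
  have hsame := fun (w : List ℕ) (v : ℕ ⊕ ℝ) (hv : v.isRight = s.rule.isReal) =>
    sameOn_set hs hz hz le_rfl w σ v hv
  have ha : s.rule.isReal = true ∨ s.a ≠ 9 := by
    simp only [Stmt.wf, Bool.and_eq_true, Bool.or_eq_true, bne_iff_ne] at hs
    tauto
  have h9 : 9 ∉ s.rule.bounds := by
    simp only [Stmt.wf, Bool.and_eq_true] at hs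
    simpa using hs.1.2
  obtain ⟨a, sh, bs, r⟩ := s
  dsimp only at *
  have hidx := fun w => eval_cellExp sh σ z w hz
  have hidx0 := hidx []
  rw [List.append_nil] at hidx0
  cases r with
  | nat p =>
    have ha : a ≠ 9 := by simpa [isReal] using ha
    obtain ⟨T, hT, hE⟩ := p.exec a (cellExp sh bs.length) (σ.view z)
    rw [hidx0, Mem.setNat_view _ _ ha] at hE
    exact ⟨T, hT, hE⟩
  | real p =>
    obtain ⟨T, hT, hE⟩ := p.exec a (cellExp sh bs.length) (σ.view z)
    rw [hidx0] at hE
    exact ⟨T, hT, hE⟩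
  | search b p =>
    have ha : a ≠ 9 := by simpa [isReal] using ha
    have hb : b ≠ 9 := by rintro rfl; simp [bounds] at h9
    set c := cellIndex sh z with hc
    let P : ℕ → Prop := fun j => p.Holds (σ.view (z ++ [j]))
    let st : ℕ → Mem := fun j => σ.setNat a c (searchVal P j)
    have hab : ∀ v, (σ.setNat a c v).nat b [] = σ.nat b [] := fun v => by
      have := hsame [] (.inl v) rfl (false, b, false) (by simp [uses]) [] (by simp)
      simpa [Mem.get, Mem.set] using this
    have hP : ∀ j v, p.Holds ((σ.setNat a c v).view (z ++ [j])) ↔ P j := fun j v =>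
      p.holds_congr ((hsame [j] (.inl v) rfl).mono fun u hu => by simp [uses, hu])
    obtain ⟨T, hT, hE⟩ := exec_forLoop (t := 2) (x := z) (B := σ.nat b []) hb
      (p := .ite (.conj (.natLE (.read a (cellExp sh bs.length)) (.const 0)) p)
        (.natSet a (cellExp sh bs.length) (.add (.var bs.length) (.const 1))) .skip) st
      (fun j _ => hab _) (by
        intro j _
        have hread : (NExp.read a (cellExp sh bs.length)).eval ((st j).view (z ++ [j])) =
            searchVal P j := by
          rw [NExp.eval, eval_cellExp sh _ z _ hz, Mem.view_nat_ne _ _ ha]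
          simp [st, Mem.setNat, hc]
        have htest : (Test.conj (.natLE (.read a (cellExp sh bs.length)) (.const 0)) p).Holds
            ((st j).view (z ++ [j])) ↔ (searchVal P j = 0 ∧ P j) := by
          rw [Test.Holds, Test.Holds, hread, hP]
          simp [NExp.eval]
        by_cases h : searchVal P j = 0 ∧ P j
        · refine ⟨2, le_rfl, Exec.iteTrue (htest.2 h) ?_⟩
          have := Exec.natSet ((st j).view (z ++ [j])) a (cellExp sh bs.length)
            (.add (.var bs.length) (.const 1))
          rw [eval_cellExp sh _ z _ hz, Mem.setNat_view _ _ ha] at this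
          convert this using 2
          simp only [st, searchVal, if_pos h, NExp.eval, NExp.eval_var, ← hz]
          simp [Mem.setNat, hc]
        · refine ⟨2, le_rfl, Exec.iteFalse (mt htest.1 h) ?_⟩
          have : st (j + 1) = st j := by simp only [st, searchVal, if_neg h]
          rw [this]
          exact Exec.skip _)
    refine ⟨1 + T, ?_, Exec.seq ?_ (hz ▸ hE)⟩
    · have := hS b (by simp [bounds])
      simp only [steps]
      omega
    · have := Exec.natSet (σ.view z) a (cellExp sh bs.length) (.const 0)
      rwa [hidx0, Mem.setNat_view _ _ ha] at this
  | min b p v i =>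
    have hb : b ≠ 9 := by rintro rfl; simp [bounds] at h9
    set c := cellIndex sh z with hc
    let P : ℕ → Prop := fun j => p.Holds (σ.view (z ++ [j]))
    let V : ℕ → ℝ := fun j => v.eval (σ.view (z ++ [j]))
    let st : ℕ → Mem := fun j => σ.setReal a c (minVal P V (i.eval (σ.view z)) j)
    have hP : ∀ j x, p.Holds ((σ.setReal a c x).view (z ++ [j])) ↔ P j := fun j x =>
      p.holds_congr ((hsame [j] (.inr x) rfl).mono fun u hu => by simp [uses, hu])
    have hV : ∀ j x, v.eval ((σ.setReal a c x).view (z ++ [j])) = V j := fun j x =>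
      v.eval_congr ((hsame [j] (.inr x) rfl).mono fun u hu => by simp [uses, hu])
    obtain ⟨T, hT, hE⟩ := exec_forLoop (t := 2) (x := z) (B := σ.nat b []) hb
      (p := .ite (.conj p (.neg (.realLE (.read a (cellExp sh bs.length)) v)))
        (.realSet a (cellExp sh bs.length) v) .skip) st
      (fun j _ => rfl) (by
        intro j _
        have hread : (RExp.read a (cellExp sh bs.length)).eval ((st j).view (z ++ [j])) =
            minVal P V (i.eval (σ.view z)) j := by
          rw [RExp.eval, eval_cellExp sh _ z _ hz, Mem.view_real]
          simp [st, Mem.setReal, hc]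
        have htest : (Test.conj p (.neg (.realLE (.read a (cellExp sh bs.length)) v))).Holds
            ((st j).view (z ++ [j])) ↔ (P j ∧ ¬ minVal P V (i.eval (σ.view z)) j ≤ V j) := by
          simp only [Test.Holds, hread]
          rw [hP, hV]
        by_cases h : P j ∧ ¬ minVal P V (i.eval (σ.view z)) j ≤ V j
        · refine ⟨2, le_rfl, Exec.iteTrue (htest.2 h) ?_⟩
          have := Exec.realSet ((st j).view (z ++ [j])) a (cellExp sh bs.length) v
          rw [eval_cellExp sh _ z _ hz, Mem.setReal_view, hV] at this
          convert this using 2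
          simp only [st, minVal, if_pos h]
          simp [Mem.setReal, hc]
        · refine ⟨2, le_rfl, Exec.iteFalse (mt htest.1 h) ?_⟩
          have : st (j + 1) = st j := by simp only [st, minVal, if_neg h]
          rw [this]
          exact Exec.skip _)
    refine ⟨1 + T, ?_, Exec.seq ?_ (hz ▸ hE)⟩
    · have := hS b (by simp [bounds])
      simp only [steps]
      omega
    · have := Exec.realSet (σ.view z) a (cellExp sh bs.length) i
      rwa [hidx0, Mem.setReal_view] at this

/-- The statement holds as an equation in the memory `τ`. -/
def Stmt.Holds (s : Stmt) (τ : Mem) : Prop :=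
  ∀ z ∈ loopValues (s.bounds.map fun b => τ.nat b []),
    τ.get s.rule.isReal s.a (cellIndex s.shift z) = s.rule.val τ z

theorem cellIndex_injective (shift : Bool) : Function.Injective (cellIndex shift) := by
  intro z z' h
  cases shift with
  | false => simpa [cellIndex] using h
  | true =>
    cases z <;> cases z' <;> simp_all [cellIndex]

theorem Rule.mem_uses_of_mem_bounds {r : Rule} {b : ℕ} (h : b ∈ r.bounds) :
    (false, b, false) ∈ r.uses := by
  cases r <;> simp [bounds] at h <;> simp [uses, h]

theorem Stmt.bound_ne_target {s : Stmt} (hs : s.wf = true) {b : ℕ}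
    (hb : b ∈ s.bounds ++ s.rule.bounds) : (false, b) ≠ (s.rule.isReal, s.a) := by
  intro h
  simp only [Prod.mk.injEq] at h
  simp only [Stmt.wf, Bool.and_eq_true, Bool.or_eq_true, List.all_eq_true,
    List.contains_eq_mem, decide_eq_false_iff_not, Bool.not_eq_eq_eq_not,
    Bool.not_true, bne_iff_ne] at hs
  rcases List.mem_append.1 hb with hb | hb
  · rcases hs.1.1.2 with h' | h'
    · rw [h'] at h; simp at h
    · exact h' (h.2 ▸ hb)
  · rcases hs.2 _ (Rule.mem_uses_of_mem_bounds hb) with (h' | h') | h'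
    · exact h' h.1
    · exact h' h.2
    · simp at h'

/-- Once the cell for `z` is written, later writes hit other cells and, by `sameOn_set`, leave the
value of the rule at `z` alone. So the assignment made in passing is an equation in the final
memory. The last clause protects layer `0` of a shifted array, the initial values of the recursion.
-/
theorem Stmt.exec {s : Stmt} (hs : s.wf = true) (σ : Mem) {S : ℕ}
    (hS : ∀ b ∈ s.bounds ++ s.rule.bounds, σ.nat b [] ≤ S) :
    ∃ T ≤ (s.rule.steps S + 4) * (S + 5) ^ s.bounds.length, ∃ τ,
      Exec s.prog (σ.view []) T (τ.view []) ∧ s.Holds τ ∧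
      (∀ r a, (r, a) ≠ (s.rule.isReal, s.a) → ∀ l, τ.get r a l = σ.get r a l) ∧
      ∀ l, s.shift = true → l.headD 0 = 0 →
        τ.get s.rule.isReal s.a l = σ.get s.rule.isReal s.a l := by
  let leaf : List ℕ → Mem → Mem := fun z τ => τ.set s.a (cellIndex s.shift z) (s.rule.val τ z)
  have hframe : ∀ z τ r a, (r, a) ≠ (s.rule.isReal, s.a) → ∀ l, (leaf z τ).get r a l = τ.get r a l := by
    intro z τ r a h l
    rw [Mem.get_set, if_neg]
    rintro ⟨h1, h2, -⟩
    rw [Rule.isRight_val] at h1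
    exact h (by rw [h1, h2])
  have hnat : ∀ z τ b, (false, b) ≠ (s.rule.isReal, s.a) → (leaf z τ).nat b = τ.nat b := by
    intro z τ b h
    funext l
    simpa [Mem.get] using hframe z τ false b h l
  have hwf := hs
  simp only [Stmt.wf, Bool.and_eq_true, Bool.or_eq_true, bne_iff_ne, List.all_eq_true,
    List.contains_eq_mem, decide_eq_false_iff_not, Bool.not_eq_eq_eq_not,
    Bool.not_true] at hwf
  obtain ⟨⟨⟨⟨⟨_, hsh⟩, h9⟩, _⟩, _⟩, _⟩ := hwf
  have hbs : ∀ b ∈ s.bounds, (false, b) ≠ (s.rule.isReal, s.a) := fun b hb =>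
    Stmt.bound_ne_target hs (by simp [hb])
  have hrb : ∀ b ∈ s.rule.bounds, (false, b) ≠ (s.rule.isReal, s.a) := fun b hb =>
    Stmt.bound_ne_target hs (by simp [hb])
  obtain ⟨T, hT, hE⟩ := exec_forLoops leaf s.bounds h9
    (fun z τ b hb => hnat z τ b (hbs b hb)) (s.rule.prog s.a s.shift s.bounds.length)
    (S := S) (t := s.rule.steps S) (fun τ => ∀ b ∈ s.rule.bounds, τ.nat b [] ≤ S)
    (fun z τ h b hb => by rw [hnat z τ b (hrb b hb)]; exact h b hb) [] σ
    (fun b hb => hS b (by simp [hb])) (fun b hb => hS b (by simp [hb]))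
    (fun τ z h hz => Rule.exec hs (by simpa using hz) τ h)
  refine ⟨T, hT, _, hE, ?_⟩
  simp only [List.nil_append]
  set Z := loopValues (s.bounds.map fun b => σ.nat b []) with hZ
  have hlen : ∀ z ∈ Z, z.length = s.bounds.length := fun z hz => by
    simpa using (mem_loopValues.1 hz).length_eq
  have hfoldframe : ∀ (Y : List (List ℕ)) τ r a, (r, a) ≠ (s.rule.isReal, s.a) → ∀ l,
      (Y.foldl (fun τ y => leaf y τ) τ).get r a l = τ.get r a l := by
    intro Y
    induction Y with
    | nil => simp
    | cons y Y ih =>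
      intro τ r a h l
      rw [List.foldl_cons, ih _ r a h, hframe _ _ _ _ h]
  have hfoldcell : ∀ (Y : List (List ℕ)) τ l, (∀ y ∈ Y, cellIndex s.shift y ≠ l) →
      (Y.foldl (fun τ y => leaf y τ) τ).get s.rule.isReal s.a l = τ.get s.rule.isReal s.a l := by
    intro Y
    induction Y with
    | nil => simp
    | cons y Y ih =>
      intro τ l h
      rw [List.foldl_cons, ih _ l fun y' hy' => h y' (by simp [hy']), Mem.get_set, if_neg]
      rintro ⟨-, -, h'⟩
      exact h y (by simp) h'.symm
  refine ⟨?_, fun r a h l => hfoldframe Z σ r a h l, ?_⟩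
  · have hmap : (s.bounds.map fun b => (Z.foldl (fun τ y => leaf y τ) σ).nat b []) =
        s.bounds.map fun b => σ.nat b [] := List.map_congr_left fun b hb => by
      simpa [Mem.get] using hfoldframe Z σ false b (hbs b hb) []
    unfold Stmt.Holds
    rw [hmap, ← hZ]
    have hpw : Z.Pairwise fun z z' => z ≠ z' ∧ z.headD 0 ≤ z'.headD 0 := pairwise_loopValues _
    clear_value Z
    clear hZ hE hmap
    induction Z generalizing σ with
    | nil => simp
    | cons y Y ih =>
      rw [List.pairwise_cons] at hpw
      have hval : ∀ (X : List (List ℕ)) τ, (∀ x ∈ X, x.length = s.bounds.length ∧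
          y.headD 0 ≤ x.headD 0) →
          s.rule.val (X.foldl (fun τ y => leaf y τ) τ) y = s.rule.val τ y := by
        intro X
        induction X with
        | nil => simp
        | cons x X ihX =>
          intro τ hX
          rw [List.foldl_cons, ihX _ fun x' hx' => hX x' (by simp [hx'])]
          exact Rule.val_congr _ fun w => sameOn_set hs (hlen y (by simp)) (hX x (by simp)).1
            (hX x (by simp)).2 w τ _ (Rule.isRight_val _ _ _)
      intro z hz
      rw [List.mem_cons] at hz
      rcases hz with rfl | hz
      · rw [hval (z :: Y) σ (by
          intro x hx
          rcases List.mem_cons.1 hx with rfl | hx'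
          · exact ⟨hlen _ (by simp), le_rfl⟩
          · exact ⟨hlen _ hx, (hpw.1 x hx').2⟩)]
        rw [List.foldl_cons, hfoldcell, Mem.get_set, if_pos ⟨(Rule.isRight_val _ _ _).symm, rfl, rfl⟩]
        intro x hx h
        exact (hpw.1 x hx).1 (cellIndex_injective _ h).symm
      · rw [List.foldl_cons]
        exact ih (leaf y σ) (fun b hb => by
          have hne : (false, b) ≠ (s.rule.isReal, s.a) := by
            rcases List.mem_append.1 hb with h | h
            · exact hbs b h
            · exact hrb b h
          rw [hnat _ _ _ hne]; exact hS b hb)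
          (fun z hz => hlen z (by simp [hz])) hpw.2 z hz
  · intro l h0 hl
    refine hfoldcell Z σ l fun y hy h => ?_
    have hne : s.bounds ≠ [] := by
      rcases hsh with h | h
      · rw [h0] at h; simp at h
      · exact h
    subst h
    cases y with
    | nil => exact hne (List.length_eq_zero_iff.1 (hlen _ hy).symm)
    | cons i y => simp [cellIndex, h0] at hl

/-! ### Execution of programs -/

/-- The array filled by a statement. -/
def Stmt.target (s : Stmt) : Bool × ℕ := (s.rule.isReal, s.a)

/-- The statement `s'` does not overwrite anything that `s` reads or writes. -/
def Stmt.keeps (s s' : Stmt) : Bool :=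
  s'.target != s.target && (s.bounds ++ s.rule.bounds).all (fun b => s'.target != (false, b)) &&
    s.rule.uses.all fun u => s'.target != (u.1, u.2.1)

/-- Well-formedness of a program. -/
def wfProg : List Stmt → Bool
  | [] => true
  | s :: L => s.wf && L.all s.keeps && wfProg L

/-- The program of a list of statements. -/
def compile : List Stmt → Prog
  | [] => .skip
  | s :: L => .seq s.prog (compile L)

theorem Stmt.Holds.of_keeps {s : Stmt} {σ τ : Mem} (h : s.Holds σ)
    (hT : ∀ l, τ.get s.rule.isReal s.a l = σ.get s.rule.isReal s.a l)
    (hb : ∀ b ∈ s.bounds, τ.nat b [] = σ.nat b [])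
    (hu : ∀ u ∈ s.rule.uses, ∀ l, τ.get u.1 u.2.1 l = σ.get u.1 u.2.1 l) : s.Holds τ := by
  intro z hz
  rw [List.map_congr_left hb] at hz
  rw [hT, h z hz]
  exact (Rule.val_congr _ fun w u hm l _ => hu u hm l).symm

/-- No statement overwrites what an earlier one has read or written, so all equations hold together
in the end. The time is bounded through the final memory `τ`, since the loop bounds may be computed
by the program itself and are then known only through its equations. -/
theorem exec_compile (L : List Stmt) (hL : wfProg L = true) : ∃ C D : ℕ, ∀ σ : Mem, ∃ T τ,
    Exec (compile L) (σ.view []) T (τ.view []) ∧ (∀ s ∈ L, s.Holds τ) ∧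
    (∀ r a, (∀ s ∈ L, s.target ≠ (r, a)) → ∀ l, τ.get r a l = σ.get r a l) ∧
    (∀ s ∈ L, s.shift = true → ∀ l, l.headD 0 = 0 →
      τ.get s.rule.isReal s.a l = σ.get s.rule.isReal s.a l) ∧
    ∀ S, (∀ s ∈ L, ∀ b ∈ s.bounds ++ s.rule.bounds, τ.nat b [] ≤ S) → T ≤ C * (S + 5) ^ D := by
  induction L with
  | nil => exact ⟨1, 0, fun σ => ⟨1, σ, Exec.skip _, by simp, by simp, by simp, by simp⟩⟩
  | cons s L ih =>
    simp only [wfProg, Bool.and_eq_true, List.all_eq_true] at hL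
    obtain ⟨⟨hs, hkeep⟩, hL⟩ := hL
    obtain ⟨C, D, H⟩ := ih hL
    obtain ⟨c, hc⟩ : ∃ c, ∀ S, s.rule.steps S + 4 ≤ c * (S + 5) := by
      cases s.rule with
      | nat p => exact ⟨p.size + 1, fun S => by simp only [Rule.steps]; nlinarith [Nat.zero_le (p.size * S)]⟩
      | real p => exact ⟨p.size + 1, fun S => by simp only [Rule.steps]; nlinarith [Nat.zero_le (p.size * S)]⟩
      | search b p => exact ⟨4, fun S => by simp only [Rule.steps]; omega⟩
      | min b p v c => exact ⟨4, fun S => by simp only [Rule.steps]; omega⟩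
    refine ⟨c + C, max (s.bounds.length + 1) D, fun σ => ?_⟩
    have hle₀ : ∀ b ∈ s.bounds ++ s.rule.bounds, σ.nat b [] ≤
        ((s.bounds ++ s.rule.bounds).map fun b => σ.nat b []).foldr max 0 := by
      generalize s.bounds ++ s.rule.bounds = l
      induction l with
      | nil => simp
      | cons b l ih =>
        intro b' hb'
        rw [List.map_cons, List.foldr_cons, le_max_iff]
        rcases List.mem_cons.1 hb' with rfl | hb'
        · exact .inl le_rfl
        · exact .inr (ih b' hb')
    obtain ⟨T, hT, τ₁, hE₁, hh₁, hf₁, hz₁⟩ := s.exec hs σ hle₀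
    obtain ⟨U, τ, hE, hh, hf, hz, ht⟩ := H τ₁
    have hk : ∀ s' ∈ L, s'.target ≠ s.target ∧
        (∀ b ∈ s.bounds ++ s.rule.bounds, s'.target ≠ (false, b)) ∧
        ∀ u ∈ s.rule.uses, s'.target ≠ (u.1, u.2.1) := by
      intro s' hs'
      have := hkeep s' hs'
      simp only [Stmt.keeps, Bool.and_eq_true, bne_iff_ne, List.all_eq_true] at this
      exact ⟨this.1.1, this.1.2, this.2⟩
    have hself : ∀ l, τ.get s.rule.isReal s.a l = τ₁.get s.rule.isReal s.a l :=
      hf _ _ fun s' hs' => (hk s' hs').1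
    have hbd : ∀ b ∈ s.bounds ++ s.rule.bounds, τ.nat b [] = τ₁.nat b [] := fun b hb => by
      simpa [Mem.get] using hf false b (fun s' hs' => (hk s' hs').2.1 b hb) []
    have hbd' : ∀ b ∈ s.bounds ++ s.rule.bounds, τ₁.nat b [] = σ.nat b [] := fun b hb => by
      have hne : (false, b) ≠ (s.rule.isReal, s.a) := Stmt.bound_ne_target hs hb
      simpa [Mem.get] using hf₁ false b hne []
    refine ⟨T + U, τ, Exec.seq hE₁ hE, ?_, ?_, ?_, ?_⟩
    · intro s' hs'
      rcases List.mem_cons.1 hs' with rfl | hs'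
      · exact hh₁.of_keeps hself (fun b hb => hbd b (by simp [hb]))
          fun u hu l => hf _ _ (fun s'' hs'' => (hk s'' hs'').2.2 u hu) l
      · exact hh s' hs'
    · intro r a h l
      rw [hf r a fun s' hs' => h s' (by simp [hs'])]
      exact hf₁ r a (fun h' => h s (by simp) h'.symm) l
    · intro s' hs' hsh l hl
      rcases List.mem_cons.1 hs' with rfl | hs'
      · rw [hself, hz₁ l hsh hl]
      · rw [hz s' hs' hsh l hl]
        exact hf₁ _ _ (fun h' => (hk s' hs').1 h') l
    · intro S hS
      have hU := ht S fun s' hs' => hS s' (by simp [hs'])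
      have hmax : ((s.bounds ++ s.rule.bounds).map fun b => σ.nat b []).foldr max 0 ≤ S := by
        have : ∀ b ∈ s.bounds ++ s.rule.bounds, σ.nat b [] ≤ S := fun b hb => by
          rw [← hbd' b hb, ← hbd b hb]; exact hS s (by simp) b hb
        revert this
        generalize s.bounds ++ s.rule.bounds = l
        intro h
        induction l with
        | nil => simp
        | cons b l ih =>
          simp only [List.map_cons, List.foldr_cons, max_le_iff]
          exact ⟨h b (by simp), ih fun b' hb' => h b' (by simp [hb'])⟩
      set S₁ := ((s.bounds ++ s.rule.bounds).map fun b => σ.nat b []).foldr max 0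
      have hT' : T ≤ c * (S + 5) ^ (s.bounds.length + 1) := by
        calc T ≤ (s.rule.steps S₁ + 4) * (S₁ + 5) ^ s.bounds.length := hT
          _ ≤ (c * (S₁ + 5)) * (S₁ + 5) ^ s.bounds.length := Nat.mul_le_mul_right _ (hc _)
          _ = c * (S₁ + 5) ^ (s.bounds.length + 1) := by ring
          _ ≤ _ := by gcongr
      have h1 : (S + 5) ^ (s.bounds.length + 1) ≤ (S + 5) ^ max (s.bounds.length + 1) D :=
        Nat.pow_le_pow_right (by omega) (le_max_left _ _)
      have h2 : (S + 5) ^ D ≤ (S + 5) ^ max (s.bounds.length + 1) D :=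
        Nat.pow_le_pow_right (by omega) (le_max_right _ _)
      nlinarith [Nat.mul_le_mul_left c h1, Nat.mul_le_mul_left C h2]

/-! ## Shortest routes -/

/-- A route problem: states are the numbers below `Q`; a route starts in a `start` state, ends in a
`finish` state, and follows `step`. -/
structure RouteProblem where
  Q : ℕ
  start : ℕ → Prop
  step : ℕ → ℕ → Prop
  finish : ℕ → Prop
  startCost : ℕ → ℝ
  stepCost : ℕ → ℕ → ℝ
  finishCost : ℕ → ℝ

namespace RouteProblem

/-- `q 0, …, q l` is a route. -/
structure IsRoute (R : RouteProblem) (q : ℕ → ℕ) (l : ℕ) : Prop where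
  lt : ∀ i ≤ l, q i < R.Q
  start : R.start (q 0)
  step : ∀ i < l, R.step (q i) (q (i + 1))
  finish : R.finish (q l)

/-- The cost of the route `q 0, …, q l`. -/
noncomputable def cost (R : RouteProblem) (q : ℕ → ℕ) (l : ℕ) : ℝ :=
  R.startCost (q 0) + ∑ i ∈ Finset.range l, R.stepCost (q i) (q (i + 1)) + R.finishCost (q l)

/-- `q 0, …, q l` is a cheapest route among those with `l + 2 ≤ K`, and among the cheapest ones it is
a shortest one. -/
structure IsBest (R : RouteProblem) (K : ℕ) (q : ℕ → ℕ) (l : ℕ) : Prop where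
  isRoute : R.IsRoute q l
  le : l + 2 ≤ K
  cost_le : ∀ q' l', R.IsRoute q' l' → l' + 2 ≤ K → R.cost q l ≤ R.cost q' l'
  cost_lt : ∀ q' l', R.IsRoute q' l' → l' < l → R.cost q l < R.cost q' l'

/-- The network of the problem, with the source `Q`, the sink `Q + 1` and a loop at the source. -/
def adj (R : RouteProblem) (i j : ℕ) : Prop :=
  if i = R.Q then (if j = R.Q then True else if j = R.Q + 1 then False else R.start j)
  else if i = R.Q + 1 then False
  else if j = R.Q then False else if j = R.Q + 1 then R.finish i else R.step i j

/-- The arc costs in the network of the problem. -/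
noncomputable def arc (R : RouteProblem) (i j : ℕ) : ℝ :=
  if i = R.Q then (if j = R.Q then 0 else if j = R.Q + 1 then 0 else R.startCost j)
  else if i = R.Q + 1 then 0
  else if j = R.Q then 0 else if j = R.Q + 1 then R.finishCost i else R.stepCost i j

/-- A walk with `k` arcs from the source. -/
structure IsWalk (R : RouteProblem) (W : ℕ → ℕ) (k : ℕ) : Prop where
  lt : ∀ i ≤ k, W i < R.Q + 2
  zero : W 0 = R.Q
  adj : ∀ i < k, R.adj (W i) (W (i + 1))

/-- Cost of a walk. -/
noncomputable def walkCost (R : RouteProblem) (W : ℕ → ℕ) (k : ℕ) : ℝ :=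
  ∑ i ∈ Finset.range k, R.arc (W i) (W (i + 1))

variable {R : RouteProblem}

theorem adj_source {j : ℕ} (h : R.adj j R.Q) : j = R.Q := by
  by_contra hj
  by_cases h1 : j = R.Q + 1 <;> simp [adj, hj, h1] at h

theorem not_adj_sink {j : ℕ} : ¬ R.adj (R.Q + 1) j := by simp [adj]

theorem adj_self : R.adj R.Q R.Q := by simp [adj]

theorem arc_self : R.arc R.Q R.Q = 0 := by simp [arc]

theorem arc_start {j : ℕ} (hj : j < R.Q) : R.arc R.Q j = R.startCost j := by
  rw [arc, if_pos rfl, if_neg (by omega), if_neg (by omega)]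

theorem arc_step {i j : ℕ} (hi : i < R.Q) (hj : j < R.Q) : R.arc i j = R.stepCost i j := by
  rw [arc, if_neg (by omega), if_neg (by omega), if_neg (by omega), if_neg (by omega)]

theorem arc_finish {i : ℕ} (hi : i < R.Q) : R.arc i (R.Q + 1) = R.finishCost i := by
  rw [arc, if_neg (by omega), if_neg (by omega), if_neg (by omega), if_pos rfl]

/-- The loop at the source is free, so a walk may wait there. Walks with exactly `K` arcs thus stand
for all shorter ones. -/
theorem IsWalk.pad {W : ℕ → ℕ} {k : ℕ} (h : R.IsWalk W k) :
    R.IsWalk (fun i => W (i - 1)) (k + 1) ∧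
      R.walkCost (fun i => W (i - 1)) (k + 1) = R.walkCost W k := by
  refine ⟨⟨fun i hi => h.lt _ (by omega), h.zero, fun i hi => ?_⟩, ?_⟩
  · cases i with
    | zero => simpa [h.zero] using adj_self
    | succ i => exact h.adj i (by omega)
  · rw [walkCost, Finset.sum_range_succ']
    simp [h.zero, arc_self, walkCost]

theorem IsWalk.padTo {W : ℕ → ℕ} {k l : ℕ} (h : R.IsWalk W k) (hkl : k ≤ l) :
    ∃ W', R.IsWalk W' l ∧ W' l = W k ∧ R.walkCost W' l = R.walkCost W k := by
  induction l, hkl using Nat.le_induction with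
  | base => exact ⟨W, h, rfl, rfl⟩
  | succ l _ ih =>
    obtain ⟨W', h1, h2, h3⟩ := ih
    exact ⟨_, h1.pad.1, by simpa using h2, h1.pad.2.trans h3⟩

theorem IsWalk.extend {W : ℕ → ℕ} {k x : ℕ} (h : R.IsWalk W k) (hx : x < R.Q + 2)
    (ha : R.adj (W k) x) :
    R.IsWalk (fun i => if i ≤ k then W i else x) (k + 1) ∧
      R.walkCost (fun i => if i ≤ k then W i else x) (k + 1) = R.walkCost W k + R.arc (W k) x := by
  refine ⟨⟨fun i hi => ?_, by simpa using h.zero, fun i hi => ?_⟩, ?_⟩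
  · split_ifs with h1
    · exact h.lt i h1
    · exact hx
  · rw [if_pos (by omega : i ≤ k)]
    split_ifs with h1
    · exact h.adj i h1
    · rwa [show i = k by omega]
  · rw [walkCost, Finset.sum_range_succ]
    congr 1
    · refine Finset.sum_congr rfl fun i hi => ?_
      rw [Finset.mem_range] at hi
      rw [if_pos (by omega), if_pos (by omega)]
    · simp

/-- The tables of a layered shortest path computation: `r` is reachability, `D` is the distance by
walks with a given number of arcs. -/
structure Tables (R : RouteProblem) (K : ℕ) (r : ℕ → ℕ → ℕ) (D : ℕ → ℕ → ℝ) : Prop where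
  r_zero : ∀ x < R.Q + 2, r 0 x = 0
  D_zero : ∀ x < R.Q + 2, D 0 x = 0
  r_succ : ∀ k < K, ∀ x < R.Q + 2,
    r (k + 1) x = searchVal (fun j => R.adj j x ∧ (j = R.Q ∨ r k j ≠ 0)) (R.Q + 2)
  D_succ : ∀ k < K, ∀ x < R.Q + 2,
    D (k + 1) x = minVal (fun j => R.adj j x ∧ (j = R.Q ∨ r k j ≠ 0))
      (fun j => D k j + R.arc j x) (D k (r (k + 1) x - 1) + R.arc (r (k + 1) x - 1) x) (R.Q + 2)

variable {K : ℕ} {r : ℕ → ℕ → ℕ} {D : ℕ → ℕ → ℝ}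

/-- Layer `0` of `r` vanishes even at the source, which is why the source appears as a separate
alternative. -/
theorem Tables.reach (h : R.Tables K r D) {k x : ℕ} (hk : k ≤ K) (hx : x < R.Q + 2) :
    (x = R.Q ∨ r k x ≠ 0) ↔ ∃ W, R.IsWalk W k ∧ W k = x := by
  induction k generalizing x with
  | zero =>
    rw [h.r_zero x hx]
    constructor
    · rintro (rfl | h)
      · exact ⟨fun _ => R.Q, ⟨fun _ _ => by simp, rfl, by simp⟩, rfl⟩
      · simp at h
    · rintro ⟨W, hW, rfl⟩
      exact .inl hW.zero
  | succ k ih =>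
    constructor
    · intro hr
      have : ∃ j < R.Q + 2, R.adj j x ∧ (j = R.Q ∨ r k j ≠ 0) := by
        rcases hr with rfl | hr
        · exact ⟨R.Q, by omega, adj_self, .inl rfl⟩
        · rw [h.r_succ k hk x hx] at hr
          obtain ⟨h1, h2, _⟩ := searchVal_spec hr
          exact ⟨_, h1, h2⟩
      obtain ⟨j, hj, hadj, hjr⟩ := this
      obtain ⟨W, hW, rfl⟩ := (ih (by omega) hj).1 hjr
      exact ⟨_, (hW.extend hx hadj).1, by simp⟩
    · rintro ⟨W, hW, rfl⟩
      right
      rw [h.r_succ k hk _ hx]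
      intro h0
      refine searchVal_eq_zero.1 h0 (W k) (hW.lt k (by omega)) ⟨hW.adj k (by omega), ?_⟩
      exact (ih (by omega) (hW.lt k (by omega))).2
        ⟨W, ⟨fun i hi => hW.lt i (by omega), hW.zero, fun i hi => hW.adj i (by omega)⟩, rfl⟩

/-- The loop is the only arc into the source, so nothing else can contribute to its distance. -/
theorem Tables.D_source (h : R.Tables K r D) {k : ℕ} (hk : k ≤ K) : D k R.Q = 0 := by
  induction k with
  | zero => exact h.D_zero _ (by omega)
  | succ k ih =>
    have hr : r (k + 1) R.Q = R.Q + 1 := by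
      have hne : r (k + 1) R.Q ≠ 0 := by
        rw [h.r_succ k hk _ (by omega)]
        intro h0
        exact searchVal_eq_zero.1 h0 R.Q (by omega) ⟨adj_self, .inl rfl⟩
      have h1 := hne
      rw [h.r_succ k hk _ (by omega)] at h1
      have h2 := adj_source (searchVal_spec h1).2.1.1
      rw [← h.r_succ k hk _ (by omega)] at h2
      omega
    rw [h.D_succ k hk _ (by omega), hr]
    rcases minVal_mem (fun j => R.adj j R.Q ∧ (j = R.Q ∨ r k j ≠ 0))
      (fun j => D k j + R.arc j R.Q) (D k (R.Q + 1 - 1) + R.arc (R.Q + 1 - 1) R.Q) (R.Q + 2)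
      with h1 | ⟨j, _, hj, h1⟩
    · rw [h1]; simp [ih (by omega), arc_self]
    · rw [h1, adj_source hj.1, ih (by omega), arc_self]; simp

theorem Tables.dist_le (h : R.Tables K r D) {k : ℕ} (hk : k ≤ K) {W : ℕ → ℕ} (hW : R.IsWalk W k) :
    D k (W k) ≤ R.walkCost W k := by
  induction k with
  | zero => rw [h.D_zero _ (hW.lt 0 le_rfl)]; simp [walkCost]
  | succ k ih =>
    have hW' : R.IsWalk W k :=
      ⟨fun i hi => hW.lt i (by omega), hW.zero, fun i hi => hW.adj i (by omega)⟩
    rw [h.D_succ k hk _ (hW.lt _ le_rfl), walkCost, Finset.sum_range_succ]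
    refine (minVal_le (hW.lt k (by omega)) ⟨hW.adj k (by omega),
      (h.reach (by omega) (hW.lt k (by omega))).2 ⟨W, hW', rfl⟩⟩).trans ?_
    simpa [walkCost] using ih (by omega) hW'

/-- A reachable state has a predecessor that realizes its distance. -/
theorem Tables.exists_pred (h : R.Tables K r D) {k x : ℕ} (hk : k < K) (hx : x < R.Q + 2)
    (hr : r (k + 1) x ≠ 0) : ∃ j < R.Q + 2, R.adj j x ∧ (j = R.Q ∨ r k j ≠ 0) ∧
      D k j + R.arc j x ≤ D (k + 1) x := by
  rw [h.D_succ k hk x hx]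
  rcases minVal_mem (fun j => R.adj j x ∧ (j = R.Q ∨ r k j ≠ 0)) (fun j => D k j + R.arc j x)
    (D k (r (k + 1) x - 1) + R.arc (r (k + 1) x - 1) x) (R.Q + 2) with h1 | ⟨j, hj, hp, h1⟩
  -- There is no infinite value to start a minimum from. It starts from the predecessor found by the
  -- search, which is itself admissible.
  · rw [h1]
    have hr' := hr
    rw [h.r_succ k hk x hx] at hr'
    obtain ⟨h2, h3, _⟩ := searchVal_spec hr'
    rw [← h.r_succ k hk x hx] at h2 h3
    exact ⟨_, h2, h3.1, h3.2, le_rfl⟩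
  · exact ⟨j, hj, hp.1, hp.2, h1.ge⟩

/-- The tables for finding a best route: `kk` is the number of arcs, `p` are predecessors, and `b` is
the best walk, in reverse order. -/
structure RouteTables (R : RouteProblem) (K : ℕ) (r : ℕ → ℕ → ℕ) (D : ℕ → ℕ → ℝ) (kk : ℕ)
    (p : ℕ → ℕ → ℕ) (b : ℕ → ℕ) : Prop extends R.Tables K r D where
  kk_eq : kk = searchVal (fun k => r (k + 1) (R.Q + 1) ≠ 0 ∧ D (k + 1) (R.Q + 1) ≤ D K (R.Q + 1)) K
  p_eq : ∀ k < K, ∀ x < R.Q + 2,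
    p k x = searchVal (fun j => (R.adj j x ∧ (j = R.Q ∨ r k j ≠ 0)) ∧
      D k j + R.arc j x ≤ D (k + 1) x) (R.Q + 2)
  b_one : b 1 = R.Q + 1
  b_succ : ∀ i, 0 < i → i ≤ K → b (i + 1) = p (kk - i) (b i) - 1

variable {kk : ℕ} {p : ℕ → ℕ → ℕ} {b : ℕ → ℕ}

/-- The arc from the source and the arc to the sink come on top of the `l` steps, hence `l + 2`. -/
theorem IsRoute.isWalk {q : ℕ → ℕ} {l : ℕ} (h : R.IsRoute q l) :
    ∃ W, R.IsWalk W (l + 2) ∧ W (l + 2) = R.Q + 1 ∧ R.walkCost W (l + 2) = R.cost q l := by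
  let W : ℕ → ℕ := fun i => if i = 0 then R.Q else if i ≤ l + 1 then q (i - 1) else R.Q + 1
  have h0 : W 0 = R.Q := rfl
  have h1 : ∀ i ≤ l, W (i + 1) = q i := fun i hi => by simp [W]; omega
  have h2 : W (l + 2) = R.Q + 1 := by simp [W]
  have hstart := h.lt 0 (by omega)
  have hfinish := h.lt l le_rfl
  refine ⟨W, ⟨fun i hi => ?_, h0, fun i hi => ?_⟩, h2, ?_⟩
  · rcases i with _ | i
    · rw [h0]; omega
    · rcases Nat.lt_or_ge l i with h3 | h3
      · rw [show i + 1 = l + 2 by omega, h2]; omega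
      · rw [h1 i h3]; have := h.lt i h3; omega
  · rcases i with _ | i
    · rw [h0, h1 0 (by omega)]
      simp only [adj, if_true]
      rw [if_neg (by omega), if_neg (by omega)]
      exact h.start
    · rcases Nat.lt_or_ge i l with h3 | h3
      · have h4 := h.lt i h3.le
        have h5 := h.lt (i + 1) h3
        rw [h1 i h3.le, h1 (i + 1) h3, adj]
        rw [if_neg (by omega), if_neg (by omega), if_neg (by omega), if_neg (by omega)]
        exact h.step i h3
      · obtain rfl : i = l := by omega
        rw [h1 i le_rfl, h2, adj]
        rw [if_neg (by omega), if_neg (by omega), if_neg (by omega), if_pos rfl]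
        exact h.finish
  · rw [walkCost, Finset.sum_range_succ, Finset.sum_range_succ', cost, h2, h1 l le_rfl, h0,
      h1 0 (by omega)]
    have e1 : R.arc R.Q (q 0) = R.startCost (q 0) :=
      arc_start hstart
    have e2 : R.arc (q l) (R.Q + 1) = R.finishCost (q l) :=
      arc_finish hfinish
    have e3 : ∑ i ∈ Finset.range l, R.arc (W (i + 1)) (W (i + 1 + 1)) =
        ∑ i ∈ Finset.range l, R.stepCost (q i) (q (i + 1)) := by
      refine Finset.sum_congr rfl fun i hi => ?_
      rw [Finset.mem_range] at hi
      have h4 := h.lt i hi.le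
      have h5 := h.lt (i + 1) hi
      rw [h1 i hi.le, h1 (i + 1) hi, arc_step h4 h5]
    rw [e1, e2, e3]
    ring

/-- Only the loop leads back to the source, so a walk found there has never left it and has paid
nothing so far. -/
theorem IsWalk.drop {W : ℕ → ℕ} {k i : ℕ} (h : R.IsWalk W k) (hi : i ≤ k) (hW : W i = R.Q) :
    R.IsWalk (fun j => W (i + j)) (k - i) ∧
      R.walkCost (fun j => W (i + j)) (k - i) = R.walkCost W k := by
  refine ⟨⟨fun j hj => h.lt _ (by omega), hW, fun j hj => h.adj (i + j) (by omega)⟩, ?_⟩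
  have hall : ∀ j ≤ i, W j = R.Q := by
    intro j hj
    induction hj using Nat.decreasingInduction with
    | self => exact hW
    | of_succ j hj ih =>
      have := h.adj j (by omega)
      rw [ih] at this
      exact adj_source this
  obtain ⟨l, rfl⟩ := Nat.exists_eq_add_of_le hi
  have hzero : ∑ j ∈ Finset.range i, R.arc (W j) (W (j + 1)) = 0 := by
    refine Finset.sum_eq_zero fun j hj => ?_
    rw [Finset.mem_range] at hj
    rw [hall j hj.le, hall (j + 1) hj, arc_self]
  rw [walkCost, walkCost, Finset.sum_range_add, hzero, zero_add]
  simp [add_assoc]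

theorem IsWalk.isRoute {W : ℕ → ℕ} {k : ℕ} (h : R.IsWalk W k) (hk : W k = R.Q + 1)
    (hne : ∀ i, 0 < i → i < k → W i ≠ R.Q) :
    2 ≤ k ∧ R.IsRoute (fun i => W (i + 1)) (k - 2) ∧
      R.cost (fun i => W (i + 1)) (k - 2) = R.walkCost W k := by
  have hne' : ∀ i < k, W i ≠ R.Q + 1 := by
    intro i hi h'
    have := h.adj i hi
    rw [h'] at this
    exact not_adj_sink this
  have h2 : 2 ≤ k := by
    rcases k with _ | _ | k
    · have := h.zero; omega
    · have := h.adj 0 (by omega)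
      rw [h.zero, hk] at this
      simp [RouteProblem.adj] at this
    · omega
  obtain ⟨l, rfl⟩ := Nat.exists_eq_add_of_le' h2
  simp only [Nat.add_sub_cancel]
  have hlt : ∀ i ≤ l, W (i + 1) < R.Q := by
    intro i hi
    have h1 := h.lt (i + 1) (by omega)
    have h2 := hne (i + 1) (by omega) (by omega)
    have h3 := hne' (i + 1) (by omega)
    omega
  have hroute : R.IsRoute (fun i => W (i + 1)) l := by
    refine ⟨hlt, ?_, fun i hi => ?_, ?_⟩
    · have := h.adj 0 (by omega)
      have h1 := hlt 0 (by omega)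
      rw [h.zero, RouteProblem.adj, if_pos rfl, if_neg (by omega), if_neg (by omega)] at this
      exact this
    · have := h.adj (i + 1) (by omega)
      have h1 := hlt i (by omega)
      have h2 := hlt (i + 1) (by omega)
      rw [RouteProblem.adj, if_neg (by omega), if_neg (by omega), if_neg (by omega), if_neg (by omega)] at this
      exact this
    · have := h.adj (l + 1) (by omega)
      have h1 := hlt l (by omega)
      rw [hk, RouteProblem.adj, if_neg (by omega), if_neg (by omega), if_neg (by omega), if_pos rfl] at this
      exact this
  refine ⟨h2, hroute, ?_⟩
  have h0 := hlt 0 (by omega)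
  have hl := hlt l le_rfl
  rw [walkCost, Finset.sum_range_succ, Finset.sum_range_succ', cost, hk, h.zero]
  have e1 : R.arc R.Q (W (0 + 1)) = R.startCost (W (0 + 1)) :=
    arc_start h0
  have e2 : R.arc (W (l + 1)) (R.Q + 1) = R.finishCost (W (l + 1)) :=
    arc_finish hl
  have e3 : ∑ i ∈ Finset.range l, R.arc (W (i + 1)) (W (i + 1 + 1)) =
      ∑ i ∈ Finset.range l, R.stepCost (W (i + 1)) (W (i + 1 + 1)) := by
    refine Finset.sum_congr rfl fun i hi => ?_
    rw [Finset.mem_range] at hi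
    have h4 := hlt i hi.le
    have h5 := hlt (i + 1) hi
    rw [arc_step h4 h5]
  rw [e1, e2, e3]
  ring

theorem RouteTables.exists_route (h : R.RouteTables K r D kk p b) {q : ℕ → ℕ} {l : ℕ}
    (hq : R.IsRoute q l) (hl : l + 2 ≤ K) : kk ≠ 0 := by
  obtain ⟨W, hW, hend, _⟩ := hq.isWalk
  obtain ⟨W', hW', hend', _⟩ := hW.padTo hl
  rw [h.kk_eq]
  intro h0
  refine searchVal_eq_zero.1 h0 (K - 1) (by omega) ?_
  rw [Nat.sub_add_cancel (by omega)]
  refine ⟨?_, le_rfl⟩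
  have := (h.reach (k := K) le_rfl (by omega)).2 ⟨W', hW', hend'.trans hend⟩
  rcases this with h | h
  · omega
  · exact h

/-- `kk` is the least number of arcs that attains the final distance. Backtracking from the sink
gives a walk of that cost. Being shortest, it does not wait at the source, so it is a route, and
every route with fewer steps is strictly more expensive. -/
theorem RouteTables.isBest (h : R.RouteTables K r D kk p b) (hkk : kk ≠ 0) :
    2 ≤ kk ∧ kk ≤ K ∧ R.IsBest K (fun i => b (kk - i)) (kk - 2) ∧
      R.cost (fun i => b (kk - i)) (kk - 2) = D kk (R.Q + 1) := by
  have hspec := searchVal_spec (h.kk_eq ▸ hkk)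
  rw [← h.kk_eq, Nat.sub_add_cancel (by omega)] at hspec
  obtain ⟨hlt, ⟨hr, hD⟩, hmin⟩ := hspec
  have hkK : kk ≤ K := by omega
  -- all walks to the sink are at least as expensive
  have hle : ∀ W k, R.IsWalk W k → W k = R.Q + 1 → k ≤ K → D kk (R.Q + 1) ≤ R.walkCost W k := by
    intro W k hW hend hk
    obtain ⟨W', hW', hend', hc⟩ := hW.padTo hk
    rw [← hc]
    refine hD.trans ?_
    rw [← hend, ← hend']
    exact h.dist_le le_rfl hW'
  have hlt' : ∀ W k, R.IsWalk W k → W k = R.Q + 1 → k < kk → D kk (R.Q + 1) < R.walkCost W k := by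
    intro W k hW hend hk
    have hk0 : k ≠ 0 := by
      rintro rfl
      have := hW.zero
      omega
    have := hmin (k - 1) (by omega)
    rw [Nat.sub_add_cancel (by omega)] at this
    have hrk : r k (R.Q + 1) ≠ 0 := by
      rcases (h.reach (k := k) (by omega) (by omega)).2 ⟨W, hW, hend⟩ with h' | h'
      · omega
      · exact h'
    have hgt : D K (R.Q + 1) < D k (R.Q + 1) := by
      by_contra hc
      exact this ⟨hrk, not_lt.1 hc⟩
    calc D kk (R.Q + 1) ≤ D K (R.Q + 1) := hD
      _ < D k (R.Q + 1) := hgt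
      _ ≤ _ := hend ▸ h.dist_le (by omega) hW
  -- the walk found by backtracking
  have hback : ∀ i ≤ kk, b (i + 1) < R.Q + 2 ∧ (b (i + 1) = R.Q ∨ r (kk - i) (b (i + 1)) ≠ 0) ∧
      (i < kk → R.adj (b (i + 2)) (b (i + 1)) ∧
        D (kk - (i + 1)) (b (i + 2)) + R.arc (b (i + 2)) (b (i + 1)) ≤ D (kk - i) (b (i + 1))) := by
    have hstep : ∀ i < kk, b (i + 1) < R.Q + 2 →
        (b (i + 1) = R.Q ∨ r (kk - i) (b (i + 1)) ≠ 0) →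
        b (i + 2) < R.Q + 2 ∧ (b (i + 2) = R.Q ∨ r (kk - (i + 1)) (b (i + 2)) ≠ 0) ∧
        R.adj (b (i + 2)) (b (i + 1)) ∧
        D (kk - (i + 1)) (b (i + 2)) + R.arc (b (i + 2)) (b (i + 1)) ≤ D (kk - i) (b (i + 1)) := by
      intro i hi hb hrb
      -- In positive layers the loop makes the entry of the source nonzero as well.
      have hrb' : r (kk - i) (b (i + 1)) ≠ 0 := by
        rcases hrb with h' | h'
        · rw [h', show kk - i = kk - (i + 1) + 1 by omega, h.r_succ _ (by omega) _ (by omega)]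
          intro h0
          exact searchVal_eq_zero.1 h0 R.Q (by omega) ⟨adj_self, .inl rfl⟩
        · exact h'
      have hk1 : kk - i = kk - (i + 1) + 1 := by omega
      rw [hk1] at hrb'
      obtain ⟨j, hj, h1, h2, h3⟩ := h.exists_pred (k := kk - (i + 1)) (by omega) hb hrb'
      have hp : p (kk - (i + 1)) (b (i + 1)) ≠ 0 := by
        rw [h.p_eq _ (by omega) _ hb]
        intro h0
        exact searchVal_eq_zero.1 h0 j hj ⟨⟨h1, h2⟩, h3⟩
      have hs := hp
      rw [h.p_eq _ (by omega) _ hb] at hs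
      have hs := searchVal_spec hs
      rw [← h.p_eq _ (by omega) _ hb, ← h.b_succ (i + 1) (by omega) (by omega)] at hs
      rw [hk1]
      exact ⟨hs.1, hs.2.1.1.2, hs.2.1.1.1, hs.2.1.2⟩
    have hinv : ∀ i ≤ kk, b (i + 1) < R.Q + 2 ∧ (b (i + 1) = R.Q ∨ r (kk - i) (b (i + 1)) ≠ 0) := by
      intro i
      induction i with
      | zero =>
        intro _
        rw [h.b_one]
        exact ⟨by omega, .inr (by simpa using hr)⟩
      | succ i ih =>
        intro hi
        obtain ⟨h1, h2⟩ := ih (by omega)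
        obtain ⟨h3, h4, _⟩ := hstep i (by omega) h1 h2
        exact ⟨h3, h4⟩
    intro i hi
    obtain ⟨h1, h2⟩ := hinv i hi
    exact ⟨h1, h2, fun hi => (hstep i hi h1 h2).2.2⟩
  let W : ℕ → ℕ := fun i => b (kk + 1 - i)
  have hW0 : W 0 = R.Q := by
    have := (hback kk le_rfl)
    rcases this.2.1 with h' | h'
    · exact h'
    · rw [Nat.sub_self, h.r_zero _ this.1] at h'
      exact absurd rfl h'
  have hWk : W kk = R.Q + 1 := by
    simp only [W]
    rw [show kk + 1 - kk = 1 by omega, h.b_one]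
  have hwalk : R.IsWalk W kk := by
    refine ⟨fun i hi => ?_, hW0, fun i hi => ?_⟩
    · have := (hback (kk - i) (by omega)).1
      simp only [W]
      rwa [show kk + 1 - i = kk - i + 1 by omega]
    · have := ((hback (kk - (i + 1)) (by omega)).2.2 (by omega)).1
      simp only [W]
      rwa [show kk - (i + 1) + 2 = kk + 1 - i by omega,
        show kk - (i + 1) + 1 = kk + 1 - (i + 1) by omega] at this
  have hcost : ∀ i ≤ kk, R.walkCost W i ≤ D i (W i) := by
    intro i
    induction i with
    | zero =>
      intro _
      rw [hW0, h.D_source (by omega)]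
      simp [walkCost]
    | succ i ih =>
      intro hi
      have := ((hback (kk - (i + 1)) (by omega)).2.2 (by omega)).2
      rw [show kk - (i + 1) + 2 = kk + 1 - i by omega,
        show kk - (i + 1) + 1 = kk + 1 - (i + 1) by omega,
        show kk - (kk + 1 - (i + 1)) = i by omega,
        show kk - (kk - (i + 1)) = i + 1 by omega] at this
      rw [walkCost, Finset.sum_range_succ]
      refine le_trans ?_ this
      have := ih (by omega)
      simp only [walkCost] at this
      simp only [W] at this ⊢
      linarith
  have hcost' : R.walkCost W kk = D kk (R.Q + 1) :=
    le_antisymm (hWk ▸ hcost kk le_rfl) (hle W kk hwalk hWk hkK)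
  -- A visit to the source after time `0` could be cut off, which would give the same cost with
  -- fewer than `kk` arcs.
  obtain ⟨h2, hroute, hrc⟩ := hwalk.isRoute hWk (by
    intro i hi0 hi hiQ
    obtain ⟨h1, h2⟩ := hwalk.drop hi.le hiQ
    have := hlt' _ _ h1 (by rw [show i + (kk - i) = kk by omega]; exact hWk) (by omega)
    rw [h2, hcost'] at this
    exact lt_irrefl _ this)
  have hfun : (fun i => W (i + 1)) = fun i => b (kk - i) := by
    funext i
    simp only [W]
    congr 1
    omega
  rw [hfun] at hroute hrc
  refine ⟨h2, hkK, ⟨hroute, by omega, fun q' l' hq' hl' => ?_, fun q' l' hq' hl' => ?_⟩,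
    hrc.trans hcost'⟩
  · obtain ⟨V, hV, hend, hc⟩ := hq'.isWalk
    rw [hrc, hcost', ← hc]
    exact hle V _ hV hend hl'
  · obtain ⟨V, hV, hend, hc⟩ := hq'.isWalk
    rw [hrc, hcost', ← hc]
    exact hlt' V _ hV hend (by omega)

end RouteProblem

/-! ### Shortcuts and routes without shortcuts -/

namespace RouteProblem

variable {R : RouteProblem}

theorem exists_route {a c : ℕ} (ha : a < R.Q) (hs : R.start a) (hc : R.finish c)
    (h : Relation.ReflTransGen (fun i j => R.step i j ∧ j < R.Q) a c) : ∃ q l, R.IsRoute q l := by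
  have : ∃ (q : ℕ → ℕ) (l : ℕ), q 0 = a ∧ q l = c ∧ (∀ i ≤ l, q i < R.Q) ∧
      ∀ i < l, R.step (q i) (q (i + 1)) := by
    clear hc
    induction h with
    | refl => exact ⟨fun _ => a, 0, rfl, rfl, fun _ _ => ha, by simp⟩
    | tail _ hstep ih =>
      rename_i d e _
      obtain ⟨q, l, h0, hl, hlt, hst⟩ := ih
      refine ⟨fun i => if i ≤ l then q i else e, l + 1, by simpa using h0, by simp, ?_, ?_⟩
      · intro i hi
        dsimp only
        split_ifs with h
        · exact hlt i h
        · exact hstep.2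
      · intro i hi
        dsimp only
        rw [if_pos (by omega : i ≤ l)]
        split_ifs with h
        · exact hst i h
        · rw [show i = l by omega, hl]
          exact hstep.1
  obtain ⟨q, l, rfl, rfl, h1, h2⟩ := this
  exact ⟨q, l, h1, hs, h2, hc⟩

/-- Leave out `q (i + 1), …, q (i + c)`. -/
def splice (q : ℕ → ℕ) (i c k : ℕ) : ℕ := if k ≤ i then q k else q (k + c)

theorem IsRoute.splice {q : ℕ → ℕ} {l i c : ℕ} (h : R.IsRoute q l) (hc : i + 1 + c ≤ l)
    (hs : R.step (q i) (q (i + 1 + c))) : R.IsRoute (splice q i c) (l - c) := by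
  refine ⟨fun k hk => ?_, ?_, fun k hk => ?_, ?_⟩
  · unfold RouteProblem.splice
    split_ifs with h1
    · exact h.lt k (by omega)
    · exact h.lt (k + c) (by omega)
  · simpa [RouteProblem.splice] using h.start
  · unfold RouteProblem.splice
    rcases lt_trichotomy k i with h1 | h1 | h1
    · rw [if_pos h1.le, if_pos (by omega)]
      exact h.step k (by omega)
    · subst h1
      rw [if_pos le_rfl, if_neg (by omega)]
      exact hs
    · rw [if_neg (by omega), if_neg (by omega), show k + 1 + c = k + c + 1 by omega]
      exact h.step _ (by omega)
  · unfold RouteProblem.splice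
    rw [if_neg (by omega), Nat.sub_add_cancel (by omega)]
    exact h.finish

theorem cost_splice {q : ℕ → ℕ} {l i c : ℕ} (hc : i + 1 + c ≤ l) :
    R.cost (splice q i c) (l - c) +
      ∑ k ∈ Finset.range (c + 1), R.stepCost (q (i + k)) (q (i + k + 1)) =
    R.cost q l + R.stepCost (q i) (q (i + 1 + c)) := by
  obtain ⟨e, rfl⟩ := Nat.exists_eq_add_of_le hc
  have h1 : ∀ k ≤ i, splice q i c k = q k := fun k hk => by simp [splice, hk]
  have h2 : ∀ k, splice q i c (i + 1 + k) = q (i + 1 + c + k) := fun k => by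
    rw [splice, if_neg (by omega)]
    congr 1
    omega
  rw [cost, cost, show i + 1 + c + e - c = i + 1 + e by omega, Finset.sum_range_add,
    Finset.sum_range_succ, show i + 1 + c + e = i + (c + 1) + e by omega,
    Finset.sum_range_add _ (i + (c + 1)), Finset.sum_range_add _ i, h1 0 (by omega), h2 e]
  have e1 : ∑ x ∈ Finset.range i, R.stepCost (splice q i c x) (splice q i c (x + 1)) =
      ∑ x ∈ Finset.range i, R.stepCost (q x) (q (x + 1)) := by
    refine Finset.sum_congr rfl fun x hx => ?_
    rw [Finset.mem_range] at hx
    rw [h1 x (by omega), h1 (x + 1) (by omega)]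
  have e2 : ∑ x ∈ Finset.range e, R.stepCost (splice q i c (i + 1 + x))
      (splice q i c (i + 1 + x + 1)) =
      ∑ x ∈ Finset.range e, R.stepCost (q (i + (c + 1) + x)) (q (i + (c + 1) + x + 1)) := by
    refine Finset.sum_congr rfl fun x _ => ?_
    rw [h2 x, add_assoc (i + 1) x 1, h2 (x + 1)]
    congr 2 <;> omega
  have e3 : splice q i c i = q i := h1 i le_rfl
  have e4 : splice q i c (i + 1) = q (i + 1 + c) := by simpa using h2 0
  rw [e1, e2, e3, e4, show i + 1 + c + e = i + (c + 1) + e by omega]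
  ring

theorem IsRoute.take {q : ℕ → ℕ} {l i : ℕ} (h : R.IsRoute q l) (hi : i ≤ l) (hs : R.finish (q i)) :
    R.IsRoute q i :=
  ⟨fun k hk => h.lt k (by omega), h.start, fun k hk => h.step k (by omega), hs⟩

theorem IsRoute.drop {q : ℕ → ℕ} {l i : ℕ} (h : R.IsRoute q l) (hi : i ≤ l)
    (hs : R.start (q i)) : R.IsRoute (fun k => q (i + k)) (l - i) :=
  ⟨fun k hk => h.lt _ (by omega), hs, fun k hk => h.step (i + k) (by omega), by
    rw [Nat.add_sub_cancel' hi]; exact h.finish⟩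

/-- A route without shortcuts. -/
structure IsTight (R : RouteProblem) (q : ℕ → ℕ) (l : ℕ) : Prop extends R.IsRoute q l where
  no_step : ∀ i j, i + 1 < j → j ≤ l → ¬ R.step (q i) (q j)
  no_start : ∀ j, 0 < j → j ≤ l → ¬ R.start (q j)
  no_finish : ∀ i < l, ¬ R.finish (q i)

/-- A shortcut, a later start or an earlier finish would shorten the route, so a route with the
fewest steps has none of them. -/
theorem exists_tight {q : ℕ → ℕ} {l : ℕ} (h : R.IsRoute q l) : ∃ q l, R.IsTight q l := by
  classical
  have hex : ∃ l q, R.IsRoute q l := ⟨l, q, h⟩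
  obtain ⟨q, hq⟩ := Nat.find_spec hex
  have hmin : ∀ l' q', R.IsRoute q' l' → Nat.find hex ≤ l' := fun l' q' h' => Nat.find_min' hex ⟨q', h'⟩
  set l := Nat.find hex
  refine ⟨q, l, hq, fun i j hij hj hs => ?_, fun j hj hjl hs => ?_, fun i hi hs => ?_⟩
  · have := hmin _ _ (hq.splice (i := i) (c := j - i - 1) (by omega)
      (by rwa [show i + 1 + (j - i - 1) = j by omega]))
    omega
  · have := hmin _ _ (hq.drop hjl hs)
    omega
  · have := hmin _ _ (hq.take hi.le hs)
    omega

/-- From the first visit of a repeated state one could step directly to the successor of the second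
visit, or finish. -/
theorem IsTight.injOn {q : ℕ → ℕ} {l : ℕ} (h : R.IsTight q l) {i j : ℕ} (hi : i ≤ l) (hj : j ≤ l)
    (hij : q i = q j) : i = j := by
  have key : ∀ i j, i < j → j ≤ l → q i ≠ q j := by
    intro i j hlt hj hij
    rcases Nat.eq_or_lt_of_le hj with rfl | hj
    · exact h.no_finish i hlt (hij ▸ h.finish)
    · exact h.no_step i (j + 1) (by omega) hj (hij ▸ h.step j hj)
  rcases lt_trichotomy i j with h1 | h1 | h1
  · exact absurd hij (key i j h1 hj)
  · exact h1
  · exact absurd hij.symm (key j i h1 hi)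

/-- This bounds the number of layers that a shortest route computation needs. -/
theorem IsTight.lt_Q {q : ℕ → ℕ} {l : ℕ} (h : R.IsTight q l) : l + 1 ≤ R.Q := by
  have : (Finset.range (l + 1)).card ≤ (Finset.range R.Q).card := by
    refine Finset.card_le_card_of_injOn q (fun i hi => ?_) (fun i hi j hj hij => ?_)
    · simp only [Finset.coe_range, Set.mem_Iio] at hi ⊢
      exact h.lt i (by omega)
    · simp only [Finset.coe_range, Set.mem_Iio] at hi hj
      exact h.injOn (by omega) (by omega) hij
  simpa using this

end RouteProblem

/-! ## Dart graphs -/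

/-- A finite graph given by its darts (directed edges) `d < M`: `d` leads from the node `tl d` to the
node `hd d`, and `rev d` is the dart of the same edge `ed d` in the other direction. -/
structure DartGraph where
  n : ℕ
  M : ℕ
  tl : ℕ → ℕ
  hd : ℕ → ℕ
  ed : ℕ → ℕ
  rev : ℕ → ℕ
  tl_lt : ∀ d < M, tl d < n
  rev_lt : ∀ d < M, rev d < M
  tl_rev : ∀ d < M, tl (rev d) = hd d
  hd_rev : ∀ d < M, hd (rev d) = tl d
  ed_rev : ∀ d < M, ed (rev d) = ed d
  rev_rev : ∀ d < M, rev (rev d) = d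
  eq_or_eq_rev : ∀ d < M, ∀ d' < M, ed d = ed d' → d = d' ∨ d = rev d'

namespace DartGraph

variable (G : DartGraph)

/-- One step along an edge of `F` inside the node set `X`. -/
def Step (F X : Set ℕ) (u v : ℕ) : Prop :=
  u ∈ X ∧ v ∈ X ∧ ∃ d < G.M, G.ed d ∈ F ∧ G.tl d = u ∧ G.hd d = v

/-- Reachability along edges of `F` inside the node set `X`. -/
def Reach (F X : Set ℕ) : ℕ → ℕ → Prop := Relation.ReflTransGen (G.Step F X)

/-- No edge of `F` and no node other than `S` and `T` separates `T` from `S`. -/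
def Conn2 (F : Set ℕ) (S T : ℕ) : Prop :=
  (∀ e, G.Reach (F \ {e}) Set.univ S T) ∧ ∀ x, x ≠ S → x ≠ T → G.Reach F {x}ᶜ S T

/-- The levels `L` activate all edges of `F`, where `c d` is the cost of the dart `d` at its tail. -/
def Activates (c : ℕ → ℝ) (L : ℕ → ℝ) (F : Set ℕ) : Prop :=
  ∀ d < G.M, G.ed d ∈ F → c d ≤ L (G.tl d)

variable {G}

theorem hd_lt {d : ℕ} (h : d < G.M) : G.hd d < G.n := by
  rw [← G.tl_rev d h]; exact G.tl_lt _ (G.rev_lt d h)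

theorem Step.mono {F F' X X' : Set ℕ} (hF : F ⊆ F') (hX : X ⊆ X') {u v : ℕ} (h : G.Step F X u v) :
    G.Step F' X' u v := by
  obtain ⟨hu, hv, d, hd, he, h1, h2⟩ := h
  exact ⟨hX hu, hX hv, d, hd, hF he, h1, h2⟩

theorem Step.symm {F X : Set ℕ} {u v : ℕ} (h : G.Step F X u v) : G.Step F X v u := by
  obtain ⟨hu, hv, d, hd, he, h1, h2⟩ := h
  exact ⟨hv, hu, G.rev d, G.rev_lt d hd, by rwa [G.ed_rev d hd], by rw [G.tl_rev d hd, h2],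
    by rw [G.hd_rev d hd, h1]⟩

theorem Reach.mono {F F' X X' : Set ℕ} (hF : F ⊆ F') (hX : X ⊆ X') {u v : ℕ}
    (h : G.Reach F X u v) : G.Reach F' X' u v :=
  Relation.ReflTransGen.mono (fun _ _ h' => Step.mono hF hX h') _ _ h

theorem Reach.symm {F X : Set ℕ} {u v : ℕ} (h : G.Reach F X u v) : G.Reach F X v u :=
  (@Relation.ReflTransGen.stdSymm _ _ ⟨fun _ _ h => Step.symm h⟩).symm _ _ h

theorem Reach.trans {F X : Set ℕ} {u v w : ℕ} (h : G.Reach F X u v) (h' : G.Reach F X v w) :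
    G.Reach F X u w :=
  Relation.ReflTransGen.trans h h'

theorem reach_dart {F X : Set ℕ} {d : ℕ} (hd : d < G.M) (he : G.ed d ∈ F) (h1 : G.tl d ∈ X)
    (h2 : G.hd d ∈ X) : G.Reach F X (G.tl d) (G.hd d) :=
  Relation.ReflTransGen.single ⟨h1, h2, d, hd, he, rfl, rfl⟩

variable (G)

/-- Finding a cheap `ST`-path in the edge set `A`, as a route problem on darts. -/
noncomputable def pathProblem (A : Set ℕ) (c : ℕ → ℝ) (S T : ℕ) : RouteProblem where
  Q := G.M
  start d := G.ed d ∈ A ∧ G.tl d = S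
  step d' d := G.ed d ∈ A ∧ G.hd d' = G.tl d
  finish d := G.hd d = T
  startCost d := c d
  stepCost d' d := max (c (G.rev d')) (c d)
  finishCost d := c (G.rev d)

/-- The nodes of a sequence of darts that starts in `S`. -/
def node (S : ℕ) (x : ℕ → ℕ) (i : ℕ) : ℕ := if i = 0 then S else G.hd (x (i - 1))

variable {G} {A : Set ℕ} {c : ℕ → ℝ} {S T : ℕ} {x : ℕ → ℕ} {l : ℕ}

theorem node_succ (i : ℕ) : G.node S x (i + 1) = G.hd (x i) := by simp [node]

theorem node_zero : G.node S x 0 = S := by simp [node]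

theorem tl_eq_node (h : (G.pathProblem A c S T).IsRoute x l) {i : ℕ} (hi : i ≤ l) :
    G.tl (x i) = G.node S x i := by
  cases i with
  | zero => exact h.start.2
  | succ i => rw [node_succ]; exact (h.step i (by omega)).2.symm

theorem ed_mem (h : (G.pathProblem A c S T).IsRoute x l) {i : ℕ} (hi : i ≤ l) : G.ed (x i) ∈ A := by
  cases i with
  | zero => exact h.start.1
  | succ i => exact (h.step i (by omega)).1

theorem node_lt (hS : S < G.n) (h : (G.pathProblem A c S T).IsRoute x l) {i : ℕ} (hi : i ≤ l + 1) :
    G.node S x i < G.n := by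
  cases i with
  | zero => exact hS
  | succ i => rw [node_succ]; exact hd_lt (h.lt i (by omega))

/-- The part of the cost of a path that is paid at node number `i`. -/
noncomputable def pathCharge (G : DartGraph) (c : ℕ → ℝ) (x : ℕ → ℕ) (l i : ℕ) : ℝ :=
  if i = 0 then c (x 0) else if i ≤ l then max (c (G.rev (x (i - 1)))) (c (x i))
  else c (G.rev (x l))

theorem cost_eq_sum_pathCharge :
    (G.pathProblem A c S T).cost x l = ∑ i ∈ Finset.range (l + 2), G.pathCharge c x l i := by
  rw [RouteProblem.cost, Finset.sum_range_succ, Finset.sum_range_succ']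
  have : ∑ i ∈ Finset.range l, G.pathCharge c x l (i + 1) =
      ∑ i ∈ Finset.range l, (G.pathProblem A c S T).stepCost (x i) (x (i + 1)) := by
    refine Finset.sum_congr rfl fun i hi => ?_
    rw [Finset.mem_range] at hi
    simp [pathCharge, pathProblem, Nat.succ_le_of_lt hi]
  rw [this]
  simp [pathCharge, pathProblem]
  ring

theorem pathCharge_nonneg (hc : ∀ d, 0 ≤ c d) (i : ℕ) : 0 ≤ G.pathCharge c x l i := by
  unfold pathCharge
  split_ifs
  · exact hc _
  · exact le_max_of_le_left (hc _)
  · exact hc _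

theorem le_pathCharge_tail {i : ℕ} (hi : i ≤ l) : c (x i) ≤ G.pathCharge c x l i := by
  unfold pathCharge
  split_ifs with h
  · rw [h]
  · exact le_max_right _ _

theorem le_pathCharge_head {i : ℕ} (hi : i ≤ l) :
    c (G.rev (x i)) ≤ G.pathCharge c x l (i + 1) := by
  unfold pathCharge
  rw [if_neg (by omega)]
  split_ifs with h
  · simp
  · rw [show i = l by omega]

/-- Spread charges `f i`, paid at the nodes `v i`, over the nodes. -/
theorem sum_spread {n k : ℕ} {v : ℕ → ℕ} (hv : ∀ i < k, v i < n) (f : ℕ → ℝ) :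
    ∑ u ∈ Finset.range n, ∑ i ∈ Finset.range k, (if v i = u then f i else 0) =
      ∑ i ∈ Finset.range k, f i := by
  rw [Finset.sum_comm]
  refine Finset.sum_congr rfl fun i hi => ?_
  rw [Finset.mem_range] at hi
  simp [hv i hi]

theorem le_spread {k : ℕ} {v : ℕ → ℕ} {f : ℕ → ℝ} (hf : ∀ i < k, 0 ≤ f i) {i : ℕ} (hi : i < k) :
    f i ≤ ∑ j ∈ Finset.range k, (if v j = v i then f j else 0) := by
  have := Finset.single_le_sum (f := fun j => if v j = v i then f j else 0) (s := Finset.range k)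
    (fun j hj => by
      split_ifs
      · exact hf j (Finset.mem_range.1 hj)
      · exact le_rfl) (Finset.mem_range.2 hi)
  simpa using this

theorem spread_nonneg {k : ℕ} {v : ℕ → ℕ} {f : ℕ → ℝ} (hf : ∀ i < k, 0 ≤ f i) (u : ℕ) :
    0 ≤ ∑ j ∈ Finset.range k, (if v j = u then f j else 0) :=
  Finset.sum_nonneg fun j hj => by
    split_ifs
    · exact hf j (Finset.mem_range.1 hj)
    · exact le_rfl

/-- The edges of a sequence of darts. -/
def edges (G : DartGraph) (x : ℕ → ℕ) (l : ℕ) : Set ℕ := {e | ∃ i ≤ l, G.ed (x i) = e}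

/-- A positive level is bounded by the cost of a dart of the path or of its reversal, and that cost
is part of a charge at the same node. Repeated visits only add charges, so the path need not be
simple. -/
theorem pathProblem_sound (hc : ∀ d, 0 ≤ c d) (hS : S < G.n)
    (h : (G.pathProblem A c S T).IsRoute x l) {L : ℕ → ℝ}
    (hL : ∀ v, L v ≤ 0 ∨ ∃ d < G.M, G.ed d ∈ G.edges x l ∧ G.tl d = v ∧ L v ≤ c d) :
    ∑ v ∈ Finset.range G.n, L v ≤ (G.pathProblem A c S T).cost x l := by
  rw [cost_eq_sum_pathCharge, ← sum_spread (v := G.node S x) (n := G.n) (k := l + 2)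
    (fun i hi => node_lt hS h (by omega)) (G.pathCharge c x l)]
  have hnn : ∀ i < l + 2, 0 ≤ G.pathCharge c x l i := fun i _ => pathCharge_nonneg hc i
  refine Finset.sum_le_sum fun v _ => ?_
  rcases hL v with h0 | ⟨d, hd, ⟨i, hi, he⟩, rfl, hle⟩
  · exact h0.trans (spread_nonneg hnn v)
  · refine hle.trans ?_
    rcases G.eq_or_eq_rev d hd (x i) (h.lt i hi) he.symm with rfl | rfl
    · rw [tl_eq_node h hi]
      exact (le_pathCharge_tail hi).trans (le_spread hnn (by omega))
    · rw [G.tl_rev _ (h.lt i hi), ← node_succ (S := S)]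
      exact (le_pathCharge_head hi).trans (le_spread (v := G.node S x) hnn (by omega))

theorem reach_node (h : (G.pathProblem A c S T).IsRoute x l) {F X : Set ℕ} {i j : ℕ} (hij : i ≤ j)
    (hj : j ≤ l + 1) (hX : ∀ k, i ≤ k → k ≤ j → G.node S x k ∈ X)
    (hF : ∀ k, i ≤ k → k < j → G.ed (x k) ∈ F) :
    G.Reach F X (G.node S x i) (G.node S x j) := by
  induction j, hij using Nat.le_induction with
  | base => exact .refl
  | succ j hij ih =>
    refine (ih (by omega) (fun k h1 h2 => hX k h1 (by omega))
      fun k h1 h2 => hF k h1 (by omega)).trans ?_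
    have h1 := hX j hij (by omega)
    have h2 := hX (j + 1) (by omega) le_rfl
    rw [node_succ] at h2 ⊢
    rw [← tl_eq_node h (by omega)] at h1 ⊢
    exact reach_dart (h.lt j (by omega)) (hF j hij (by omega)) h1 h2

theorem exists_pathProblem_route (hST : S ≠ T) {F : Set ℕ} (h : G.Reach F Set.univ S T) :
    ∃ q l, (G.pathProblem F c S T).IsRoute q l := by
  suffices H : S = T ∨ ∃ q l, (G.pathProblem F c S T).IsRoute q l from H.resolve_left hST
  clear hST
  induction h with
  | refl => exact .inl rfl
  | tail _ hs ih =>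
    obtain ⟨_, _, d, hd, he, rfl, rfl⟩ := hs
    right
    rcases ih with h | ⟨q, l, h⟩
    · exact ⟨fun _ => d, 0, fun _ _ => hd, ⟨he, h.symm⟩, by simp, rfl⟩
    · refine ⟨fun i => if i ≤ l then q i else d, l + 1, fun i hi => ?_, ?_, fun i hi => ?_, ?_⟩
      · split_ifs with h1
        · exact h.lt i h1
        · exact hd
      · exact ⟨by simpa using h.start.1, by simpa using h.start.2⟩
      · rw [if_pos (by omega : i ≤ l)]
        split_ifs with h1
        · exact h.step i h1
        · rw [show i = l by omega]
          exact ⟨he, h.finish⟩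
      · simp [pathProblem]

theorem node_injOn_of_head {x : ℕ → ℕ} {l : ℕ} (h0 : ∀ i ≤ l, G.hd (x i) ≠ S)
    (h1 : ∀ i j, i < j → j ≤ l → G.hd (x i) ≠ G.hd (x j)) :
    Set.InjOn (G.node S x) (Set.Iio (l + 2)) := by
  have key : ∀ i j, i < j → j ≤ l + 1 → G.node S x i ≠ G.node S x j := by
    intro i j hij hj
    obtain ⟨j, rfl⟩ : ∃ k, j = k + 1 := ⟨j - 1, by omega⟩
    rw [node_succ]
    cases i with
    | zero => rw [node_zero]; exact (h0 j (by omega)).symm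
    | succ i => rw [node_succ]; exact h1 i j (by omega) (by omega)
  intro i hi j hj hij
  rw [Set.mem_Iio] at hi hj
  rcases lt_trichotomy i j with h | h | h
  · exact absurd hij (key i j h (by omega))
  · exact h
  · exact absurd hij.symm (key j i h (by omega))

theorem IsTight.node_injOn (hST : S ≠ T) (h : (G.pathProblem A c S T).IsTight x l) :
    Set.InjOn (G.node S x) (Set.Iio (l + 2)) := by
  refine node_injOn_of_head (fun i hi hS => ?_) (fun i j hij hj he => ?_)
  · rcases Nat.eq_or_lt_of_le hi with rfl | hi
    · exact hST (hS.symm.trans h.finish)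
    · refine h.no_start (i + 1) (by omega) hi ⟨ed_mem h.toIsRoute hi, ?_⟩
      rw [← hS]
      exact (h.step i hi).2.symm
  · rcases Nat.eq_or_lt_of_le hj with rfl | hj
    · exact h.no_finish i hij (he.trans h.finish)
    · exact h.no_step i (j + 1) (by omega) hj ⟨ed_mem h.toIsRoute hj, he.trans (h.step j hj).2⟩

/-- On a tight path the nodes are distinct, and the charge at each is a maximum of costs that `L`
covers there. -/
theorem pathProblem_complete (hST : S ≠ T) (hS : S < G.n) {F : Set ℕ} (hF : F ⊆ A)
    (h : G.Reach F Set.univ S T) {L : ℕ → ℝ} (hL0 : ∀ v, 0 ≤ L v) (hL : G.Activates c L F) :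
    ∃ q l, (G.pathProblem A c S T).IsRoute q l ∧ l + 1 ≤ G.M ∧
      (G.pathProblem A c S T).cost q l ≤ ∑ v ∈ Finset.range G.n, L v := by
  obtain ⟨q, l, h⟩ := exists_pathProblem_route (c := c) hST h
  obtain ⟨q, l, h⟩ := RouteProblem.exists_tight h
  have hr := h.toIsRoute
  refine ⟨q, l, ⟨hr.lt, ⟨hF hr.start.1, hr.start.2⟩, fun i hi => ⟨hF (hr.step i hi).1,
    (hr.step i hi).2⟩, hr.finish⟩, h.lt_Q, ?_⟩
  have htail : ∀ i ≤ l, c (q i) ≤ L (G.node S q i) := fun i hi => by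
    rw [← tl_eq_node hr hi]
    exact hL _ (hr.lt i hi) (ed_mem hr hi)
  have hhead : ∀ i ≤ l, c (G.rev (q i)) ≤ L (G.node S q (i + 1)) := fun i hi => by
    rw [node_succ, ← G.tl_rev _ (hr.lt i hi)]
    refine hL _ (G.rev_lt _ (hr.lt i hi)) ?_
    rw [G.ed_rev _ (hr.lt i hi)]
    exact ed_mem hr hi
  calc (G.pathProblem A c S T).cost q l
      = ∑ i ∈ Finset.range (l + 2), G.pathCharge c q l i := cost_eq_sum_pathCharge
    _ ≤ ∑ i ∈ Finset.range (l + 2), L (G.node S q i) := by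
        refine Finset.sum_le_sum fun i hi => ?_
        rw [Finset.mem_range] at hi
        unfold pathCharge
        split_ifs with h1 h2
        · subst h1; exact htail 0 (by omega)
        · refine max_le ?_ (htail i h2)
          have := hhead (i - 1) (by omega)
          rwa [Nat.sub_add_cancel (by omega)] at this
        · rw [show i = l + 1 by omega]
          exact hhead l le_rfl
    _ = ∑ v ∈ (Finset.range (l + 2)).image (G.node S q), L v := by
        rw [Finset.sum_image]
        simpa using IsTight.node_injOn hST h
    _ ≤ ∑ v ∈ Finset.range G.n, L v := by
        refine Finset.sum_le_sum_of_subset_of_nonneg ?_ fun v _ _ => hL0 v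
        intro v hv
        rw [Finset.mem_image] at hv
        obtain ⟨i, hi, rfl⟩ := hv
        rw [Finset.mem_range] at hi ⊢
        exact node_lt hS hr (by omega)

/-- Cutting out a closed part does not raise the cost, since the costs at the remaining node were
already paid in the steps left out. It does shorten the path, so the choice of a shortest among the
cheapest routes forbids repeated nodes. -/
theorem IsBest.node_injOn (hc : ∀ d, 0 ≤ c d) (hST : S ≠ T) {K : ℕ}
    (h : (G.pathProblem A c S T).IsBest K x l) : Set.InjOn (G.node S x) (Set.Iio (l + 2)) := by
  have hr := h.isRoute
  have hstep : ∀ i j, 0 ≤ (G.pathProblem A c S T).stepCost i j := fun i j =>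
    le_max_of_le_left (hc _)
  refine node_injOn_of_head (fun i hi hS => ?_) (fun i j hij hj he => ?_)
  · rcases Nat.eq_or_lt_of_le hi with rfl | hi
    · exact hST (hS.symm.trans hr.finish)
    · have hd := hr.drop (i := i + 1) hi ⟨ed_mem hr hi, by
        rw [← hS]; exact (hr.step i hi).2.symm⟩
      refine absurd (h.cost_lt _ _ hd (by omega)) (not_lt.2 ?_)
      obtain ⟨e, rfl⟩ := Nat.exists_eq_add_of_le hi
      rw [RouteProblem.cost, RouteProblem.cost, Nat.add_sub_cancel_left, Finset.sum_range_add,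
        Finset.sum_range_succ]
      have h1 : c (x (i + 1)) ≤ (G.pathProblem A c S T).stepCost (x i) (x (i + 1)) :=
        le_max_right _ _
      have h2 : 0 ≤ ∑ k ∈ Finset.range i, (G.pathProblem A c S T).stepCost (x k) (x (k + 1)) :=
        Finset.sum_nonneg fun _ _ => hstep _ _
      have h3 : 0 ≤ c (x 0) := hc _
      simp only [pathProblem, add_zero, Nat.succ_eq_add_one, ← add_assoc] at h1 h2 h3 ⊢
      linarith
  · rcases Nat.eq_or_lt_of_le hj with rfl | hj
    · refine absurd (h.cost_lt _ _ (hr.take hij.le (he.trans hr.finish)) hij) (not_lt.2 ?_)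
      obtain ⟨e, rfl⟩ := Nat.exists_eq_add_of_le (Nat.succ_le_of_lt hij)
      rw [RouteProblem.cost, RouteProblem.cost, Finset.sum_range_add, Finset.sum_range_succ]
      have h1 : c (G.rev (x i)) ≤ (G.pathProblem A c S T).stepCost (x i) (x (i + 1)) :=
        le_max_left _ _
      have h2 : 0 ≤ ∑ k ∈ Finset.range e,
          (G.pathProblem A c S T).stepCost (x (i + 1 + k)) (x (i + 1 + k + 1)) :=
        Finset.sum_nonneg fun _ _ => hstep _ _
      have h3 : 0 ≤ c (G.rev (x (i + 1 + e))) := hc _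
      simp only [pathProblem, Nat.succ_eq_add_one] at h1 h2 h3 ⊢
      linarith
    · have hs : (G.pathProblem A c S T).step (x i) (x (i + 1 + (j - i))) := by
        rw [show i + 1 + (j - i) = j + 1 by omega]
        exact ⟨ed_mem hr hj, he.trans (hr.step j hj).2⟩
      have hlt := h.cost_lt _ _ (hr.splice (by omega) hs) (by omega)
      have heq := RouteProblem.cost_splice (R := G.pathProblem A c S T) (q := x)
        (i := i) (c := j - i) (l := l) (by omega)
      obtain ⟨e, rfl⟩ := Nat.exists_eq_add_of_le (Nat.succ_le_of_lt hij)
      rw [show i.succ + e - i = e + 1 by omega] at heq hlt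
      rw [Finset.sum_range_succ, Finset.sum_range_succ'] at heq
      have h2 : 0 ≤ ∑ k ∈ Finset.range e,
          (G.pathProblem A c S T).stepCost (x (i + (k + 1))) (x (i + (k + 1) + 1)) :=
        Finset.sum_nonneg fun _ _ => hstep _ _
      -- The new step joins the head of the first step left out to the tail of the last one. Its
      -- maximum is at most the sum of these two step costs.
      have h1 : (G.pathProblem A c S T).stepCost (x i) (x (i + 1 + (e + 1))) ≤
          (G.pathProblem A c S T).stepCost (x (i + 0)) (x (i + 0 + 1)) +
          (G.pathProblem A c S T).stepCost (x (i + (e + 1))) (x (i + (e + 1) + 1)) := by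
        rw [show i + 1 + (e + 1) = i + (e + 1) + 1 by omega]
        refine max_le ?_ ?_
        · have := hstep (x (i + (e + 1))) (x (i + (e + 1) + 1))
          have h4 : c (G.rev (x i)) ≤ (G.pathProblem A c S T).stepCost (x (i + 0)) (x (i + 0 + 1)) :=
            le_max_left _ _
          linarith
        · have := hstep (x (i + 0)) (x (i + 0 + 1))
          have h4 : c (x (i + (e + 1) + 1)) ≤
              (G.pathProblem A c S T).stepCost (x (i + (e + 1))) (x (i + (e + 1) + 1)) :=
            le_max_right _ _
          linarith
      linarith

end DartGraph

/-! ### Augmenting sequences: existence, cost and connectivity -/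

namespace DartGraph

variable (G : DartGraph)

variable {G} in
theorem Reach.closed {F X : Set ℕ} {u v : ℕ} (h : G.Reach F X u v) {Z : ℕ → Prop} (hu : Z u)
    (hZ : ∀ a, Z a → ∀ b, G.Step F X a b → Z b) : Z v := by
  induction h with
  | refl => exact hu
  | tail _ hs ih => exact hZ _ ih _ hs

/-- An `ST`-path `x 0, …, x l` together with the positions of its nodes: `pos v` is `i + 1` if `v` is
node number `i` of the path, and `0` if `v` is not on the path. -/
structure PathData (A : Set ℕ) (c : ℕ → ℝ) (S T : ℕ) (x : ℕ → ℕ) (l : ℕ) (pos : ℕ → ℕ) : Prop where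
  route : (G.pathProblem A c S T).IsRoute x l
  pos_node : ∀ i ≤ l + 1, pos (G.node S x i) = i + 1
  pos_ne : ∀ v, pos v ≠ 0 → ∃ i ≤ l + 1, G.node S x i = v

/-- Can the dart `d` follow the dart `d'` in an augmenting sequence of darts?  Off the path, the
sequence is a walk; from a node of the path it goes on from an earlier node of the path. -/
def earStep (B : Set ℕ) (pos : ℕ → ℕ) (d' d : ℕ) : Prop :=
  G.ed d ∈ B ∧ ((pos (G.hd d') = 0 ∧ G.hd d' = G.tl d) ∨
    (pos (G.hd d') ≠ 0 ∧ pos (G.tl d) ≠ 0 ∧ pos (G.tl d) < pos (G.hd d')))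

/-- Augmenting sequences of darts. -/
noncomputable def earProblem (B : Set ℕ) (pos : ℕ → ℕ) (S T : ℕ) : RouteProblem where
  Q := G.M
  start d := G.ed d ∈ B ∧ G.tl d = S
  step := G.earStep B pos
  finish d := G.hd d = T
  startCost _ := 0
  stepCost _ _ := 0
  finishCost _ := 0

open Classical in
/-- The price of going on with the dart `d` from a node of the path, after the dart `y` was the last
but one to arrive on the path: what was paid for `y` at its head can be used. -/
noncomputable def startPrice (c : ℕ → ℝ) (y d : ℕ) : ℝ :=
  if y < G.M ∧ G.hd y = G.tl d then max 0 (c d - c (G.rev y)) else c d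

open Classical in
/-- Cheap augmenting sequences of darts.  The state `y * M + d` stands for the dart `d` after the dart
`y` was the last one to arrive on the path (`y = M` if there was none). -/
noncomputable def augProblem (B : Set ℕ) (pos : ℕ → ℕ) (c : ℕ → ℝ) (S T : ℕ) : RouteProblem where
  Q := (G.M + 1) * G.M
  start q := q / G.M = G.M ∧ G.ed (q % G.M) ∈ B ∧ G.tl (q % G.M) = S
  step q' q := G.ed (q % G.M) ∈ B ∧
    ((pos (G.hd (q' % G.M)) = 0 ∧ G.hd (q' % G.M) = G.tl (q % G.M) ∧ q' / G.M = q / G.M) ∨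
    (pos (G.hd (q' % G.M)) ≠ 0 ∧ pos (G.tl (q % G.M)) ≠ 0 ∧
      pos (G.tl (q % G.M)) < pos (G.hd (q' % G.M)) ∧ q / G.M = q' % G.M))
  finish q := G.hd (q % G.M) = T
  startCost q := c (q % G.M)
  stepCost q' q :=
    if pos (G.hd (q' % G.M)) = 0 then max (c (G.rev (q' % G.M))) (c (q % G.M))
    else c (G.rev (q' % G.M)) + G.startPrice c (q' / G.M) (q % G.M)
  finishCost q := c (G.rev (q % G.M))

variable {G} {A : Set ℕ} {c₀ : ℕ → ℝ} {S T : ℕ} {x : ℕ → ℕ} {l : ℕ} {pos : ℕ → ℕ}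

namespace PathData

theorem node_inj (h : G.PathData A c₀ S T x l pos) {i j : ℕ} (hi : i ≤ l + 1) (hj : j ≤ l + 1)
    (hij : G.node S x i = G.node S x j) : i = j := by
  have h1 := h.pos_node i hi
  rw [hij, h.pos_node j hj] at h1
  omega

theorem node_last (h : G.PathData A c₀ S T x l pos) : G.node S x (l + 1) = T := by
  rw [node_succ]; exact h.route.finish

theorem pos_S (h : G.PathData A c₀ S T x l pos) : pos S = 1 := by
  simpa [node_zero] using h.pos_node 0 (by omega)

theorem pos_T (h : G.PathData A c₀ S T x l pos) : pos T = l + 2 := by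
  rw [← h.node_last]; exact h.pos_node _ le_rfl

theorem pos_le (h : G.PathData A c₀ S T x l pos) (v : ℕ) : pos v ≤ l + 2 := by
  by_cases hv : pos v = 0
  · omega
  · obtain ⟨i, hi, rfl⟩ := h.pos_ne v hv
    rw [h.pos_node i hi]
    omega

theorem eq_T_of_pos (h : G.PathData A c₀ S T x l pos) {v : ℕ} (hv : pos v = l + 2) : v = T := by
  obtain ⟨i, hi, rfl⟩ := h.pos_ne v (by omega)
  rw [h.pos_node i hi] at hv
  rw [← h.node_last]
  congr 1
  omega

/-- The ends of a dart of the path. -/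
theorem ends_of_mem_edges (h : G.PathData A c₀ S T x l pos) {d : ℕ} (hd : d < G.M)
    (he : G.ed d ∈ G.edges x l) : ∃ i ≤ l, G.ed (x i) = G.ed d ∧
      ((G.tl d = G.node S x i ∧ G.hd d = G.node S x (i + 1)) ∨
        (G.tl d = G.node S x (i + 1) ∧ G.hd d = G.node S x i)) := by
  obtain ⟨i, hi, he⟩ := he
  refine ⟨i, hi, he, ?_⟩
  rcases G.eq_or_eq_rev d hd (x i) (h.route.lt i hi) he.symm with rfl | rfl
  · exact .inl ⟨tl_eq_node h.route hi, (node_succ i).symm⟩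
  · right
    rw [G.tl_rev _ (h.route.lt i hi), G.hd_rev _ (h.route.lt i hi), node_succ]
    exact ⟨rfl, tl_eq_node h.route hi⟩

/-- If no node and no edge separates `T` from `S`, then there is an augmenting sequence. -/
theorem exists_earRoute (h : G.PathData A c₀ S T x l pos) {F : Set ℕ} (hF : G.Conn2 F S T) :
    ∃ z k, (G.earProblem (F \ G.edges x l) pos S T).IsRoute z k := by
  classical
  set B := F \ G.edges x l with hB
  let R := G.earProblem B pos S T
  let In : ℕ → Prop := fun d => d < G.M ∧ ∃ a < G.M, R.start a ∧
    Relation.ReflTransGen (fun i j => R.step i j ∧ j < R.Q) a d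
  by_contra hno
  have hT : ∀ d, In d → G.hd d ≠ T := by
    rintro d ⟨_, a, ha, hs, hr⟩ hdT
    exact hno (RouteProblem.exists_route (R := R) ha hs hdT hr)
  have hstart : ∀ g < G.M, G.ed g ∈ B → G.tl g = S → In g := fun g hg he ht =>
    ⟨hg, g, hg, ⟨he, ht⟩, .refl⟩
  have hnext : ∀ d g, In d → g < G.M → G.earStep B pos d g → In g := by
    rintro d g ⟨_, a, ha, hs, hr⟩ hg hst
    exact ⟨hg, a, ha, hs, hr.tail ⟨hst, hg⟩⟩
  -- The least such `k` is the index of the farthest path node that is entered, but at least `1`,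
  -- because node `0` is `S` and cannot serve as a separating node.
  have hex : ∃ k, 1 ≤ k ∧ ∀ d, In d → pos (G.hd d) ≤ k + 1 :=
    ⟨l + 1, by omega, fun d _ => h.pos_le _⟩
  obtain ⟨hb1, hb⟩ := Nat.find_spec hex
  have hmin : ∀ k, 1 ≤ k → k < Nat.find hex → ∃ d, In d ∧ k + 1 < pos (G.hd d) := by
    intro k hk hlt
    have := Nat.find_min hex hlt
    push Not at this
    exact this hk
  have hbl : Nat.find hex ≤ l + 1 := Nat.find_min' hex ⟨by omega, fun d _ => h.pos_le _⟩
  set b := Nat.find hex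
  -- If `0 < i`, minimality of `b` provides a reachable dart that enters the path at node `b` or
  -- beyond, and from there the sequence may go on from any earlier node.
  have hfront : ∀ g < G.M, G.ed g ∈ B → ∀ i < b, G.tl g = G.node S x i → In g := by
    intro g hg he i hi ht
    rcases Nat.eq_zero_or_pos i with rfl | hi0
    · exact hstart g hg he ht
    · obtain ⟨d, hd, hlt⟩ := hmin (b - 1) (by omega) (by omega)
      refine hnext d g hd hg ⟨he, .inr ⟨by omega, ?_⟩⟩
      rw [ht, h.pos_node i (by omega)]
      omega
  -- The side of `S` in the cut: path nodes before `b` and the reached nodes off the path. Edges of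
  -- `B` leave it only into node `b`.
  let Z : ℕ → Prop := fun v => (∃ i < b, v = G.node S x i) ∨ (pos v = 0 ∧ ∃ d, In d ∧ G.hd d = v)
  have hZstep : ∀ v, Z v → ∀ g < G.M, G.ed g ∈ B → G.tl g = v → G.hd g ≠ G.node S x b →
      Z (G.hd g) := by
    intro v hv g hg he ht hne
    have hin : In g := by
      rcases hv with ⟨i, hi, rfl⟩ | ⟨h0, d, hd, rfl⟩
      · exact hfront g hg he i hi ht
      · exact hnext d g hd hg ⟨he, .inl ⟨h0, ht.symm⟩⟩
    by_cases h0 : pos (G.hd g) = 0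
    · exact .inr ⟨h0, g, hin, rfl⟩
    · obtain ⟨i, hi, hv⟩ := h.pos_ne _ h0
      have h1 := hb g hin
      rw [← hv, h.pos_node i hi] at h1
      refine .inl ⟨i, ?_, hv.symm⟩
      rcases Nat.lt_or_ge i b with h2 | h2
      · exact h2
      · exact absurd (by rw [← hv]; congr 1; omega) hne
  have hZT : ¬ Z T := by
    rintro (⟨i, hi, h1⟩ | ⟨h0, _⟩)
    · rw [← h.node_last] at h1
      have := h.node_inj le_rfl (by omega) h1
      omega
    · rw [h.pos_T] at h0; omega
  have hZS : Z S := .inl ⟨0, by omega, node_zero.symm⟩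
  have hclose : ∀ F' X : Set ℕ, (∀ v, Z v → ∀ w, G.Step F' X v w → Z w) → ¬ G.Reach F' X S T := by
    exact fun F' X hc hr => hZT (hr.closed hZS hc)
  rcases Nat.eq_or_lt_of_le hbl with hbl | hbl
  -- Here node `b` is `T`. With `l > 0`, minimality of `b` would give a reachable dart with head
  -- `T`. So the path is a single edge, and this edge separates.
  · have hl : l = 0 := by
      by_contra hl
      obtain ⟨d, hd, hlt⟩ := hmin l (by omega) (by omega)
      have := h.pos_le (G.hd d)
      exact hT d hd (h.eq_T_of_pos (by omega))
    subst hl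
    refine hclose (F \ {G.ed (x 0)}) Set.univ ?_ (hF.1 _)
    rintro v hv w ⟨_, _, d, hd, ⟨he, hne⟩, rfl, rfl⟩
    have hdB : G.ed d ∈ B := ⟨he, by
      rintro ⟨i, hi, h1⟩
      rw [Nat.le_zero.1 hi] at h1
      exact hne h1.symm⟩
    have hin : In d := by
      rcases hv with ⟨i, hi, h1⟩ | ⟨h0, d', hd', h1⟩
      · exact hfront d hd hdB i hi h1
      · exact hnext d' d hd' hd ⟨hdB, .inl ⟨h1 ▸ h0, h1⟩⟩
    refine hZstep _ hv d hd hdB rfl ?_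
    rw [hbl, h.node_last]
    exact hT d hin
  -- Now node `b` lies strictly inside the path and separates, since path edges too leave `Z` only
  -- into it.
  · have hbS : G.node S x b ≠ S := by
      intro h1
      have := h.node_inj (i := b) (j := 0) (by omega) (by omega) (by rw [h1, node_zero])
      omega
    have hbT : G.node S x b ≠ T := by
      intro h1
      have := h.node_inj (i := b) (j := l + 1) (by omega) (by omega) (by rw [h1, h.node_last])
      omega
    refine hclose F _ ?_ (hF.2 _ hbS hbT)
    rintro v hv w ⟨_, hw, d, hd, he, rfl, rfl⟩
    by_cases hE : G.ed d ∈ G.edges x l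
    · obtain ⟨i, hi, _, ⟨h1, h2⟩ | ⟨h1, h2⟩⟩ := h.ends_of_mem_edges hd hE
      · rcases hv with ⟨j, hj, h3⟩ | ⟨h0, _⟩
        · rw [h1] at h3
          have := h.node_inj (by omega) (by omega) h3
          refine .inl ⟨i + 1, ?_, h2⟩
          rcases Nat.lt_or_ge (i + 1) b with h4 | h4
          · exact h4
          · exact absurd (by rw [h2]; congr 1; omega) hw
        · rw [h1, h.pos_node i (by omega)] at h0; omega
      · rcases hv with ⟨j, hj, h3⟩ | ⟨h0, _⟩
        · rw [h1] at h3
          have := h.node_inj (by omega) (by omega) h3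
          exact .inl ⟨i, by omega, h2⟩
        · rw [h1, h.pos_node (i + 1) (by omega)] at h0; omega
    · exact hZstep _ hv d hd ⟨he, hE⟩ rfl hw

end PathData

/-! ### The cost of augmenting sequences -/

/-- `Y i` is the last dart to arrive on the path before the dart `z i`. -/
structure IsLast (G : DartGraph) (pos Y z : ℕ → ℕ) (k : ℕ) : Prop where
  zero : Y 0 = G.M
  succ : ∀ i < k, Y (i + 1) = if pos (G.hd (z i)) = 0 then Y i else z i

/-- What is paid at the head of `z i`. -/
noncomputable def headCharge (G : DartGraph) (pos : ℕ → ℕ) (c : ℕ → ℝ) (z : ℕ → ℕ) (i : ℕ) : ℝ :=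
  if pos (G.hd (z i)) = 0 then max (c (G.rev (z i))) (c (z (i + 1))) else c (G.rev (z i))

/-- What is paid at the tail of `z i`. -/
noncomputable def tailCharge (G : DartGraph) (pos : ℕ → ℕ) (c : ℕ → ℝ) (Y z : ℕ → ℕ) (i : ℕ) : ℝ :=
  if i = 0 then c (z 0) else if pos (G.hd (z (i - 1))) = 0 then 0
    else G.startPrice c (Y (i - 1)) (z i)

variable {B : Set ℕ} {c : ℕ → ℝ} {Y z q : ℕ → ℕ} {k : ℕ}

/-- Off the path, the head of `z i` is the tail of `z (i + 1)`, and the maximum of both costs is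
booked at the head. On the path the two nodes differ, and the step cost splits into a head and a
tail part. -/
theorem augCost_eq (hY : ∀ i ≤ k, q i / G.M = Y i) (hz : ∀ i ≤ k, q i % G.M = z i)
    (hT : pos (G.hd (z k)) ≠ 0) :
    (G.augProblem B pos c S T).cost q k =
      ∑ i ∈ Finset.range (k + 1), G.headCharge pos c z i +
      ∑ i ∈ Finset.range (k + 1), G.tailCharge pos c Y z i := by
  rw [Finset.sum_range_succ, Finset.sum_range_succ', RouteProblem.cost]
  have h1 : ∑ i ∈ Finset.range k, (G.augProblem B pos c S T).stepCost (q i) (q (i + 1)) =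
      ∑ i ∈ Finset.range k, G.headCharge pos c z i +
        ∑ i ∈ Finset.range k, G.tailCharge pos c Y z (i + 1) := by
    rw [← Finset.sum_add_distrib]
    refine Finset.sum_congr rfl fun i hi => ?_
    rw [Finset.mem_range] at hi
    simp only [augProblem, headCharge, tailCharge, hz i hi.le, hz (i + 1) hi, hY i hi.le]
    by_cases h0 : pos (G.hd (z i)) = 0
    · simp [h0]
    · simp [h0]
  have h2 : (G.augProblem B pos c S T).startCost (q 0) = G.tailCharge pos c Y z 0 := by
    simp [augProblem, tailCharge, hz 0 (by omega)]
  have h3 : (G.augProblem B pos c S T).finishCost (q k) = G.headCharge pos c z k := by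
    simp [augProblem, headCharge, hz k le_rfl, hT]
  rw [h1, h2, h3]
  ring

theorem startPrice_nonneg (hc : ∀ d, 0 ≤ c d) (y d : ℕ) : 0 ≤ G.startPrice c y d := by
  unfold startPrice
  split_ifs
  · exact le_max_left _ _
  · exact hc _

theorem startPrice_le (hc : ∀ d, 0 ≤ c d) (y d : ℕ) : G.startPrice c y d ≤ c d := by
  unfold startPrice
  split_ifs
  · exact max_le (hc _) (by linarith [hc (G.rev y)])
  · exact le_rfl

theorem headCharge_nonneg (hc : ∀ d, 0 ≤ c d) (i : ℕ) : 0 ≤ G.headCharge pos c z i := by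
  unfold headCharge
  split_ifs
  · exact le_max_of_le_left (hc _)
  · exact hc _

theorem tailCharge_nonneg (hc : ∀ d, 0 ≤ c d) (i : ℕ) : 0 ≤ G.tailCharge pos c Y z i := by
  unfold tailCharge
  split_ifs
  · exact hc _
  · exact le_rfl
  · exact startPrice_nonneg hc _ _

/-- Sums with at most one non-zero term. -/
theorem sum_ite_eq_zero_or {k v : ℕ} {f : ℕ → ℕ} {w : ℕ → ℝ}
    (h : ∀ i j, i < k → j < k → f i = v → f j = v → w i ≠ 0 → w j ≠ 0 → i = j) :
    ∑ i ∈ Finset.range k, (if f i = v then w i else 0) = 0 ∨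
      ∃ i < k, f i = v ∧ w i ≠ 0 ∧ ∑ i ∈ Finset.range k, (if f i = v then w i else 0) = w i := by
  by_cases hex : ∃ i < k, f i = v ∧ w i ≠ 0
  · obtain ⟨i, hi, hf, hw⟩ := hex
    refine .inr ⟨i, hi, hf, hw, ?_⟩
    rw [Finset.sum_eq_single i, if_pos hf]
    · intro j hj hji
      rw [Finset.mem_range] at hj
      by_contra hne
      split_ifs at hne with hfj
      · exact hji (h j i hj hi hfj hf hne hw)
      · exact hne rfl
    · intro h'; exact absurd (Finset.mem_range.2 hi) h'
  · left
    refine Finset.sum_eq_zero fun i hi => ?_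
    rw [Finset.mem_range] at hi
    split_ifs with hf
    · by_contra hw
      exact hex ⟨i, hi, hf, hw⟩
    · rfl

/-- In a tight augmenting sequence, each node is charged at most its level. -/
theorem charge_le (hST : S ≠ T) (h : G.PathData A c₀ S T x l pos) (hc : ∀ d, 0 ≤ c d)
    (ht : (G.earProblem B pos S T).IsTight z k) (hY : G.IsLast pos Y z k)
    {L : ℕ → ℝ} (hL0 : ∀ v, 0 ≤ L v) (hL : G.Activates c L B) (v : ℕ) :
    ∑ i ∈ Finset.range (k + 1), (if G.hd (z i) = v then G.headCharge pos c z i else 0) +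
      ∑ i ∈ Finset.range (k + 1), (if G.tl (z i) = v then G.tailCharge pos c Y z i else 0) ≤ L v := by
  have hstep : ∀ i < k, G.earStep B pos (z i) (z (i + 1)) := ht.step
  have hfinish : G.hd (z k) = T := ht.finish
  have hB : ∀ i ≤ k, G.ed (z i) ∈ B := by
    intro i hi
    cases i with
    | zero => exact ht.start.1
    | succ i => exact (hstep i (by omega)).1
  have hlt : ∀ i ≤ k, z i < G.M := ht.lt
  have htail : ∀ i ≤ k, c (z i) ≤ L (G.tl (z i)) := fun i hi => hL _ (hlt i hi) (hB i hi)
  have hhead : ∀ i ≤ k, c (G.rev (z i)) ≤ L (G.hd (z i)) := fun i hi => by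
    rw [← G.tl_rev _ (hlt i hi)]
    exact hL _ (G.rev_lt _ (hlt i hi)) (by rw [G.ed_rev _ (hlt i hi)]; exact hB i hi)
  -- heads are distinct
  have hhd : ∀ i j, i < j → j ≤ k → G.hd (z i) ≠ G.hd (z j) := by
    intro i j hij hj he
    rcases Nat.eq_or_lt_of_le hj with rfl | hj
    · exact ht.no_finish i hij (he.trans hfinish)
    · refine ht.no_step i (j + 1) (by omega) hj ?_
      have := hstep j hj
      rw [earStep, ← he] at this
      exact this
  -- a charged tail starts an ear
  have hear : ∀ j ≤ k, G.tailCharge pos c Y z j ≠ 0 →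
      j = 0 ∨ (0 < j ∧ pos (G.hd (z (j - 1))) ≠ 0 ∧ pos (G.tl (z j)) ≠ 0 ∧
        pos (G.tl (z j)) < pos (G.hd (z (j - 1)))) := by
    intro j hj hne
    rcases Nat.eq_zero_or_pos j with h0 | h0
    · exact .inl h0
    · right
      have h1 : pos (G.hd (z (j - 1))) ≠ 0 := by
        intro h1
        simp [tailCharge, h0.ne', h1] at hne
      have := hstep (j - 1) (by omega)
      rw [Nat.sub_add_cancel h0] at this
      rcases this.2 with h2 | h2
      · exact absurd h2.1 h1
      · exact ⟨h0, h1, h2.2.1, h2.2.2⟩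
  -- With equal tails, `z j` could start the sequence or directly follow `z (i - 1)`, a shortcut in
  -- either case.
  have htl : ∀ i j, i < j → j ≤ k → G.tailCharge pos c Y z i ≠ 0 → G.tailCharge pos c Y z j ≠ 0 →
      G.tl (z i) ≠ G.tl (z j) := by
    intro i j hij hj hi0 hj0 he
    rcases hear i (by omega) hi0 with rfl | ⟨h0, h1, h2, h3⟩
    · exact ht.no_start j hij hj ⟨hB j hj, he.symm.trans ht.start.2⟩
    · refine ht.no_step (i - 1) j (by omega) hj ⟨hB j hj, .inr ⟨h1, ?_⟩⟩
      rw [← he]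
      exact ⟨h2, h3⟩
  have hA := sum_ite_eq_zero_or (k := k + 1) (v := v) (f := fun i => G.hd (z i))
    (w := G.headCharge pos c z) (by
      intro i j hi hj h1 h2 _ _
      rcases lt_trichotomy i j with h3 | h3 | h3
      · exact absurd (h1.trans h2.symm) (hhd i j h3 (by omega))
      · exact h3
      · exact absurd (h2.trans h1.symm) (hhd j i h3 (by omega)))
  have hC := sum_ite_eq_zero_or (k := k + 1) (v := v) (f := fun i => G.tl (z i))
    (w := G.tailCharge pos c Y z) (by
      intro i j hi hj h1 h2 h4 h5
      rcases lt_trichotomy i j with h3 | h3 | h3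
      · exact absurd (h1.trans h2.symm) (htl i j h3 (by omega) h4 h5)
      · exact h3
      · exact absurd (h2.trans h1.symm) (htl j i h3 (by omega) h5 h4))
  have hHle : ∀ i ≤ k, G.headCharge pos c z i ≤ L (G.hd (z i)) := by
    intro i hi
    unfold headCharge
    split_ifs with h0
    · refine max_le (hhead i hi) ?_
      have hik : i < k := by
        rcases Nat.eq_or_lt_of_le hi with rfl | hi
        · rw [hfinish, h.pos_T] at h0; omega
        · exact hi
      rcases (hstep i hik).2 with h1 | h1
      · rw [h1.2]; exact htail (i + 1) hik
      · exact absurd h0 h1.1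
    · exact hhead i hi
  have hTle : ∀ i ≤ k, G.tailCharge pos c Y z i ≤ L (G.tl (z i)) := by
    intro i hi
    unfold tailCharge
    split_ifs with h0 h1
    · subst h0; exact htail 0 (by omega)
    · exact hL0 _
    · exact (startPrice_le hc _ _).trans (htail i hi)
  rcases hA with hA | ⟨i, hi, hiv, _, hA⟩ <;> rcases hC with hC | ⟨j, hj, hjv, hj0, hC⟩
  · rw [hA, hC]; simpa using hL0 v
  · rw [hA, hC, zero_add, ← hjv]; exact hTle j (by omega)
  · rw [hA, hC, add_zero, ← hiv]; exact hHle i (by omega)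
  · rw [hA, hC]
    -- the credit of the arrival `z i` is used by the start `z j`
    have hposv : pos v ≠ 0 := by
      rcases hear j (by omega) hj0 with rfl | h1
      · rw [← hjv, show G.tl (z 0) = S from ht.start.2, h.pos_S]; omega
      · rw [← hjv]; exact h1.2.2.1
    have hjump : i < k → pos (G.tl (z (i + 1))) ≠ 0 ∧ pos (G.tl (z (i + 1))) < pos v := by
      intro hik
      rcases (hstep i hik).2 with h1 | h1
      · rw [hiv] at h1; exact absurd h1.1 hposv
      · rw [hiv] at h1; exact h1.2
    -- `v` cannot be `S`: no path node precedes `S`, so a sequence that arrives there cannot go on.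
    rcases hear j (by omega) hj0 with rfl | ⟨h0, h1, h2, h3⟩
    · exfalso
      have hvS : v = S := hjv.symm.trans ht.start.2
      rcases Nat.eq_or_lt_of_le (Nat.lt_succ_iff.1 hi) with rfl | hik
      · exact hST (hvS.symm.trans (hiv.symm.trans hfinish))
      · have := hjump hik
        rw [hvS, h.pos_S] at this
        omega
    · obtain ⟨j, rfl⟩ : ∃ j', j = j' + 1 := ⟨j - 1, by omega⟩
      simp only [Nat.add_sub_cancel] at h1 h3
      rw [hjv] at h2 h3
      -- If `z i` arrived after `z j`, its successor would start before `v`, hence before the head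
      -- of `z j`, and could follow `z j` directly.
      have hij : i < j := by
        rcases lt_trichotomy i j with h4 | h4 | h4
        · exact h4
        · subst h4; rw [hiv] at h3; omega
        · exfalso
          rcases Nat.eq_or_lt_of_le (Nat.lt_succ_iff.1 hi) with rfl | hik
          · rw [← hiv, hfinish, h.pos_T] at h3
            have := h.pos_le (G.hd (z j))
            omega
          · have h5 := hjump hik
            exact ht.no_step j (i + 1) (by omega) hik
              ⟨hB _ hik, .inr ⟨h1, h5.1, by omega⟩⟩
      -- An arrival `z p` in between is impossible. Beyond `v` it could be followed directly by `z
      -- (j + 1)`. Otherwise its successor starts before `v` and could directly follow `z i`.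
      have hmid : ∀ p, i < p → p < j → pos (G.hd (z p)) = 0 := by
        intro p hip hpj
        by_contra hp
        rcases Nat.lt_or_ge (pos v) (pos (G.hd (z p))) with h5 | h5
        · exact ht.no_step p (j + 1) (by omega) (by omega)
            ⟨hB _ (by omega), .inr ⟨hp, by rw [hjv]; exact h2, by rw [hjv]; exact h5⟩⟩
        · rcases (hstep p (by omega)).2 with h6 | h6
          · exact hp h6.1
          · exact ht.no_step i (p + 1) (by omega) (by omega)
              ⟨hB _ (by omega), .inr ⟨by rw [hiv]; exact hposv, h6.2.1, by rw [hiv]; omega⟩⟩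
      -- So `z i` is still the remembered arrival when `z j` reaches the path, and the start price
      -- of `z (j + 1)` credits it.
      have hYp : ∀ p, i < p → p ≤ j → Y p = z i := by
        intro p hip
        induction p, hip using Nat.le_induction with
        | base =>
          intro _
          rw [hY.succ i (by omega), hiv, if_neg hposv]
        | succ p hip ih =>
          intro hpj
          rw [hY.succ p (by omega), if_pos (hmid p hip (by omega))]
          exact ih (by omega)
      have e1 : G.headCharge pos c z i = c (G.rev (z i)) := by
        rw [headCharge, hiv, if_neg hposv]
      have e2 : G.tailCharge pos c Y z (j + 1) = max 0 (c (z (j + 1)) - c (G.rev (z i))) := by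
        rw [tailCharge, if_neg (by omega), Nat.add_sub_cancel, if_neg h1, startPrice,
          hYp j hij le_rfl, if_pos ⟨hlt i (by omega), by rw [hiv, hjv]⟩]
      rw [e1, e2]
      have h7 := hhead i (by omega)
      have h8 := htail (j + 1) (by omega)
      rw [hiv] at h7
      rw [hjv] at h8
      -- With the credit, both charges together are the maximum of the two costs, and `L v` covers
      -- each of them.
      rcases max_cases 0 (c (z (j + 1)) - c (G.rev (z i))) with h9 | h9 <;> rw [h9.1] <;> linarith

theorem exists_isLast (G : DartGraph) (pos z : ℕ → ℕ) (k : ℕ) (hz : ∀ i ≤ k, z i < G.M) :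
    ∃ Y, G.IsLast pos Y z k ∧ ∀ i ≤ k, Y i ≤ G.M := by
  let Y : ℕ → ℕ := fun i => Nat.rec G.M (fun j y => if pos (G.hd (z j)) = 0 then y else z j) i
  refine ⟨Y, ⟨rfl, fun i _ => rfl⟩, fun i => ?_⟩
  induction i with
  | zero => exact fun _ => le_rfl
  | succ i ih =>
    intro hi
    change (if pos (G.hd (z i)) = 0 then Y i else z i) ≤ G.M
    split_ifs
    · exact ih (by omega)
    · exact (hz i (by omega)).le

/-- If no node and no edge separates `T` from `S`, then there is an augmenting sequence whose cost is
at most the sum of the levels. -/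
theorem augProblem_complete (hST : S ≠ T) (h : G.PathData A c₀ S T x l pos) (hc : ∀ d, 0 ≤ c d)
    {F A₂ : Set ℕ} (hF : G.Conn2 F S T) (hA : F ⊆ A₂) {L : ℕ → ℝ} (hL0 : ∀ v, 0 ≤ L v)
    (hL : G.Activates c L F) :
    ∃ q k, (G.augProblem (A₂ \ G.edges x l) pos c S T).IsRoute q k ∧ k + 1 ≤ G.M ∧
      (G.augProblem (A₂ \ G.edges x l) pos c S T).cost q k ≤ ∑ v ∈ Finset.range G.n, L v := by
  obtain ⟨z, k, hr⟩ := h.exists_earRoute hF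
  obtain ⟨z, k, ht⟩ := RouteProblem.exists_tight hr
  have hlt : ∀ i ≤ k, z i < G.M := ht.lt
  obtain ⟨Y, hY, hYM⟩ := exists_isLast G pos z k hlt
  let q : ℕ → ℕ := fun i => Y i * G.M + z i
  have hqY : ∀ i ≤ k, q i / G.M = Y i := fun i hi => by
    have := hlt i hi
    simp only [q]
    rw [mul_comm, Nat.mul_add_div (by omega), Nat.div_eq_of_lt this, add_zero]
  have hqz : ∀ i ≤ k, q i % G.M = z i := fun i hi => by
    have := hlt i hi
    simp only [q]
    rw [mul_comm, Nat.mul_add_mod, Nat.mod_eq_of_lt this]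
  have hsub : F \ G.edges x l ⊆ A₂ \ G.edges x l := Set.sdiff_subset_sdiff_left hA
  have hroute : (G.augProblem (A₂ \ G.edges x l) pos c S T).IsRoute q k := by
    refine ⟨fun i hi => ?_, ?_, fun i hi => ?_, ?_⟩
    · have h1 := hlt i hi
      have h2 := Nat.mul_le_mul_right G.M (hYM i hi)
      change Y i * G.M + z i < (G.M + 1) * G.M
      rw [add_mul, one_mul]
      omega
    · change _ ∧ _ ∧ _
      rw [hqY 0 (by omega), hqz 0 (by omega)]
      exact ⟨hY.zero, hsub ht.start.1, ht.start.2⟩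
    · change _ ∧ _
      have h1 : G.earStep _ pos (z i) (z (i + 1)) := ht.step i hi
      rw [hqY i hi.le, hqz i hi.le, hqY (i + 1) hi, hqz (i + 1) hi, hY.succ i hi]
      refine ⟨hsub h1.1, ?_⟩
      rcases h1.2 with h2 | h2
      · exact .inl ⟨h2.1, h2.2, by rw [if_pos h2.1]⟩
      · exact .inr ⟨h2.1, h2.2.1, h2.2.2, by rw [if_neg h2.1]⟩
    · change G.hd (q k % G.M) = T
      rw [hqz k le_rfl]
      exact ht.finish
  refine ⟨q, k, hroute, ht.lt_Q, ?_⟩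
  have hTk : G.hd (z k) = T := ht.finish
  rw [augCost_eq hqY hqz (by rw [hTk, h.pos_T]; omega),
    ← sum_spread (n := G.n) (v := fun i => G.hd (z i)) (fun i hi => hd_lt (hlt i (by omega)))
      (G.headCharge pos c z),
    ← sum_spread (n := G.n) (v := fun i => G.tl (z i)) (fun i hi => G.tl_lt _ (hlt i (by omega)))
      (G.tailCharge pos c Y z), ← Finset.sum_add_distrib]
  exact Finset.sum_le_sum fun v _ => charge_le hST h hc ht hY hL0
    (fun d hd he => hL d hd he.1) v

/-- The levels paid by an augmenting sequence activate its edges. -/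
theorem augProblem_sound_cost (hc : ∀ d, 0 ≤ c d) (hST : pos T ≠ 0)
    (h : (G.augProblem B pos c S T).IsRoute q k) :
    ∃ L : ℕ → ℝ, (∀ v, 0 ≤ L v) ∧ G.Activates c L (G.edges (fun i => q i % G.M) k) ∧
      ∑ v ∈ Finset.range G.n, L v = (G.augProblem B pos c S T).cost q k := by
  set z : ℕ → ℕ := fun i => q i % G.M with hz
  let Y : ℕ → ℕ := fun i => q i / G.M
  have hM : 0 < G.M := by
    have h1 : q 0 < (G.M + 1) * G.M := h.lt 0 (by omega)
    rcases Nat.eq_zero_or_pos G.M with h0 | h0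
    · rw [h0] at h1; simp at h1
    · exact h0
  have hlt : ∀ i, z i < G.M := fun i => Nat.mod_lt _ hM
  have hfinish : G.hd (z k) = T := h.finish
  -- A remembered dart occurs earlier in the sequence, so its head cost is contained in `LH`, and
  -- the credit given for it is justified.
  have hYlast : ∀ i ≤ k, Y i = G.M ∨ ∃ p < i, Y i = z p ∧ pos (G.hd (z p)) ≠ 0 := by
    intro i
    induction i with
    | zero => exact fun _ => .inl h.start.1
    | succ i ih =>
      intro hi
      rcases (h.step i hi).2 with h1 | h1
      · rcases ih (by omega) with h2 | ⟨p, hp, h2, h3⟩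
        · exact .inl (h1.2.2.symm.trans h2)
        · exact .inr ⟨p, by omega, h1.2.2.symm.trans h2, h3⟩
      · exact .inr ⟨i, by omega, h1.2.2.2, h1.1⟩
  have hHn : ∀ i < k + 1, 0 ≤ G.headCharge pos c z i := fun i _ => headCharge_nonneg hc i
  have hTn : ∀ i < k + 1, 0 ≤ G.tailCharge pos c Y z i := fun i _ => tailCharge_nonneg hc i
  let LH : ℕ → ℝ := fun v =>
    ∑ i ∈ Finset.range (k + 1), (if G.hd (z i) = v then G.headCharge pos c z i else 0)
  let LT : ℕ → ℝ := fun v =>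
    ∑ i ∈ Finset.range (k + 1), (if G.tl (z i) = v then G.tailCharge pos c Y z i else 0)
  have hLH : ∀ v, 0 ≤ LH v := fun v => spread_nonneg (v := fun i => G.hd (z i)) hHn v
  have hLT : ∀ v, 0 ≤ LT v := fun v => spread_nonneg (v := fun i => G.tl (z i)) hTn v
  have hLHi : ∀ i ≤ k, G.headCharge pos c z i ≤ LH (G.hd (z i)) := fun i hi =>
    le_spread (v := fun i => G.hd (z i)) hHn (by omega)
  have hLTi : ∀ i ≤ k, G.tailCharge pos c Y z i ≤ LT (G.tl (z i)) := fun i hi =>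
    le_spread (v := fun i => G.tl (z i)) hTn (by omega)
  have hhead : ∀ i, c (G.rev (z i)) ≤ G.headCharge pos c z i := by
    intro i
    unfold headCharge
    split_ifs
    · exact le_max_left _ _
    · exact le_rfl
  refine ⟨fun v => LH v + LT v, fun v => add_nonneg (hLH v) (hLT v), ?_, ?_⟩
  · rintro d hd ⟨i, hi, he⟩
    rcases G.eq_or_eq_rev d hd (z i) (hlt i) he.symm with rfl | rfl
    · cases i with
      | zero =>
        have := hLTi 0 (by omega)
        simp only [tailCharge, if_true] at this
        linarith [hLH (G.tl (z 0))]
      | succ i =>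
        rcases (h.step i hi).2 with h1 | h1
        · have h2 := hLHi i (by omega)
          have h3 : c (z (i + 1)) ≤ G.headCharge pos c z i := by
            unfold headCharge
            rw [if_pos h1.1]
            exact le_max_right _ _
          rw [show G.hd (z i) = G.tl (z (i + 1)) from h1.2.1] at h2
          linarith [hLT (G.tl (z (i + 1)))]
        · have h2 := hLTi (i + 1) hi
          rw [tailCharge, if_neg (by omega), Nat.add_sub_cancel, if_neg h1.1, startPrice] at h2
          split_ifs at h2 with h3
          · rcases hYlast i (by omega) with h4 | ⟨p, hp, h4, h5⟩
            · exact absurd h4 h3.1.ne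
            · have h6 := hLHi p (by omega)
              rw [← h4, h3.2] at h6
              have h7 := hhead p
              rw [← h4] at h7
              have h8 := le_max_right 0 (c (z (i + 1)) - c (G.rev (Y i)))
              linarith
          · linarith [hLH (G.tl (z (i + 1)))]
    · rw [G.tl_rev _ (hlt i)]
      linarith [hLHi i hi, hhead i, hLT (G.hd (z i))]
  · rw [augCost_eq (Y := Y) (z := z) (fun _ _ => rfl) (fun _ _ => rfl) (by rw [hfinish]; exact hST),
      Finset.sum_add_distrib]
    congr 1
    · exact sum_spread (v := fun i => G.hd (z i)) (fun i _ => hd_lt (hlt i)) _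
    · exact sum_spread (v := fun i => G.tl (z i)) (fun i _ => G.tl_lt _ (hlt i)) _

/-- The path together with an augmenting sequence has no separating edge or node. -/
theorem augProblem_sound_conn (h : G.PathData A c₀ S T x l pos)
    (hq : (G.augProblem B pos c S T).IsRoute q k) (hB : ∀ e ∈ B, e ∉ G.edges x l) :
    G.Conn2 (G.edges x l ∪ G.edges (fun i => q i % G.M) k) S T := by
  set z : ℕ → ℕ := fun i => q i % G.M with hz
  have hM : 0 < G.M := by
    have h1 : q 0 < (G.M + 1) * G.M := hq.lt 0 (by omega)
    rcases Nat.eq_zero_or_pos G.M with h0 | h0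
    · rw [h0] at h1; simp at h1
    · exact h0
  have hlt : ∀ i, z i < G.M := fun i => Nat.mod_lt _ hM
  have hzB : ∀ i ≤ k, G.ed (z i) ∈ B := by
    intro i hi
    cases i with
    | zero => exact hq.start.2.1
    | succ i => exact (hq.step i hi).1
  -- One argument for an edge or a node deleted at index `j`. Path nodes before `j` are still
  -- reachable from `S`, and those after `j` still reach `T`. If `T` were cut off, every landing
  -- would be at index at most `j`, the next tail would lie before `j`, and so all tails, finally
  -- that of the dart into `T`, would be reachable.
  have key : ∀ (F X : Set ℕ) (j : ℕ), (∀ i ≤ k, G.ed (z i) ∈ F) → (∀ v, pos v = 0 → v ∈ X) →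
      S ∈ X → (∀ a < j, a ≤ l + 1 → G.node S x a ∈ X ∧ G.Reach F X S (G.node S x a)) →
      (∀ b, j < b → b ≤ l + 1 → G.node S x b ∈ X ∧ G.Reach F X (G.node S x b) T) → j ≤ l →
      G.Reach F X S T := by
    intro F X j hF hX hSX hpre hsuf hj
    by_contra hno
    have hinv : ∀ i ≤ k, G.tl (z i) ∈ X ∧ G.Reach F X S (G.tl (z i)) := by
      intro i
      induction i with
      | zero =>
        intro _
        rw [show G.tl (z 0) = S from hq.start.2.2]
        exact ⟨hSX, .refl⟩
      | succ i ih =>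
        intro hi
        obtain ⟨h1, h2⟩ := ih (by omega)
        rcases (hq.step i hi).2 with h3 | h3
        · have h4 := hX _ h3.1
          have h5 : G.hd (z i) = G.tl (z (i + 1)) := h3.2.1
          have h6 := h2.trans (reach_dart (hlt i) (hF i (by omega)) h1 h4)
          rw [← h5]
          exact ⟨h4, h6⟩
        · obtain ⟨b, hb, hb'⟩ := h.pos_ne _ h3.1
          obtain ⟨a, ha, ha'⟩ := h.pos_ne _ h3.2.1
          have hab := h3.2.2.1
          rw [← hb', ← ha', h.pos_node a ha, h.pos_node b hb] at hab
          rcases Nat.lt_or_ge j b with hjb | hjb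
          · exfalso
            obtain ⟨h4, h5⟩ := hsuf b hjb hb
            rw [hb'] at h4 h5
            exact hno ((h2.trans (reach_dart (hlt i) (hF i (by omega)) h1 h4)).trans h5)
          · have := hpre a (by omega) ha
            rwa [ha'] at this
    obtain ⟨h1, h2⟩ := hinv k le_rfl
    have h3 := (hsuf (l + 1) (by omega) le_rfl).1
    rw [h.node_last] at h3
    have h4 : G.hd (z k) = T := hq.finish
    have h5 := reach_dart (hlt k) (hF k le_rfl) h1 (by rw [h4]; exact h3)
    rw [h4] at h5
    exact hno (h2.trans h5)
  have hmem : ∀ i ≤ l, G.ed (x i) ∈ G.edges x l := fun i hi => ⟨i, hi, rfl⟩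
  have hmemz : ∀ i ≤ k, G.ed (z i) ∈ G.edges z k := fun i hi => ⟨i, hi, rfl⟩
  constructor
  · intro e
    by_cases he : ∃ j ≤ l, G.ed (x j) = e
    · obtain ⟨j, hj, rfl⟩ := he
      -- The path uses no edge twice: the same direction gives equal indices, the opposite one both
      -- `j' = j + 1` and `j = j' + 1`.
      by_cases hdup : ∃ j' ≤ l, j' ≠ j ∧ G.ed (x j') = G.ed (x j)
      · exfalso
        obtain ⟨j', hj', hne, he⟩ := hdup
        obtain ⟨i, hi, _, h1⟩ := h.ends_of_mem_edges (h.route.lt j' hj') ⟨j, hj, he.symm⟩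
        rcases G.eq_or_eq_rev _ (h.route.lt j' hj') _ (h.route.lt j hj) he with h2 | h2
        · have h3 := tl_eq_node h.route hj'
          rw [h2, tl_eq_node h.route hj] at h3
          exact hne (h.node_inj (by omega) (by omega) h3).symm
        · have h3 := tl_eq_node h.route hj'
          rw [h2, G.tl_rev _ (h.route.lt j hj), ← node_succ (S := S)] at h3
          have h4 := h.node_inj (by omega) (by omega) h3
          have h5 : G.hd (x j') = G.tl (x j) := by rw [h2, G.hd_rev _ (h.route.lt j hj)]
          rw [← node_succ (S := S), tl_eq_node h.route hj] at h5
          have h6 := h.node_inj (by omega) (by omega) h5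
          omega
      have hother : ∀ i ≤ l, i ≠ j → G.ed (x i) ∈ (G.edges x l ∪ G.edges z k) \ {G.ed (x j)} :=
        fun i hi hij => ⟨.inl (hmem i hi), fun h' => hdup ⟨i, hi, hij, h'⟩⟩
      refine key _ _ j (fun i hi => ⟨.inr (hmemz i hi), fun h' => ?_⟩) (fun _ _ => trivial) trivial
        (fun a ha hal => ⟨trivial, ?_⟩) (fun b hb hbl => ⟨trivial, ?_⟩) hj
      · rw [Set.mem_singleton_iff] at h'
        exact hB _ (hzB i hi) (h' ▸ hmem j hj)
      · have := reach_node h.route (F := (G.edges x l ∪ G.edges z k) \ {G.ed (x j)})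
          (X := Set.univ) (Nat.zero_le a) hal (fun _ _ _ => trivial)
          (fun i _ hi => hother i (by omega) (by omega))
        rwa [node_zero] at this
      · have := reach_node h.route (F := (G.edges x l ∪ G.edges z k) \ {G.ed (x j)})
          (X := Set.univ) hbl le_rfl (fun _ _ _ => trivial)
          (fun i h1 hi => hother i (by omega) (by omega))
        rwa [h.node_last] at this
    · have := reach_node h.route (F := (G.edges x l ∪ G.edges z k) \ {e})
        (X := Set.univ) (Nat.zero_le _) le_rfl (fun _ _ _ => trivial)
        (fun i _ hi => ⟨.inl (hmem i (by omega)), fun h' => he ⟨i, by omega, h'⟩⟩)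
      rwa [node_zero, h.node_last] at this
  · intro v hvS hvT
    by_cases hv : pos v = 0
    · have := reach_node h.route (F := G.edges x l ∪ G.edges z k)
        (X := {v}ᶜ) (Nat.zero_le _) le_rfl (fun i _ hi => by
          rintro rfl
          rw [h.pos_node i hi] at hv
          omega)
        (fun i _ hi => .inl (hmem i (by omega)))
      rwa [node_zero, h.node_last] at this
    · obtain ⟨j, hj, rfl⟩ := h.pos_ne v hv
      have hjl : j ≤ l := by
        by_contra h1
        rw [show j = l + 1 by omega, h.node_last] at hvT
        exact hvT rfl
      have hne : ∀ i ≤ l + 1, i ≠ j → G.node S x i ∈ ({G.node S x j}ᶜ : Set ℕ) :=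
        fun i hi hij h' => hij (h.node_inj hi hj h')
      refine key _ _ j (fun i hi => .inr (hmemz i hi)) (fun v hv0 => ?_) (fun h' => hvS h'.symm)
        (fun a ha hal => ⟨hne a hal (by omega), ?_⟩) (fun b hb hbl => ⟨hne b hbl (by omega), ?_⟩) hjl
      · rintro rfl; exact hv hv0
      · have := reach_node h.route (F := G.edges x l ∪ G.edges z k)
          (X := {G.node S x j}ᶜ) (Nat.zero_le a) hal (fun i _ hi => hne i (by omega) (by omega))
          (fun i _ hi => .inl (hmem i (by omega)))
        rwa [node_zero] at this
      · have := reach_node h.route (F := G.edges x l ∪ G.edges z k)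
          (X := {G.node S x j}ᶜ) hbl le_rfl (fun i h1 hi => hne i (by omega) (by omega))
          (fun i _ hi => .inl (hmem i (by omega)))
        rwa [h.node_last] at this

end DartGraph

/-! ### A cheapest path, augmented at reduced costs -/

namespace DartGraph

variable {G : DartGraph} {A₁ A₂ : Set ℕ} {c : ℕ → ℝ} {S T K : ℕ} {x q : ℕ → ℕ} {l k : ℕ}
  {pos : ℕ → ℕ} {lev red : ℕ → ℝ}

/-- What the algorithm computes from a cheapest path `x 0, …, x l`: the positions `pos` of its nodes,
its levels `lev`, and the reduced costs `red`. -/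
structure ReducedCosts (G : DartGraph) (c : ℕ → ℝ) (S : ℕ) (x : ℕ → ℕ) (l : ℕ) (pos : ℕ → ℕ)
    (lev red : ℕ → ℝ) : Prop where
  pos_eq : ∀ v, pos v = if v = S then 1 else
    if searchVal (fun i => i ≤ l ∧ G.hd (x i) = v) (l + 1) = 0 then 0
    else searchVal (fun i => i ≤ l ∧ G.hd (x i) = v) (l + 1) + 1
  lev_nonneg : ∀ v, 0 ≤ lev v
  lev_ge : G.Activates c lev (G.edges x l)
  lev_le : ∀ v, lev v ≤ 0 ∨ ∃ d < G.M, G.ed d ∈ G.edges x l ∧ G.tl d = v ∧ lev v ≤ c d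
  red_eq : ∀ d, red d = max 0 (c d - lev (G.tl d))

/-- A best path is simple, so the search for the dart that enters a node has a unique answer and
positions are well defined. -/
theorem ReducedCosts.pathData (h : G.ReducedCosts c S x l pos lev red) (hc : ∀ d, 0 ≤ c d)
    (hST : S ≠ T) (hx : (G.pathProblem A₁ c S T).IsBest K x l) :
    G.PathData A₁ c S T x l pos := by
  have hinj := IsBest.node_injOn hc hST hx
  refine ⟨hx.isRoute, fun i hi => ?_, fun v hv => ?_⟩
  · rw [h.pos_eq]
    cases i with
    | zero => simp [node_zero]
    | succ i =>
      have hne : G.node S x (i + 1) ≠ S := by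
        intro h'
        rw [← node_zero (G := G) (S := S) (x := x)] at h'
        have := hinj (by simp; omega) (by simp) h'
        omega
      rw [if_neg hne]
      set p : ℕ → Prop := fun j => j ≤ l ∧ G.hd (x j) = G.node S x (i + 1)
      have h0 : searchVal p (l + 1) ≠ 0 := by
        intro h0
        exact searchVal_eq_zero.1 h0 i (by omega) ⟨by omega, (node_succ i).symm⟩
      rw [if_neg h0]
      obtain ⟨h1, h2, _⟩ := searchVal_spec h0
      have h3 := h2.2
      rw [← node_succ (S := S)] at h3
      have := hinj (by simp; omega) (by simp; omega) h3
      omega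
  · rw [h.pos_eq] at hv
    split_ifs at hv with h1 h2
    · exact ⟨0, by omega, by rw [h1, node_zero]⟩
    · exact absurd rfl hv
    · obtain ⟨h3, h4, _⟩ := searchVal_spec h2
      exact ⟨_, by omega, (node_succ _).trans h4.2⟩

/-- The levels of the path and of the sequence add up: a dart of the sequence only needs the excess
of its cost over what the path already pays at its tail. -/
theorem core_sound (h : G.ReducedCosts c S x l pos lev red) (hc : ∀ d, 0 ≤ c d)
    (hST : S ≠ T) (hS : S < G.n) (hx : (G.pathProblem A₁ c S T).IsBest K x l)
    (hq : (G.augProblem (A₂ \ G.edges x l) pos red S T).IsRoute q k) :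
    G.edges x l ∪ G.edges (fun i => q i % G.M) k ⊆ A₁ ∪ A₂ ∧
    G.Conn2 (G.edges x l ∪ G.edges (fun i => q i % G.M) k) S T ∧
    ∃ L : ℕ → ℝ, (∀ v, 0 ≤ L v) ∧
      G.Activates c L (G.edges x l ∪ G.edges (fun i => q i % G.M) k) ∧
      ∑ v ∈ Finset.range G.n, L v ≤ (G.pathProblem A₁ c S T).cost x l +
        (G.augProblem (A₂ \ G.edges x l) pos red S T).cost q k := by
  have hP := h.pathData hc hST hx
  have hred : ∀ d, 0 ≤ red d := fun d => by rw [h.red_eq]; exact le_max_left _ _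
  refine ⟨?_, augProblem_sound_conn hP hq fun e he => he.2, ?_⟩
  · rintro e (⟨i, hi, rfl⟩ | ⟨i, hi, rfl⟩)
    · exact .inl (ed_mem hx.isRoute hi)
    · right
      cases i with
      | zero => exact hq.start.2.1.1
      | succ i => exact (hq.step i hi).1.1
  · obtain ⟨L, hL0, hL, hsum⟩ := augProblem_sound_cost hred (by rw [hP.pos_T]; omega) hq
    refine ⟨fun v => lev v + L v, fun v => add_nonneg (h.lev_nonneg v) (hL0 v), ?_, ?_⟩
    · rintro d hd (he | he)
      · have := h.lev_ge d hd he
        linarith [hL0 (G.tl d)]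
      · have h1 := hL d hd he
        rw [h.red_eq] at h1
        linarith [le_max_right 0 (c d - lev (G.tl d))]
    · rw [Finset.sum_add_distrib, hsum]
      have := pathProblem_sound hc hS hx.isRoute h.lev_le
      linarith

/-- Reducing costs only makes activation easier, so levels that activate `F` at the costs `c` also
do so at the costs `red`. -/
theorem core_complete (h : G.ReducedCosts c S x l pos lev red) (hc : ∀ d, 0 ≤ c d)
    (hST : S ≠ T) (hx : (G.pathProblem A₁ c S T).IsBest K x l) {F : Set ℕ} (hF : F ⊆ A₂)
    (hconn : G.Conn2 F S T) {L : ℕ → ℝ} (hL0 : ∀ v, 0 ≤ L v) (hL : G.Activates c L F) :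
    ∃ q k, (G.augProblem (A₂ \ G.edges x l) pos red S T).IsRoute q k ∧ k + 1 ≤ G.M ∧
      (G.augProblem (A₂ \ G.edges x l) pos red S T).cost q k ≤ ∑ v ∈ Finset.range G.n, L v := by
  refine augProblem_complete hST (h.pathData hc hST hx)
    (fun d => by rw [h.red_eq]; exact le_max_left _ _) hconn hF hL0 fun d hd he => ?_
  rw [h.red_eq]
  exact max_le (hL0 _) (by linarith [hL d hd he, h.lev_nonneg (G.tl d)])

end DartGraph

/-! ## Two disjoint paths -/

namespace SimpleGraph

variable {V : Type*} {G : SimpleGraph V}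

/-- The part of a walk up to the first vertex of a set. -/
theorem Walk.exists_walk_first_mem {s w : V} (r : G.Walk w s) (Z : Set V) (hs : s ∈ Z) :
    ∃ z ∈ Z, ∃ r' : G.Walk w z, (∀ x ∈ r'.support, x ∈ r.support) ∧
      ∀ x ∈ r'.support, x ∈ Z → x = z := by
  induction r with
  | nil => exact ⟨_, hs, .nil, by simp, by simp⟩
  | @cons a b c hab r ih =>
    by_cases ha : a ∈ Z
    · exact ⟨a, ha, .nil, by simp, by simp⟩
    · obtain ⟨z, hz, r', h1, h2⟩ := ih hs
      refine ⟨z, hz, .cons hab r', ?_, ?_⟩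
      · simp only [Walk.support_cons, List.mem_cons]
        rintro x (rfl | hx)
        · exact .inl rfl
        · exact .inr (h1 x hx)
      · simp only [Walk.support_cons, List.mem_cons]
        rintro x (rfl | hx) hxZ
        · exact absurd hxZ ha
        · exact h2 x hx hxZ

/-- One step of the construction of two internally disjoint paths: reroute the path `p` to a
neighbour `w` of its end `v`, and extend the path `q` by `w`. -/
theorem exists_disjoint_paths_of_reroute {s v w z : V} {p q : G.Walk s v} (hp : p.IsPath)
    (hq : q.IsPath) (hpq : ∀ x ∈ p.support, x ∈ q.support → x = s ∨ x = v) (hvs : v ≠ s)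
    (hvw : G.Adj v w) (r : G.Walk w z) (hz : z ∈ p.support) (hv : v ∉ r.support)
    (hr : ∀ x ∈ r.support, x ∈ p.support ∨ x ∈ q.support → x = z) (hwq : w ∉ q.support) :
    ∃ p q : G.Walk s w, p.IsPath ∧ q.IsPath ∧
      ∀ x ∈ p.support, x ∈ q.support → x = s ∨ x = w := by
  classical
  have hzv : z ≠ v := fun h => hv (h ▸ r.end_mem_support)
  -- The first path leaves `p` at `z` and runs along `r` backwards to `w`. It gives up the rest of
  -- `p`, including `v`, so that `q` may pass through `v`.
  refine ⟨((p.takeUntil z hz).append r.reverse).bypass, q.concat hvw, Walk.bypass_isPath _,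
    hq.concat hwq hvw, fun x hx hxq => ?_⟩
  have hx := Walk.support_bypass_subset_support _ hx
  rw [Walk.mem_support_append_iff, Walk.support_reverse, List.mem_reverse] at hx
  rw [Walk.support_concat, List.mem_append, List.mem_singleton] at hxq
  rcases hxq with hxq | hxq
  · rcases hx with hx | hx
    · rcases hpq x (p.support_takeUntil_subset_support hz hx) hxq with h | rfl
      · exact .inl h
      · exact absurd hx (Walk.endpoint_notMem_support_takeUntil hp hz hzv.symm)
    · obtain rfl := hr x hx (.inr hxq)
      rcases hpq x hz hxq with h | h
      · exact .inl h
      · exact absurd h hzv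
  · exact .inr hxq

/-- If no vertex separates `t` from `s`, then there are two internally disjoint walks from `s` to
`t`. -/
theorem exists_disjoint_walks {s t : V} (hne : s ≠ t)
    (h : ∀ x, x ≠ s → x ≠ t → ∃ p : G.Walk s t, x ∉ p.support) (hst : G.Reachable s t) :
    ∃ p q : G.Walk s t, ∀ x ∈ p.support, x ∈ q.support → x = s ∨ x = t := by
  classical
  -- The common end `v` of two internally disjoint paths from `s` moves along `W` towards `t`.
  have key : ∀ v (W : G.Walk v t), W.IsPath → s ∉ W.support →
      (∃ p q : G.Walk s v, p.IsPath ∧ q.IsPath ∧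
        ∀ x ∈ p.support, x ∈ q.support → x = s ∨ x = v) →
      ∃ p q : G.Walk s t, ∀ x ∈ p.support, x ∈ q.support → x = s ∨ x = t := by
    intro v W
    induction W with
    | nil => rintro - - ⟨p, q, -, -, hpq⟩; exact ⟨p, q, hpq⟩
    | @cons v w t hvw W ih =>
      intro hW hs ⟨p, q, hp, hq, hpq⟩
      rw [Walk.cons_isPath_iff] at hW
      simp only [Walk.support_cons, List.mem_cons, not_or] at hs
      have hvs : v ≠ s := fun h => hs.1 h.symm
      refine ih hne h hst hW.1 hs.2 ?_
      obtain ⟨R, hR⟩ := h v hvs (fun h => hW.2 (h ▸ W.end_mem_support))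
      have hws : w ≠ s := fun h => hs.2 (h ▸ W.start_mem_support)
      have hsw : w ≠ v := hvw.ne'
      have hpq' : ∀ x ∈ q.support, x ∈ p.support → x = s ∨ x = v := fun x h1 h2 => hpq x h2 h1
      have nilcase : v ∉ (Walk.nil : G.Walk w w).support := by simpa using hsw.symm
      by_cases hwp : w ∈ p.support
      · refine exists_disjoint_paths_of_reroute hp hq hpq hvs hvw .nil hwp nilcase (by simp) ?_
        intro hwq
        rcases hpq w hwp hwq with h | h
        · exact hws h
        · exact hsw h
      by_cases hwq : w ∈ q.support
      · exact exists_disjoint_paths_of_reroute hq hp hpq' hvs hvw .nil hwq nilcase (by simp) hwp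
      -- From `w`, go along `W` to `t` and back along `R` to `s`. This avoids `v`, and `r` is the
      -- part up to the first vertex on one of the two paths.
      obtain ⟨z, hz, r, hr1, hr2⟩ := (R.append W.reverse).reverse.exists_walk_first_mem
        {x | x ∈ p.support ∨ x ∈ q.support} (.inl p.start_mem_support)
      have hvr : v ∉ r.support := by
        intro h'
        have := hr1 v h'
        rw [Walk.support_reverse, List.mem_reverse, Walk.mem_support_append_iff,
          Walk.support_reverse, List.mem_reverse] at this
        exact this.elim hR hW.2
      rcases hz with hz | hz
      · exact exists_disjoint_paths_of_reroute hp hq hpq hvs hvw r hz hvr hr2 hwq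
      · exact exists_disjoint_paths_of_reroute hq hp hpq' hvs hvw r hz hvr
          (fun x hx hxx => hr2 x hx hxx.symm) hwp
  obtain ⟨W, hW⟩ : ∃ W : G.Walk s t, W.IsPath := by
    obtain ⟨p⟩ := hst
    exact ⟨p.toPath, p.toPath.2⟩
  cases W with
  | nil => exact absurd rfl hne
  | @cons _ w _ hsw W =>
    rw [Walk.cons_isPath_iff] at hW
    -- The start: both paths consist of the first edge, whose vertices are exactly the permitted
    -- common ones.
    refine key w W hW.1 hW.2 ⟨hsw.toWalk, hsw.toWalk, ?_, ?_, by simp⟩ <;>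
      simp [Walk.cons_isPath_iff, hsw.ne]

end SimpleGraph

/-! ### Incidence graphs and Menger's theorem for two paths in dart graphs -/

namespace DartGraph

variable {G : DartGraph} {F X : Set ℕ} {S T : ℕ}

/-- The graph on nodes and edges in which every edge of `F` is adjacent to its ends. -/
def incidenceGraph (G : DartGraph) (F : Set ℕ) : SimpleGraph (ℕ ⊕ ℕ) :=
  .fromRel fun a b => ∃ d < G.M, G.ed d ∈ F ∧ a = .inl (G.tl d) ∧ b = .inr (G.ed d)

theorem incidenceGraph_adj_dart {d : ℕ} (hd : d < G.M) (he : G.ed d ∈ F) :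
    (G.incidenceGraph F).Adj (.inl (G.tl d)) (.inr (G.ed d)) := by
  rw [incidenceGraph, SimpleGraph.fromRel_adj]
  exact ⟨by simp, .inl ⟨d, hd, he, rfl, rfl⟩⟩

theorem Reach.exists_walk {u v : ℕ} (hu : u ∈ X) (h : G.Reach F X u v) {F' : Set ℕ}
    (hF : F ⊆ F') : ∃ p : (G.incidenceGraph F').Walk (.inl u) (.inl v),
      (∀ w, .inl w ∈ p.support → w ∈ X) ∧ ∀ e, .inr e ∈ p.support → e ∈ F := by
  induction h with
  | refl => exact ⟨.nil, by simpa using hu, by simp⟩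
  | tail _ hs ih =>
    obtain ⟨p, h1, h2⟩ := ih
    obtain ⟨ha, hb, d, hd, he, rfl, rfl⟩ := hs
    have h3 := incidenceGraph_adj_dart hd (hF he)
    have h4 := incidenceGraph_adj_dart (F := F') (G.rev_lt d hd) (by rw [G.ed_rev d hd]; exact hF he)
    rw [G.tl_rev d hd, G.ed_rev d hd] at h4
    refine ⟨(p.concat h3).concat h4.symm, fun w hw => ?_, fun e he' => ?_⟩
    · simp only [SimpleGraph.Walk.support_concat, List.mem_append, List.mem_singleton,
        Sum.inl.injEq, reduceCtorEq, or_false] at hw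
      rcases hw with hw | rfl
      · exact h1 w hw
      · exact hb
    · simp only [SimpleGraph.Walk.support_concat, List.mem_append, List.mem_singleton,
        Sum.inr.injEq, reduceCtorEq, or_false] at he'
      rcases he' with he' | rfl
      · exact h2 e he'
      · exact he

theorem ends_eq {d d' : ℕ} (hd : d < G.M) (hd' : d' < G.M) (h : G.ed d = G.ed d') :
    (G.tl d = G.tl d' ∧ G.hd d = G.hd d') ∨ (G.tl d = G.hd d' ∧ G.hd d = G.tl d') := by
  rcases G.eq_or_eq_rev d hd d' hd' h with rfl | rfl
  · exact .inl ⟨rfl, rfl⟩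
  · exact .inr ⟨G.tl_rev d' hd', G.hd_rev d' hd'⟩

/-- Walks alternate between nodes and edges, so the induction must handle both kinds of starting
vertex. A walk that starts at an edge may be entered from either end of that edge, provided that the
end lies in `X`. -/
theorem reach_of_walk {E : Set ℕ} {a b : ℕ ⊕ ℕ} (p : (G.incidenceGraph F).Walk a b) {v : ℕ}
    (hb : b = .inl v) (hX : ∀ w, .inl w ∈ p.support → w ∈ X) (hE : ∀ e, .inr e ∈ p.support → e ∈ E) :
    (∀ u, a = .inl u → G.Reach (F ∩ E) X u v) ∧
      ∀ d < G.M, a = .inr (G.ed d) → G.tl d ∈ X → G.Reach (F ∩ E) X (G.tl d) v := by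
  induction p with
  | nil =>
    subst hb
    exact ⟨fun u hu => by cases hu; exact .refl, by simp⟩
  | cons hadj p ih =>
    simp only [SimpleGraph.Walk.support_cons, List.mem_cons] at hX hE
    obtain ⟨ih1, ih2⟩ := ih hb (fun w hw => hX w (.inr hw)) fun e he => hE e (.inr he)
    rw [incidenceGraph, SimpleGraph.fromRel_adj] at hadj
    obtain ⟨-, ⟨d, hd, he, rfl, rfl⟩ | ⟨d, hd, he, rfl, rfl⟩⟩ := hadj
    · refine ⟨?_, by simp⟩
      rintro u hu
      cases hu
      exact ih2 d hd rfl (hX _ (.inl rfl))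
    · refine ⟨by simp, fun d' hd' he' hX' => ?_⟩
      have h1 := ih1 _ rfl
      have hdX : G.tl d ∈ X := hX _ (.inr p.start_mem_support)
      have hdE : G.ed d' ∈ F ∩ E :=
        ⟨by rw [Sum.inr.injEq] at he'; rwa [← he'], hE _ (.inl he'.symm)⟩
      rw [Sum.inr.injEq] at he'
      rcases ends_eq hd' hd he'.symm with h | h
      · rw [h.1]; exact h1
      · rw [← h.2] at h1 hdX
        exact (reach_dart hd' hdE hX' hdX).trans h1

/-- Reachability inside `X` uses only edges with both ends in `X`. -/
theorem Reach.restrict {u v : ℕ} (h : G.Reach F X u v) :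
    G.Reach {e ∈ F | ∀ d < G.M, G.ed d = e → G.tl d ∈ X} X u v := by
  refine Relation.ReflTransGen.mono ?_ _ _ h
  rintro a b ⟨ha, hb, d, hd, he, rfl, rfl⟩
  refine ⟨ha, hb, d, hd, ⟨he, fun d' hd' h' => ?_⟩, rfl, rfl⟩
  rcases ends_eq hd' hd h' with h | h <;> rw [h.1] <;> assumption

/-- Menger's theorem for two internally disjoint paths. -/
theorem Conn2.exists_disjoint (hST : S ≠ T) (h : G.Conn2 F S T) :
    ∃ E₁ E₂ X₁ X₂ : Set ℕ, E₁ ⊆ F ∧ E₂ ⊆ F ∧ Disjoint E₁ E₂ ∧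
      (∀ v ∈ X₁, v ∈ X₂ → v = S ∨ v = T) ∧
      (∀ d < G.M, G.ed d ∈ E₁ → G.tl d ∈ X₁) ∧ (∀ d < G.M, G.ed d ∈ E₂ → G.tl d ∈ X₂) ∧
      G.Reach E₁ X₁ S T ∧ G.Reach E₂ X₂ S T := by
  -- Edges are vertices of the incidence graph, so the two halves of `Conn2` say that no vertex of
  -- either kind separates, and disjointness covers edges and nodes at once.
  obtain ⟨p, q, hpq⟩ := SimpleGraph.exists_disjoint_walks (G := G.incidenceGraph F)
    (s := .inl S) (t := .inl T) (by simpa using hST)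
    (by
      rintro (x | e) hxS hxT
      · obtain ⟨p, hp, -⟩ := Reach.exists_walk (by simpa [eq_comm] using hxS)
          (h.2 x (by simpa using hxS) (by simpa using hxT)) subset_rfl
        exact ⟨p, fun hx => by simpa using hp x hx⟩
      · obtain ⟨p, -, hp⟩ := Reach.exists_walk (Set.mem_univ S) (h.1 e) Set.sdiff_subset
        exact ⟨p, fun hx => by simpa using hp e hx⟩)
    (by
      obtain ⟨p, -⟩ := Reach.exists_walk (Set.mem_univ S) (h.1 0) Set.sdiff_subset
      exact ⟨p⟩)
  have key : ∀ r : (G.incidenceGraph F).Walk (.inl S) (.inl T),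
      G.Reach (F ∩ {e | .inr e ∈ r.support}) {v | .inl v ∈ r.support} S T := fun r =>
    (reach_of_walk r rfl (fun w hw => hw) fun e he => he).1 S rfl
  refine ⟨_, _, _, _, fun e he => he.1.1, fun e he => he.1.1, ?_, fun v hv hv' => ?_,
    fun d hd he => he.2 d hd rfl, fun d hd he => he.2 d hd rfl, (key p).restrict, (key q).restrict⟩
  · rw [Set.disjoint_left]
    intro e he he'
    simpa using hpq _ he.1.2 he'.1.2
  · simpa using hpq _ hv hv'

end DartGraph

/-! ## Decomposition of an edge set without bridges into blocks -/

namespace DartGraph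

variable {G : DartGraph} {F : Set ℕ} {S T : ℕ}

/-- The nodes that are incident to edges of `F`. -/
def nodes (G : DartGraph) (F : Set ℕ) : Set ℕ := {v | ∃ d < G.M, G.ed d ∈ F ∧ G.tl d = v}

theorem nodes_mono {F' : Set ℕ} (h : F ⊆ F') : G.nodes F ⊆ G.nodes F' := by
  rintro v ⟨d, hd, he, hv⟩
  exact ⟨d, hd, h he, hv⟩

theorem Reach.mem_nodes {X : Set ℕ} {u v : ℕ} (h : G.Reach F X u v) (huv : u ≠ v) :
    v ∈ G.nodes F := by
  rcases Relation.ReflTransGen.cases_tail h with h | ⟨w, -, h⟩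
  · exact absurd h.symm huv
  · obtain ⟨-, -, d, hd, he, h1, -⟩ := h.symm
    exact ⟨d, hd, he, h1⟩

/-- No edge of `F` separates `T` from `S`. -/
def EConn2 (G : DartGraph) (F : Set ℕ) (S T : ℕ) : Prop := ∀ e, G.Reach (F \ {e}) Set.univ S T

theorem EConn2.reach (h : G.EConn2 F S T) : G.Reach F Set.univ S T :=
  (h 0).mono Set.sdiff_subset subset_rfl

/-- Split an edge set at a cut node. -/
theorem EConn2.split {u x v : ℕ} (h : G.EConn2 F u v) (hx : ¬ G.Reach F {x}ᶜ u v) {C : Set ℕ}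
    (hxu : x ≠ u) (hC : C = {w | G.Reach F {x}ᶜ u w}) {F₁ F₂ : Set ℕ}
    (hF₁ : F₁ = {e ∈ F | ∃ d < G.M, G.ed d = e ∧ G.tl d ∈ C})
    (hF₂ : F₂ = {e ∈ F | ¬ ∃ d < G.M, G.ed d = e ∧ G.tl d ∈ C}) :
    G.EConn2 F₁ u x ∧ G.EConn2 F₂ x v ∧ G.nodes F₁ ⊆ insert x C ∧ Disjoint (G.nodes F₂) C ∧
      u ∈ C ∧ v ∉ C ∧ x ∉ C := by
  have huC : u ∈ C := by rw [hC]; exact .refl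
  have hvC : v ∉ C := by rw [hC]; exact hx
  have hxC : x ∉ C := by
    rw [hC]
    intro h'
    rcases Relation.ReflTransGen.cases_tail h' with h' | ⟨w, -, h', h'', -⟩
    · exact hxu h'
    · exact h'' rfl
  have hstep : ∀ a ∈ C, ∀ d < G.M, G.ed d ∈ F → G.tl d = a → G.hd d = x ∨ G.hd d ∈ C := by
    intro a ha d hd he hda
    by_cases hdx : G.hd d = x
    · exact .inl hdx
    · right
      have hax : a ≠ x := fun h => hxC (h ▸ ha)
      rw [hC] at ha ⊢
      exact Relation.ReflTransGen.tail ha ⟨hax, hdx, d, hd, he, hda, rfl⟩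
  refine ⟨fun e => ?_, fun e => ?_, ?_, ?_, huC, hvC, hxC⟩
  -- Follow a walk from `u` to `v` that avoids `e`: inside `C` it uses edges of `F₁`, and it can
  -- leave `C` only through `x`.
  · have := (h e).closed (Z := fun w => (w ∈ C ∧ G.Reach (F₁ \ {e}) Set.univ u w) ∨
      G.Reach (F₁ \ {e}) Set.univ u x) (.inl ⟨huC, .refl⟩) (by
        rintro a (⟨ha, hr⟩ | hr) b ⟨-, -, d, hd, he, rfl, rfl⟩
        · have hdF : G.ed d ∈ F₁ := by rw [hF₁]; exact ⟨he.1, d, hd, rfl, ha⟩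
          have hr' := hr.trans (reach_dart hd ⟨hdF, he.2⟩ (Set.mem_univ _) (Set.mem_univ _))
          rcases hstep _ ha d hd he.1 rfl with h' | h'
          · exact .inr (h' ▸ hr')
          · exact .inl ⟨h', hr'⟩
        · exact .inr hr)
    exact this.resolve_left fun h' => hvC h'.1
  -- Outside `C` the same walk uses edges of `F₂`, and every time it comes out of `C` it does so at
  -- `x`.
  · have := (h e).closed (Z := fun w => w ∈ C ∨ G.Reach (F₂ \ {e}) Set.univ x w) (.inl huC) (by
        rintro a ha b ⟨-, -, d, hd, he, rfl, rfl⟩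
        by_cases haC : G.tl d ∈ C
        · rcases hstep _ haC d hd he.1 rfl with h' | h'
          · right; rw [h']; exact .refl
          · exact .inl h'
        by_cases hbC : G.hd d ∈ C
        · exact .inl hbC
        have hr := ha.resolve_left haC
        have hdF : G.ed d ∈ F₂ := by
          rw [hF₂]
          refine ⟨he.1, ?_⟩
          rintro ⟨d', hd', he', hC'⟩
          rcases ends_eq hd' hd he' with h' | h' <;> rw [h'.1] at hC'
          · exact haC hC'
          · exact hbC hC'
        exact .inr (hr.trans (reach_dart hd ⟨hdF, he.2⟩ (Set.mem_univ _) (Set.mem_univ _))))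
    exact this.resolve_left hvC
  · rintro w ⟨d, hd, he, rfl⟩
    rw [hF₁] at he
    obtain ⟨heF, d', hd', he', hC'⟩ := he
    rcases ends_eq hd hd' he'.symm with h' | h'
    · rw [h'.1]; exact .inr hC'
    · rw [h'.1]
      exact hstep _ hC' d' hd' (he' ▸ heF) rfl
  · rw [Set.disjoint_left]
    rintro w ⟨d, hd, he, rfl⟩ hw
    rw [hF₂] at he
    exact he.2 ⟨d, hd, rfl, hw⟩

/-- Induction over the blocks of an edge set without bridges. -/
theorem EConn2.block_induction {P : Finset ℕ → ℕ → ℕ → Prop}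
    (block : ∀ (F : Finset ℕ) u v, u ≠ v → G.Conn2 F u v → P F u v)
    (glue : ∀ (F₁ F₂ : Finset ℕ) u x v, Disjoint F₁ F₂ → x ≠ u → x ≠ v → x ∈ G.nodes F₁ →
      (∀ w ∈ G.nodes F₁, w ∈ G.nodes F₂ → w = x) → u ∉ G.nodes F₂ → v ∉ G.nodes F₁ →
      P F₁ u x → P F₂ x v → P (F₁ ∪ F₂) u v)
    (F : Finset ℕ) {u v : ℕ} (huv : u ≠ v) (h : G.EConn2 F u v) : P F u v := by
  classical
  induction hk : F.card using Nat.strong_induction_on generalizing F u v with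
  | _ k ih =>
  by_cases hblock : ∀ x, x ≠ u → x ≠ v → G.Reach F {x}ᶜ u v
  · exact block F u v huv ⟨h, hblock⟩
  push Not at hblock
  obtain ⟨x, hxu, hxv, hx⟩ := hblock
  set C : Set ℕ := {w | G.Reach F {x}ᶜ u w} with hC
  set F₁ : Finset ℕ := F.filter fun e => ∃ d < G.M, G.ed d = e ∧ G.tl d ∈ C with hF₁
  set F₂ : Finset ℕ := F.filter fun e => ¬ ∃ d < G.M, G.ed d = e ∧ G.tl d ∈ C with hF₂
  obtain ⟨h1, h2, h3, h4, huC, hvC, hxC⟩ := h.split hx hxu hC (F₁ := F₁) (F₂ := F₂)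
    (by simp [hF₁]) (by simp [hF₂])
  have hdisj : Disjoint F₁ F₂ := Finset.disjoint_filter_filter_not _ _ _
  have hunion : F₁ ∪ F₂ = F := Finset.filter_union_filter_not_eq _ _
  have hcard : F₁.card + F₂.card = F.card := by rw [← Finset.card_union_of_disjoint hdisj, hunion]
  -- Both parts contain edges, so each has fewer edges than `F` and the induction applies.
  have hpos : ∀ (F : Finset ℕ) (a b : ℕ), a ≠ b → G.EConn2 F a b → 0 < F.card := by
    intro F a b hab hF
    obtain ⟨d, -, hd, -⟩ := hF.reach.mem_nodes hab
    exact Finset.card_pos.2 ⟨_, hd⟩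
  have hp1 := hpos F₁ u x hxu.symm h1
  have hp2 := hpos F₂ x v hxv h2
  rw [← hunion]
  refine glue F₁ F₂ u x v hdisj hxu hxv (h1.reach.mem_nodes hxu.symm) (fun w hw hw' => ?_)
    (fun hu => Set.disjoint_left.1 h4 hu huC) (fun hv => ?_)
    (ih _ (by omega) F₁ hxu.symm h1 rfl) (ih _ (by omega) F₂ hxv h2 rfl)
  · exact (h3 hw).resolve_right (Set.disjoint_left.1 h4 hw')
  · exact (h3 hv).elim (fun h' => hxv h'.symm) hvC

/-- Menger's theorem for two edge-disjoint paths. -/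
theorem EConn2.exists_disjoint (F : Finset ℕ) {u v : ℕ} (huv : u ≠ v) (h : G.EConn2 F u v) :
    ∃ E₁ E₂ : Set ℕ, E₁ ⊆ F ∧ E₂ ⊆ F ∧ Disjoint E₁ E₂ ∧
      G.Reach E₁ Set.univ u v ∧ G.Reach E₂ Set.univ u v := by
  refine EConn2.block_induction (G := G) (P := fun F u v => ∃ E₁ E₂ : Set ℕ, E₁ ⊆ F ∧ E₂ ⊆ F ∧
    Disjoint E₁ E₂ ∧ G.Reach E₁ Set.univ u v ∧ G.Reach E₂ Set.univ u v) ?_ ?_ F huv h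
  · intro F u v huv h
    obtain ⟨E₁, E₂, X₁, X₂, h1, h2, h3, -, -, -, h4, h5⟩ := h.exists_disjoint huv
    exact ⟨E₁, E₂, h1, h2, h3, h4.mono subset_rfl (Set.subset_univ _),
      h5.mono subset_rfl (Set.subset_univ _)⟩
  · rintro F₁ F₂ u x v hdisj - - - - - - ⟨E₁, E₂, h1, h2, h3, h4, h5⟩ ⟨E₁', E₂', h1', h2', h3', h4', h5'⟩
    have hF : Disjoint (F₁ : Set ℕ) (F₂ : Set ℕ) := Finset.disjoint_coe.2 hdisj
    refine ⟨E₁ ∪ E₁', E₂ ∪ E₂', ?_, ?_, ?_,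
      (h4.mono Set.subset_union_left subset_rfl).trans (h4'.mono Set.subset_union_right subset_rfl),
      (h5.mono Set.subset_union_left subset_rfl).trans (h5'.mono Set.subset_union_right subset_rfl)⟩
    · rw [Finset.coe_union]; exact Set.union_subset_union h1 h1'
    · rw [Finset.coe_union]; exact Set.union_subset_union h2 h2'
    · simp only [Set.disjoint_union_left, Set.disjoint_union_right]
      exact ⟨⟨h3, (hF.mono h2 h1').symm⟩, hF.mono h1 h2', h3'⟩

open Classical in
/-- The sum of the levels `L` of the inner nodes of `F`. -/
noncomputable def innerCost (G : DartGraph) (L : ℕ → ℝ) (F : Set ℕ) (u v : ℕ) : ℝ :=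
  ∑ w ∈ Finset.range G.n with w ∈ G.nodes F ∧ w ≠ u ∧ w ≠ v, L w

/-- If every block between `u` and `v` can be replaced by a link between the darts `γ u` and `γ v`,
then an edge set without bridges can be replaced by a chain of links. -/
theorem EConn2.exists_chain {ok : ℕ → ℕ → Prop} {val : ℕ → ℕ → ℝ} {tc L : ℕ → ℝ} {γ : ℕ → ℕ}
    {E : Finset ℕ} (hL0 : ∀ v, 0 ≤ L v) (hγ : ∀ v ∈ G.nodes E, γ v < G.M ∧ tc (γ v) ≤ L v)
    (block : ∀ F : Set ℕ, F ⊆ E → ∀ u v, u ≠ v → G.Conn2 F u v →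
      ok (γ u) (γ v) ∧ val (γ u) (γ v) ≤ 3 / 2 * G.innerCost L F u v)
    {u v : ℕ} (huv : u ≠ v) (h : G.EConn2 E u v) :
    ∃ (q : ℕ → ℕ) (k : ℕ), k ≤ E.card ∧ q 0 = γ u ∧ q k = γ v ∧ (∀ i ≤ k, q i < G.M) ∧
      (∀ i < k, ok (q i) (q (i + 1))) ∧
      ∑ i ∈ Finset.range k, (val (q i) (q (i + 1)) + tc (q (i + 1))) ≤
        3 / 2 * G.innerCost L E u v + L v := by
  classical
  refine EConn2.block_induction (G := G) (P := fun F u v => F ⊆ E →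
    ∃ (q : ℕ → ℕ) (k : ℕ), k ≤ F.card ∧ q 0 = γ u ∧ q k = γ v ∧ (∀ i ≤ k, q i < G.M) ∧
      (∀ i < k, ok (q i) (q (i + 1))) ∧
      ∑ i ∈ Finset.range k, (val (q i) (q (i + 1)) + tc (q (i + 1))) ≤
        3 / 2 * G.innerCost L F u v + L v) ?_ ?_ E huv h subset_rfl
  · intro F u v huv hF hFE
    have hFE' : (F : Set ℕ) ⊆ E := by exact_mod_cast hFE
    have hr : G.Reach F Set.univ u v := EConn2.reach hF.1
    have hv := hγ v (nodes_mono hFE' (hr.mem_nodes huv))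
    have hu := hγ u (nodes_mono hFE' (hr.symm.mem_nodes huv.symm))
    obtain ⟨h1, h2⟩ := block F hFE' u v huv hF
    refine ⟨fun i => if i = 0 then γ u else γ v, 1, ?_, by simp, by simp, ?_, ?_, ?_⟩
    · obtain ⟨d, -, hd, -⟩ := hr.mem_nodes huv
      exact Finset.card_pos.2 ⟨_, hd⟩
    · intro i _
      dsimp only
      split_ifs
      · exact hu.1
      · exact hv.1
    · intro i hi
      obtain rfl : i = 0 := by omega
      simpa using h1
    · simp only [Finset.sum_range_one]
      simp only [if_true, zero_add, one_ne_zero, if_false]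
      linarith [hv.2]
  · rintro F₁ F₂ u x v hdisj hxu hxv hx hinter hu hv ih₁ ih₂ hFE
    obtain ⟨q₁, k₁, hk₁, hs₁, ht₁, hlt₁, hok₁, hsum₁⟩ := ih₁ (Finset.union_subset_left hFE)
    obtain ⟨q₂, k₂, hk₂, hs₂, ht₂, hlt₂, hok₂, hsum₂⟩ := ih₂ (Finset.union_subset_right hFE)
    set q : ℕ → ℕ := fun i => if i ≤ k₁ then q₁ i else q₂ (i - k₁) with hq
    have hq1 : ∀ i ≤ k₁, q i = q₁ i := fun i hi => by simp [hq, hi]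
    have hq2 : ∀ i, q (k₁ + i) = q₂ i := by
      intro i
      rcases Nat.eq_zero_or_pos i with rfl | hi
      · simp [hq, ht₁, hs₂]
      · simp [hq, show ¬ i = 0 by omega]
    refine ⟨q, k₁ + k₂, ?_, by rw [hq1 0 (by omega), hs₁], by rw [hq2, ht₂], fun i hi => ?_,
      fun i hi => ?_, ?_⟩
    · rw [Finset.card_union_of_disjoint hdisj]; omega
    · rcases le_or_gt i k₁ with h' | h'
      · rw [hq1 i h']; exact hlt₁ i h'
      · obtain ⟨j, rfl⟩ := Nat.exists_eq_add_of_le h'.le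
        rw [hq2]; exact hlt₂ j (by omega)
    · rcases lt_or_ge i k₁ with h' | h'
      · rw [hq1 i h'.le, hq1 (i + 1) h']; exact hok₁ i h'
      · obtain ⟨j, rfl⟩ := Nat.exists_eq_add_of_le h'
        rw [hq2, add_assoc, hq2]; exact hok₂ j (by omega)
    · rw [Finset.sum_range_add]
      have e1 : ∑ i ∈ Finset.range k₁, (val (q i) (q (i + 1)) + tc (q (i + 1))) =
          ∑ i ∈ Finset.range k₁, (val (q₁ i) (q₁ (i + 1)) + tc (q₁ (i + 1))) := by
        refine Finset.sum_congr rfl fun i hi => ?_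
        rw [Finset.mem_range] at hi
        rw [hq1 i hi.le, hq1 (i + 1) hi]
      have e2 : ∑ i ∈ Finset.range k₂, (val (q (k₁ + i)) (q (k₁ + i + 1)) + tc (q (k₁ + i + 1))) =
          ∑ i ∈ Finset.range k₂, (val (q₂ i) (q₂ (i + 1)) + tc (q₂ (i + 1))) := by
        refine Finset.sum_congr rfl fun i hi => ?_
        rw [hq2, add_assoc, hq2]
      rw [e1, e2]
      have hn : x < G.n := by
        obtain ⟨d, hd, -, rfl⟩ := hx
        exact G.tl_lt d hd
      -- The inner nodes of the parts are disjoint and do not include `x`. The chain pays `L x`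
      -- once, while the new bound allows `3 / 2 * L x`.
      have key : G.innerCost L F₁ u x + G.innerCost L F₂ x v + L x ≤
          G.innerCost L (F₁ ∪ F₂ : Finset ℕ) u v := by
        unfold innerCost
        rw [← Finset.sum_union, ← Finset.sum_singleton L x, ← Finset.sum_union]
        · refine Finset.sum_le_sum_of_subset_of_nonneg ?_ fun w _ _ => hL0 w
          have hm1 : G.nodes F₁ ⊆ G.nodes (F₁ ∪ F₂ : Finset ℕ) := nodes_mono (by simp)
          have hm2 : G.nodes F₂ ⊆ G.nodes (F₁ ∪ F₂ : Finset ℕ) := nodes_mono (by simp)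
          intro w
          simp only [Finset.mem_union, Finset.mem_filter, Finset.mem_range, Finset.mem_singleton]
          rintro ((⟨h1, h2, h3, h4⟩ | ⟨h1, h2, h3, h4⟩) | rfl)
          · exact ⟨h1, hm1 h2, h3, fun h => hv (h ▸ h2)⟩
          · exact ⟨h1, hm2 h2, fun h => hu (h ▸ h2), h4⟩
          · exact ⟨hn, hm1 hx, hxu, hxv⟩
        · rw [Finset.disjoint_singleton_right]
          simp
        · rw [Finset.disjoint_left]
          intro w hw hw'
          simp only [Finset.mem_filter] at hw hw'
          exact hw'.2.2.1 (hinter w hw.2.1 hw'.2.1)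
      have := hL0 x
      linarith

end DartGraph

/-! ## Chains of blocks -/

namespace DartGraph

variable {G : DartGraph} {A₁ A₂ F : Set ℕ} {c tc L : ℕ → ℝ} {S T : ℕ}

/-- The result of the search for a cheap edge set in which neither an edge nor a node separates `T`
from `S`: a path in `A₁` is augmented by edges of `A₂`. -/
structure CoreResult (G : DartGraph) (A₁ A₂ : Set ℕ) (c : ℕ → ℝ) (S T : ℕ) (ok : Prop) (val : ℝ)
    (sol : Set ℕ) : Prop where
  sound : S ≠ T → S < G.n → ok → sol ⊆ A₁ ∪ A₂ ∧ G.Conn2 sol S T ∧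
    ∃ L : ℕ → ℝ, (∀ v, 0 ≤ L v) ∧ G.Activates c L sol ∧ ∑ v ∈ Finset.range G.n, L v ≤ val
  complete : S ≠ T → S < G.n → ∀ {F₁ F₂ : Set ℕ} {L₁ L₂ : ℕ → ℝ}, F₁ ⊆ A₁ → F₂ ⊆ A₂ →
    G.Reach F₁ Set.univ S T → G.Conn2 F₂ S T → (∀ v, 0 ≤ L₁ v) → (∀ v, 0 ≤ L₂ v) →
    G.Activates c L₁ F₁ → G.Activates c L₂ F₂ →
    ok ∧ val ≤ ∑ v ∈ Finset.range G.n, L₁ v + ∑ v ∈ Finset.range G.n, L₂ v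

/-- The edges whose costs at the tails of `g` and `h` do not exceed the costs of `g` and `h`. -/
def blockEdges (G : DartGraph) (tc : ℕ → ℝ) (g h : ℕ) : Set ℕ :=
  {e | ∀ d < G.M, G.ed d = e →
    (G.tl d = G.tl g → tc d ≤ tc g) ∧ (G.tl d = G.tl h → tc d ≤ tc h)}

/-- The costs at nodes other than the tails of `g` and `h`. -/
noncomputable def blockCost (G : DartGraph) (tc : ℕ → ℝ) (g h d : ℕ) : ℝ :=
  if G.tl d = G.tl g ∨ G.tl d = G.tl h then 0 else tc d

/-- In a block, one of two disjoint paths costs at most half of the block. -/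
theorem CoreResult.le_innerCost {g h : ℕ} {ok : Prop} {val : ℝ} {sol : Set ℕ}
    (hres : G.CoreResult (G.blockEdges tc g h) (G.blockEdges tc g h) (G.blockCost tc g h)
      (G.tl g) (G.tl h) ok val sol) (hg : G.tl g < G.n)
    (hne : G.tl g ≠ G.tl h) (hF : F ⊆ G.blockEdges tc g h)
    (hconn : G.Conn2 F (G.tl g) (G.tl h)) (hL0 : ∀ v, 0 ≤ L v) (hL : G.Activates tc L F) :
    ok ∧ val ≤ 3 / 2 * G.innerCost L F (G.tl g) (G.tl h) := by
  classical
  set u := G.tl g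
  set v := G.tl h
  -- At `u` and `v` the block costs vanish, so no level is needed there.
  let L' : ℕ → ℝ := fun w => if w ∈ G.nodes F ∧ w ≠ u ∧ w ≠ v then L w else 0
  have hL'0 : ∀ w, 0 ≤ L' w := fun w => by
    simp only [L']; split_ifs; exacts [hL0 w, le_rfl]
  have hsum : ∑ w ∈ Finset.range G.n, L' w = G.innerCost L F u v := by
    rw [innerCost, Finset.sum_filter]
  have hL' : G.Activates (G.blockCost tc g h) L' F := by
    intro d hd he
    simp only [blockCost, L']
    split_ifs with h1 h2 h2
    · exact hL0 _
    · exact le_rfl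
    · exact hL d hd he
    · exact absurd ⟨⟨d, hd, he, rfl⟩, fun h => h1 (.inl h), fun h => h1 (.inr h)⟩ h2
  obtain ⟨E₁, E₂, X₁, X₂, hE₁, hE₂, -, hX, hn₁, hn₂, hr₁, hr₂⟩ := hconn.exists_disjoint hne
  -- The competitors are one of the disjoint paths, with levels on its own nodes only, and all of
  -- `F` for the augmentation.
  have key : ∀ E X : Set ℕ, E ⊆ F → (∀ d < G.M, G.ed d ∈ E → G.tl d ∈ X) → G.Reach E X u v →
      ok ∧ val ≤ ∑ w ∈ Finset.range G.n, (if w ∈ X then L' w else 0) +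
        ∑ w ∈ Finset.range G.n, L' w := by
    intro E X hE hX hr
    refine hres.complete hne hg (hE.trans hF) hF (hr.mono subset_rfl (Set.subset_univ _)) hconn
      (fun w => ?_) hL'0 (fun d hd he => ?_) hL'
    · split_ifs; exacts [hL'0 w, le_rfl]
    · rw [if_pos (hX d hd he)]
      exact hL' d hd (hE he)
  obtain ⟨h1, h2⟩ := key E₁ X₁ hE₁ hn₁ hr₁
  obtain ⟨-, h3⟩ := key E₂ X₂ hE₂ hn₂ hr₂
  refine ⟨h1, ?_⟩
  -- The paths share no inner node, so together they cost at most `L'`. Averaging the two bounds on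
  -- `val` gives the factor `1 / 2 + 1`.
  have h4 : ∑ w ∈ Finset.range G.n, (if w ∈ X₁ then L' w else 0) +
      ∑ w ∈ Finset.range G.n, (if w ∈ X₂ then L' w else 0) ≤ ∑ w ∈ Finset.range G.n, L' w := by
    rw [← Finset.sum_add_distrib]
    refine Finset.sum_le_sum fun w _ => ?_
    have hw := hX w
    have := hL'0 w
    split_ifs with h5 h6 h6
    · have : L' w = 0 := by
        rcases hw h5 h6 with rfl | rfl <;> simp [L']
      rw [this]; simp
    all_goals linarith
  rw [← hsum]
  linarith

/-- Chains of links from `s` to `t`; a link joins the tails of two darts. -/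
def chainProblem (G : DartGraph) (link : ℕ → ℕ → Prop) (val : ℕ → ℕ → ℝ) (tc : ℕ → ℝ) (s t : ℕ) :
    RouteProblem where
  Q := G.M
  start d := G.tl d = s
  step := link
  finish d := G.tl d = t
  startCost := tc
  stepCost d' d := val d' d + tc d
  finishCost _ := 0

variable {link ok : ℕ → ℕ → Prop} {val : ℕ → ℕ → ℝ} {sol : ℕ → ℕ → Set ℕ} {s t : ℕ}

/-- Each link pays for the levels at its inner nodes, and each dart of the chain pays its own cost
at its tail. That cost suffices there for both adjacent links, because `blockEdges` forbids anything
dearer. -/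
theorem chainProblem_sound (htc : ∀ d, 0 ≤ tc d)
    (hres : ∀ g < G.M, ∀ h < G.M, G.CoreResult (G.blockEdges tc g h) (G.blockEdges tc g h)
      (G.blockCost tc g h) (G.tl g) (G.tl h) (ok g h) (val g h) (sol g h))
    (hlink : ∀ g h, link g h → ok g h ∧ G.tl g ≠ G.tl h) {q : ℕ → ℕ} {l : ℕ}
    (hq : (G.chainProblem link val tc s t).IsRoute q l) :
    G.EConn2 {e | ∃ i < l, e ∈ sol (q i) (q (i + 1))} s t ∧
    (∀ i < l, G.Conn2 (sol (q i) (q (i + 1))) (G.tl (q i)) (G.tl (q (i + 1)))) ∧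
    ∃ L : ℕ → ℝ, (∀ v, 0 ≤ L v) ∧ G.Activates tc L {e | ∃ i < l, e ∈ sol (q i) (q (i + 1))} ∧
      ∑ v ∈ Finset.range G.n, L v ≤ (G.chainProblem link val tc s t).cost q l := by
  have hlt : ∀ i ≤ l, q i < G.M := hq.lt
  have hsound : ∀ i < l, _ := fun i hi =>
    (hres (q i) (hlt i hi.le) (q (i + 1)) (hlt _ hi)).sound (hlink _ _ (hq.step i hi)).2
      (G.tl_lt _ (hlt i hi.le)) (hlink _ _ (hq.step i hi)).1
  refine ⟨fun e => ?_, fun i hi => (hsound i hi).2.1, ?_⟩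
  · have : ∀ i ≤ l, G.Reach ({e | ∃ i < l, e ∈ sol (q i) (q (i + 1))} \ {e}) Set.univ s
        (G.tl (q i)) := by
      intro i hi
      induction i with
      | zero => rw [show G.tl (q 0) = s from hq.start]; exact .refl
      | succ i ih =>
        refine (ih (by omega)).trans (((hsound i hi).2.1.1 e).mono ?_ subset_rfl)
        exact Set.sdiff_subset_sdiff_left fun e he => ⟨i, hi, he⟩
    have h := this l le_rfl
    rwa [show G.tl (q l) = t from hq.finish] at h
  · have hex : ∀ i, ∃ L : ℕ → ℝ, (∀ v, 0 ≤ L v) ∧ (i < l →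
        G.Activates (G.blockCost tc (q i) (q (i + 1))) L (sol (q i) (q (i + 1))) ∧
        ∑ v ∈ Finset.range G.n, L v ≤ val (q i) (q (i + 1))) := by
      intro i
      by_cases hi : i < l
      · obtain ⟨-, -, L, h1, h2, h3⟩ := hsound i hi
        exact ⟨L, h1, fun _ => ⟨h2, h3⟩⟩
      · exact ⟨0, fun _ => le_rfl, fun h => absurd h hi⟩
    choose L hL0 hL using hex
    have hs0 : ∀ v, 0 ≤ ∑ i ∈ Finset.range l, L i v := fun v =>
      Finset.sum_nonneg fun i _ => hL0 i v
    have hsp0 := fun v => spread_nonneg (k := l + 1) (v := fun i => G.tl (q i))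
      (f := fun i => tc (q i)) (fun i _ => htc _) v
    refine ⟨fun v => ∑ i ∈ Finset.range l, L i v +
      ∑ i ∈ Finset.range (l + 1), (if G.tl (q i) = v then tc (q i) else 0),
      fun v => add_nonneg (hs0 v) (hsp0 v), ?_, ?_⟩
    · rintro d hd ⟨i, hi, he⟩
      have hA := (hsound i hi).1 he
      rw [Set.union_self] at hA
      obtain ⟨h1, h2⟩ := hA d hd rfl
      have hsp := fun (j : ℕ) (hj : j < l + 1) => le_spread (v := fun i => G.tl (q i))
        (f := fun i => tc (q i)) (fun i _ => htc _) hj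
      dsimp only
      by_cases hg : G.tl d = G.tl (q i)
      · have := hsp i (by omega)
        rw [← hg] at this
        linarith [h1 hg, hs0 (G.tl d)]
      by_cases hh : G.tl d = G.tl (q (i + 1))
      · have := hsp (i + 1) (by omega)
        rw [← hh] at this
        linarith [h2 hh, hs0 (G.tl d)]
      have h3 := (hL i hi).1 d hd he
      rw [blockCost, if_neg (by tauto)] at h3
      have h4 := Finset.single_le_sum (f := fun i => L i (G.tl d)) (fun i _ => hL0 i _)
        (Finset.mem_range.2 hi)
      linarith [hsp0 (G.tl d)]
    · rw [Finset.sum_add_distrib, Finset.sum_comm,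
        sum_spread (fun i hi => G.tl_lt _ (hlt i (by omega)))]
      have h1 : ∑ i ∈ Finset.range l, ∑ v ∈ Finset.range G.n, L i v ≤
          ∑ i ∈ Finset.range l, val (q i) (q (i + 1)) :=
        Finset.sum_le_sum fun i hi => (hL i (Finset.mem_range.1 hi)).2
      rw [RouteProblem.cost, Finset.sum_range_succ']
      simp only [chainProblem, Finset.sum_add_distrib]
      linarith

theorem innerCost_add_le (hL0 : ∀ v, 0 ≤ L v) (hst : s ≠ t) (hs : s < G.n) (ht : t < G.n) :
    G.innerCost L F s t + L s + L t ≤ ∑ v ∈ Finset.range G.n, L v := by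
  classical
  rw [innerCost, add_assoc, ← Finset.sum_pair hst, ← Finset.sum_union]
  · refine Finset.sum_le_sum_of_subset_of_nonneg (fun w => ?_) fun w _ _ => hL0 w
    simp only [Finset.mem_union, Finset.mem_filter, Finset.mem_range, Finset.mem_insert,
      Finset.mem_singleton]
    rintro (h | rfl | rfl)
    exacts [h.1, hs, ht]
  · rw [Finset.disjoint_left]
    intro w hw hw'
    simp only [Finset.mem_filter, Finset.mem_insert, Finset.mem_singleton] at hw hw'
    tauto

/-- Levels that are attained by costs are represented by darts, and the blocks by links. -/
theorem exists_terminals {E : Set ℕ}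
    (hres : ∀ g < G.M, ∀ h < G.M, G.CoreResult (G.blockEdges tc g h) (G.blockEdges tc g h)
      (G.blockCost tc g h) (G.tl g) (G.tl h) (ok g h) (val g h) (sol g h))
    (hL0 : ∀ v, 0 ≤ L v) (hL : G.Activates tc L E)
    (hLE : ∀ v ∈ G.nodes E, ∃ d < G.M, G.tl d = v ∧ tc d = L v) :
    ∃ γ : ℕ → ℕ, (∀ v ∈ G.nodes E, γ v < G.M ∧ G.tl (γ v) = v ∧ tc (γ v) = L v) ∧
      ∀ F ⊆ E, ∀ u v, u ≠ v → G.Conn2 F u v → u ∈ G.nodes E ∧ v ∈ G.nodes E ∧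
        ok (γ u) (γ v) ∧ val (γ u) (γ v) ≤ 3 / 2 * G.innerCost L F u v := by
  have hex : ∀ v, ∃ d, v ∈ G.nodes E → d < G.M ∧ G.tl d = v ∧ tc d = L v := by
    intro v
    by_cases hv : v ∈ G.nodes E
    · obtain ⟨d, hd⟩ := hLE v hv
      exact ⟨d, fun _ => hd⟩
    · exact ⟨0, fun h => absurd h hv⟩
  choose γ hγ using hex
  refine ⟨γ, hγ, fun F hF u v huv hconn => ?_⟩
  have hr : G.Reach F Set.univ u v := EConn2.reach hconn.1
  have hv := nodes_mono hF (hr.mem_nodes huv)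
  have hu := nodes_mono hF (hr.symm.mem_nodes huv.symm)
  obtain ⟨hv1, hv2, hv3⟩ := hγ v hv
  obtain ⟨hu1, hu2, hu3⟩ := hγ u hu
  have := (hres (γ u) hu1 (γ v) hv1).le_innerCost (F := F) (L := L) (G.tl_lt _ hu1)
    (by rwa [hu2, hv2]) ?_ (by rwa [hu2, hv2]) hL0 fun d hd he => hL d hd (hF he)
  · rw [hu2, hv2] at this
    exact ⟨hu, hv, this⟩
  · intro e he d hd hde
    have := hL d hd (hF (hde ▸ he))
    constructor <;> intro h
    · rw [h, hu2] at this; rwa [hu3]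
    · rw [h, hv2] at this; rwa [hv3]

/-- An edge set without bridges yields a chain that costs at most `3 / 2` times as much. -/
theorem chainProblem_complete_of_eConn2 {E : Finset ℕ}
    (hres : ∀ g < G.M, ∀ h < G.M, G.CoreResult (G.blockEdges tc g h) (G.blockEdges tc g h)
      (G.blockCost tc g h) (G.tl g) (G.tl h) (ok g h) (val g h) (sol g h))
    (hlink : ∀ g h, ok g h → G.tl g ≠ G.tl h → link g h)
    (hL0 : ∀ v, 0 ≤ L v) (hL : G.Activates tc L E)
    (hLE : ∀ v ∈ G.nodes E, ∃ d < G.M, G.tl d = v ∧ tc d = L v)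
    (hst : s ≠ t) (hE : G.EConn2 E s t) :
    ∃ q l, (G.chainProblem link val tc s t).IsRoute q l ∧ l ≤ E.card ∧
      (G.chainProblem link val tc s t).cost q l ≤ 3 / 2 * ∑ v ∈ Finset.range G.n, L v := by
  obtain ⟨γ, hγ, hblock⟩ := exists_terminals hres hL0 hL hLE
  obtain ⟨q, k, hk, hq0, hqk, hlt, hok, hsum⟩ := EConn2.exists_chain
    (ok := fun g h => ok g h ∧ G.tl g ≠ G.tl h) (val := val) (tc := tc) (L := L) (γ := γ) hL0
    (fun v hv => ⟨(hγ v hv).1, (hγ v hv).2.2.le⟩)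
    (fun F hF u v huv hconn => by
      obtain ⟨h1, h2, h3, h4⟩ := hblock F hF u v huv hconn
      exact ⟨⟨h3, by rwa [(hγ u h1).2.1, (hγ v h2).2.1]⟩, h4⟩) hst hE
  obtain ⟨ht1, ht2, ht3⟩ := hγ t (hE.reach.mem_nodes hst)
  obtain ⟨hs1, hs2, hs3⟩ := hγ s (hE.reach.symm.mem_nodes hst.symm)
  refine ⟨q, k, ⟨hlt, ?_, fun i hi => hlink _ _ (hok i hi).1 (hok i hi).2, ?_⟩, hk, ?_⟩
  · change G.tl (q 0) = s
    rw [hq0, hs2]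
  · change G.tl (q k) = t
    rw [hqk, ht2]
  · have := innerCost_add_le (F := E) hL0 hst (hs2 ▸ G.tl_lt _ hs1) (ht2 ▸ G.tl_lt _ ht1)
    rw [RouteProblem.cost]
    simp only [chainProblem, hq0, hs3]
    linarith [hL0 s, hL0 t]

/-- A block between `s` and `t` yields a chain with one link that costs at most `3 / 2` times as
much. -/
theorem chainProblem_complete_of_conn2 {E : Set ℕ}
    (hres : ∀ g < G.M, ∀ h < G.M, G.CoreResult (G.blockEdges tc g h) (G.blockEdges tc g h)
      (G.blockCost tc g h) (G.tl g) (G.tl h) (ok g h) (val g h) (sol g h))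
    (hlink : ∀ g h, ok g h → G.tl g = s → G.tl h = t → link g h)
    (hL0 : ∀ v, 0 ≤ L v) (hL : G.Activates tc L E)
    (hLE : ∀ v ∈ G.nodes E, ∃ d < G.M, G.tl d = v ∧ tc d = L v)
    (hst : s ≠ t) (hE : G.Conn2 E s t) :
    ∃ q, (G.chainProblem link val tc s t).IsRoute q 1 ∧
      (G.chainProblem link val tc s t).cost q 1 ≤ 3 / 2 * ∑ v ∈ Finset.range G.n, L v := by
  obtain ⟨γ, hγ, hblock⟩ := exists_terminals hres hL0 hL hLE
  obtain ⟨hs, ht, hok, hval⟩ := hblock E subset_rfl s t hst hE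
  obtain ⟨ht1, ht2, ht3⟩ := hγ t ht
  obtain ⟨hs1, hs2, hs3⟩ := hγ s hs
  refine ⟨fun i => if i = 0 then γ s else γ t, ⟨fun i _ => ?_, ?_, fun i hi => ?_, ?_⟩, ?_⟩
  · change (if i = 0 then γ s else γ t) < G.M
    split_ifs
    exacts [hs1, ht1]
  · exact hs2
  · obtain rfl : i = 0 := by omega
    exact hlink _ _ hok hs2 ht2
  · exact ht2
  · have := innerCost_add_le (F := E) hL0 hst (hs2 ▸ G.tl_lt _ hs1) (ht2 ▸ G.tl_lt _ ht1)
    rw [RouteProblem.cost]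
    simp [chainProblem, hs3, ht3]
    linarith [hL0 s, hL0 t]

end DartGraph

/-! ## Statements for shortest routes -/

@[simp] theorem NExp.eval_const (σ : Mem) (c : ℕ) : (NExp.const c).eval σ = c := rfl

@[simp] theorem NExp.eval_add (σ : Mem) (x y : NExp) :
    (NExp.add x y).eval σ = x.eval σ + y.eval σ := rfl

@[simp] theorem NExp.eval_sub (σ : Mem) (x y : NExp) :
    (NExp.sub x y).eval σ = x.eval σ - y.eval σ := rfl

attribute [simp] NExp.eval_var Mem.view_real

@[simp] theorem NExp.eval_scalar_view (σ : Mem) (z : List ℕ) {a : ℕ} (h : a ≠ 9) :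
    (NExp.scalar a).eval (σ.view z) = σ.nat a [] := by
  rw [NExp.eval_scalar, Mem.view_nat_ne _ _ h]

@[simp] theorem NExp.eval_read_one (σ : Mem) (z : List ℕ) {a : ℕ} (h : a ≠ 9) (x : NExp) :
    (NExp.read a ![x]).eval (σ.view z) = σ.nat a [x.eval (σ.view z)] := by
  simp [NExp.eval, Mem.view_nat_ne _ _ h]

@[simp] theorem NExp.eval_read_two (σ : Mem) (z : List ℕ) {a : ℕ} (h : a ≠ 9) (x y : NExp) :
    (NExp.read a ![x, y]).eval (σ.view z) = σ.nat a [x.eval (σ.view z), y.eval (σ.view z)] := by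
  simp [NExp.eval, Mem.view_nat_ne _ _ h]

@[simp] theorem NExp.eval_read_three (σ : Mem) (z : List ℕ) {a : ℕ} (h : a ≠ 9) (x y u : NExp) :
    (NExp.read a ![x, y, u]).eval (σ.view z) =
      σ.nat a [x.eval (σ.view z), y.eval (σ.view z), u.eval (σ.view z)] := by
  simp [NExp.eval, Mem.view_nat_ne _ _ h]

@[simp] theorem NExp.eval_read_four (σ : Mem) (z : List ℕ) {a : ℕ} (h : a ≠ 9) (x y u v : NExp) :
    (NExp.read a ![x, y, u, v]).eval (σ.view z) =
      σ.nat a [x.eval (σ.view z), y.eval (σ.view z), u.eval (σ.view z), v.eval (σ.view z)] := by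
  simp [NExp.eval, Mem.view_nat_ne _ _ h]

@[simp] theorem RExp.eval_zero (σ : Mem) : RExp.zero.eval σ = 0 := rfl

@[simp] theorem RExp.eval_add (σ : Mem) (x y : RExp) :
    (RExp.add x y).eval σ = x.eval σ + y.eval σ := rfl

@[simp] theorem RExp.eval_sub (σ : Mem) (x y : RExp) :
    (RExp.sub x y).eval σ = x.eval σ - y.eval σ := rfl

@[simp] theorem RExp.eval_read_one (σ : Mem) (a : ℕ) (x : NExp) :
    (RExp.read a ![x]).eval σ = σ.real a [x.eval σ] := by
  simp [RExp.eval]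

@[simp] theorem RExp.eval_read_two (σ : Mem) (a : ℕ) (x y : NExp) :
    (RExp.read a ![x, y]).eval σ = σ.real a [x.eval σ, y.eval σ] := by
  simp [RExp.eval]

@[simp] theorem RExp.eval_read_three (σ : Mem) (a : ℕ) (x y u : NExp) :
    (RExp.read a ![x, y, u]).eval σ = σ.real a [x.eval σ, y.eval σ, u.eval σ] := by
  simp [RExp.eval]

@[simp] theorem RExp.eval_read_four (σ : Mem) (a : ℕ) (x y u v : NExp) :
    (RExp.read a ![x, y, u, v]).eval σ = σ.real a [x.eval σ, y.eval σ, u.eval σ, v.eval σ] := by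
  simp [RExp.eval]

/-- Equality of integers. -/
def Test.eq (x y : NExp) : Test := .conj (.natLE x y) (.natLE y x)

/-- Disjunction of tests. -/
def Test.disj (b b' : Test) : Test := .neg (.conj (.neg b) (.neg b'))

@[simp] theorem Test.holds_natLE (σ : Mem) (x y : NExp) :
    (Test.natLE x y).Holds σ ↔ x.eval σ ≤ y.eval σ := Iff.rfl

@[simp] theorem Test.holds_realLE (σ : Mem) (x y : RExp) :
    (Test.realLE x y).Holds σ ↔ x.eval σ ≤ y.eval σ := Iff.rfl

@[simp] theorem Test.holds_neg (σ : Mem) (b : Test) : (Test.neg b).Holds σ ↔ ¬ b.Holds σ := Iff.rfl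

@[simp] theorem Test.holds_conj (σ : Mem) (b b' : Test) :
    (Test.conj b b').Holds σ ↔ b.Holds σ ∧ b'.Holds σ := Iff.rfl

@[simp] theorem Test.holds_eq (σ : Mem) (x y : NExp) :
    (Test.eq x y).Holds σ ↔ x.eval σ = y.eval σ := by
  simp only [Test.eq, holds_conj, holds_natLE]
  omega

@[simp] theorem Test.holds_disj (σ : Mem) (b b' : Test) :
    (Test.disj b b').Holds σ ↔ b.Holds σ ∨ b'.Holds σ := by
  simp only [Test.disj, holds_neg, holds_conj]
  tauto

@[simp] theorem NBody.eval_ret (σ : Mem) (x : NExp) : (NBody.ret x).eval σ = x.eval σ := rfl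

open Classical in
@[simp] theorem NBody.eval_ite (σ : Mem) (b : Test) (p q : NBody) :
    (NBody.ite b p q).eval σ = if b.Holds σ then p.eval σ else q.eval σ := rfl

@[simp] theorem RBody.eval_ret (σ : Mem) (x : RExp) : (RBody.ret x).eval σ = x.eval σ := rfl

open Classical in
@[simp] theorem RBody.eval_ite (σ : Mem) (b : Test) (p q : RBody) :
    (RBody.ite b p q).eval σ = if b.Holds σ then p.eval σ else q.eval σ := rfl

/-- The body with value `1` if the test holds, and `0` otherwise. -/
def NBody.flag (b : Test) : NBody := .ite b (.ret (.const 1)) (.ret (.const 0))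

@[simp] theorem NBody.eval_flag_eq_one (σ : Mem) (b : Test) :
    (NBody.flag b).eval σ = 1 ↔ b.Holds σ := by
  simp only [NBody.flag, NBody.eval_ite]
  split_ifs with h <;> simp [h]

/-- The maximum of two real expressions. -/
def RBody.max (x y : RExp) : RBody := .ite (.realLE x y) (.ret y) (.ret x)

@[simp] theorem RBody.eval_max (σ : Mem) (x y : RExp) :
    (RBody.max x y).eval σ = Max.max (x.eval σ) (y.eval σ) := by
  simp only [RBody.max, RBody.eval_ite, Test.holds_realLE, RBody.eval_ret]
  rw [max_def]

/-- The statements hold, and the entries `0` of the shifted arrays are zero. -/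
def Satisfies (τ : Mem) (L : List Stmt) : Prop :=
  ∀ s ∈ L, s.Holds τ ∧ (s.shift = true → ∀ l, l.headD 0 = 0 →
    τ.get s.rule.isReal s.a l = if s.rule.isReal then .inr 0 else .inl 0)

theorem Satisfies.append {τ : Mem} {L L' : List Stmt} :
    Satisfies τ (L ++ L') ↔ Satisfies τ L ∧ Satisfies τ L' := by
  simp only [Satisfies, List.mem_append]
  constructor
  · exact fun h => ⟨fun s hs => h s (.inl hs), fun s hs => h s (.inr hs)⟩
  · rintro ⟨h, h'⟩ s (hs | hs)
    exacts [h s hs, h' s hs]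

section

variable {τ : Mem} {L : List Stmt} {a b : ℕ} {sh : Bool} {bs : List ℕ}

theorem Satisfies.nat (h : Satisfies τ L) {p : NBody} (hs : ⟨a, sh, bs, .nat p⟩ ∈ L)
    {z : List ℕ} (hz : List.Forall₂ (· < ·) z (bs.map fun b => τ.nat b [])) :
    τ.nat a (cellIndex sh z) = p.eval (τ.view z) :=
  Sum.inl_injective ((h _ hs).1 z (mem_loopValues.2 hz))

theorem Satisfies.real (h : Satisfies τ L) {p : RBody} (hs : ⟨a, sh, bs, .real p⟩ ∈ L)
    {z : List ℕ} (hz : List.Forall₂ (· < ·) z (bs.map fun b => τ.nat b [])) :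
    τ.real a (cellIndex sh z) = p.eval (τ.view z) :=
  Sum.inr_injective ((h _ hs).1 z (mem_loopValues.2 hz))

theorem Satisfies.search (h : Satisfies τ L) {p : Test} (hs : ⟨a, sh, bs, .search b p⟩ ∈ L)
    {z : List ℕ} (hz : List.Forall₂ (· < ·) z (bs.map fun b => τ.nat b [])) :
    τ.nat a (cellIndex sh z) =
      searchVal (fun j => p.Holds (τ.view (z ++ [j]))) (τ.nat b []) :=
  Sum.inl_injective ((h _ hs).1 z (mem_loopValues.2 hz))

theorem Satisfies.min (h : Satisfies τ L) {p : Test} {v c : RExp}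
    (hs : ⟨a, sh, bs, .min b p v c⟩ ∈ L)
    {z : List ℕ} (hz : List.Forall₂ (· < ·) z (bs.map fun b => τ.nat b [])) :
    τ.real a (cellIndex sh z) = minVal (fun j => p.Holds (τ.view (z ++ [j])))
      (fun j => v.eval (τ.view (z ++ [j]))) (c.eval (τ.view z)) (τ.nat b []) :=
  Sum.inr_injective ((h _ hs).1 z (mem_loopValues.2 hz))

theorem Satisfies.nat_zero (h : Satisfies τ L) {r : Rule} (hs : ⟨a, true, bs, r⟩ ∈ L)
    (hr : r.isReal = false) {l : List ℕ} (hl : l.headD 0 = 0) : τ.nat a l = 0 := by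
  have := (h _ hs).2 rfl l hl
  simp only [hr, Mem.get] at this
  simpa using this

theorem Satisfies.real_zero (h : Satisfies τ L) {r : Rule} (hs : ⟨a, true, bs, r⟩ ∈ L)
    (hr : r.isReal = true) {l : List ℕ} (hl : l.headD 0 = 0) : τ.real a l = 0 := by
  have := (h _ hs).2 rfl l hl
  simp only [hr, Mem.get] at this
  simpa using this

end

theorem searchVal_congr_lt {p q : ℕ → Prop} {B : ℕ} (h : ∀ j < B, (p j ↔ q j)) :
    searchVal p B = searchVal q B := by
  induction B with
  | zero => rfl
  | succ B ih =>
    have h1 := ih fun j hj => h j (by omega)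
    rw [searchVal, searchVal, h1, propext (h B (by omega))]

theorem minVal_congr_lt {p q : ℕ → Prop} {v w : ℕ → ℝ} {c : ℝ} {B : ℕ} (h : ∀ j < B, (p j ↔ q j))
    (hv : ∀ j < B, v j = w j) : minVal p v c B = minVal q w c B := by
  induction B with
  | zero => rfl
  | succ B ih =>
    have h1 := ih (fun j hj => h j (by omega)) fun j hj => hv j (by omega)
    rw [minVal, minVal, h1, hv B (by omega), propext (h B (by omega))]

section

open NExp

/-- Statements that solve a family of route problems, indexed by the loop variables `0` and `1` below
the scalars `G` and `H`.  The scalars `Q`, `N`, `K`, `K'` hold the number of states, of states with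
source and sink, the maximal number of arcs, and `K + 1`; the tests and costs refer to the states in
the loop variables `2` and `3`. -/
def routeProg (B G H Q N K K' : ℕ) (start step finish : Test) (startCost stepCost finishCost : RBody) :
    List Stmt :=
  let source : NExp := scalar Q
  let sink : NExp := .add (scalar Q) (.const 1)
  let arrive : Test := .conj (.eq (.read B ![var 1, var 2, var 4, var 3]) (.const 1))
    (.disj (.eq (var 4) source) (.neg (.eq (.read (B + 1) ![var 0, var 1, var 2, var 4]) (.const 0))))
  let via (j : NExp) : RExp :=
    .add (.read (B + 1) ![var 0, var 1, var 2, j]) (.read B ![var 1, var 2, j, var 3])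
  [⟨B, false, [G, H, N, N], .nat (
      .ite (.eq (var 2) source)
        (.ite (.eq (var 3) source) (.ret (.const 1))
          (.ite (.eq (var 3) sink) (.ret (.const 0)) (.flag start)))
        (.ite (.eq (var 2) sink) (.ret (.const 0))
          (.ite (.eq (var 3) source) (.ret (.const 0))
            (.ite (.eq (var 3) sink) (.flag finish) (.flag step)))))⟩,
    ⟨B, false, [G, H, N, N], .real (
      .ite (.eq (var 2) source)
        (.ite (.eq (var 3) source) (.ret .zero)
          (.ite (.eq (var 3) sink) (.ret .zero) startCost))
        (.ite (.eq (var 2) sink) (.ret .zero)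
          (.ite (.eq (var 3) source) (.ret .zero)
            (.ite (.eq (var 3) sink) finishCost stepCost))))⟩,
    ⟨B + 1, true, [K, G, H, N], .search N arrive⟩,
    ⟨B + 1, true, [K, G, H, N], .min N arrive (via (var 4))
      (via (.sub (.read (B + 1) ![.add (var 0) (.const 1), var 1, var 2, var 3]) (.const 1)))⟩,
    ⟨B + 2, false, [G, H], .search K (.conj
      (.neg (.eq (.read (B + 1) ![.add (var 2) (.const 1), var 0, var 1, sink]) (.const 0)))
      (.realLE (.read (B + 1) ![.add (var 2) (.const 1), var 0, var 1, sink])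
        (.read (B + 1) ![scalar K, var 0, var 1, sink])))⟩,
    ⟨B + 3, false, [K, G, H, N], .search N (.conj arrive (.realLE (via (var 4))
      (.read (B + 1) ![.add (var 0) (.const 1), var 1, var 2, var 3])))⟩,
    ⟨B + 4, true, [K', G, H], .nat (.ite (.eq (var 0) (.const 0)) (.ret sink)
      (.ret (.sub (.read (B + 3) ![.sub (.read (B + 2) ![var 1, var 2]) (var 0), var 1, var 2,
        .read (B + 4) ![var 0, var 1, var 2]]) (.const 1))))⟩]

/-- The tables that `routeProg` computes are those of the route problem. -/
theorem Satisfies.routeTables {τ : Mem} {L : List Stmt} (hL : Satisfies τ L)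
    {B G H Q N K K' : ℕ} {start step finish : Test} {startCost stepCost finishCost : RBody}
    (hsub : routeProg B G H Q N K K' start step finish startCost stepCost finishCost ⊆ L)
    (hB : 10 ≤ B) (hQ9 : Q ≠ 9) (hK9 : K ≠ 9) {R : RouteProblem}
    (hQ : τ.nat Q [] = R.Q) (hN : τ.nat N [] = R.Q + 2) (hK' : τ.nat K' [] = τ.nat K [] + 1)
    {g h : ℕ} (hg : g < τ.nat G []) (hh : h < τ.nat H [])
    (hstart : ∀ j < R.Q, (start.Holds (τ.view [g, h, R.Q, j]) ↔ R.start j))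
    (hstep : ∀ i < R.Q, ∀ j < R.Q, (step.Holds (τ.view [g, h, i, j]) ↔ R.step i j))
    (hfinish : ∀ i < R.Q, (finish.Holds (τ.view [g, h, i, R.Q + 1]) ↔ R.finish i))
    (hstartCost : ∀ j < R.Q, startCost.eval (τ.view [g, h, R.Q, j]) = R.startCost j)
    (hstepCost : ∀ i < R.Q, ∀ j < R.Q, stepCost.eval (τ.view [g, h, i, j]) = R.stepCost i j)
    (hfinishCost : ∀ i < R.Q, finishCost.eval (τ.view [g, h, i, R.Q + 1]) = R.finishCost i) :
    R.RouteTables (τ.nat K []) (fun k x => τ.nat (B + 1) [k, g, h, x])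
      (fun k x => τ.real (B + 1) [k, g, h, x]) (τ.nat (B + 2) [g, h])
      (fun k x => τ.nat (B + 3) [k, g, h, x]) (fun i => τ.nat (B + 4) [i, g, h]) := by
  simp only [routeProg, List.cons_subset, List.nil_subset, and_true] at hsub
  obtain ⟨m0, m1, m2, m3, m4, m5, m6⟩ := hsub
  have n0 : B ≠ 9 := by omega
  have n1 : B + 1 ≠ 9 := by omega
  have n2 : B + 2 ≠ 9 := by omega
  have n3 : B + 3 ≠ 9 := by omega
  have n4 : B + 4 ≠ 9 := by omega
  have hadj : ∀ i < R.Q + 2, ∀ j < R.Q + 2, (τ.nat B [g, h, i, j] = 1 ↔ R.adj i j) := by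
    intro i hi j hj
    have := hL.nat m0 (z := [g, h, i, j]) (by simp [hg, hh, hN, hi, hj])
    simp only [cellIndex, Bool.false_eq_true, if_false] at this
    rw [this]
    simp only [NBody.eval_ite, Test.holds_eq, eval_var, eval_scalar_view _ _ hQ9, hQ, eval_add,
      eval_const, RouteProblem.adj, List.getD_cons_succ, List.getD_cons_zero, NBody.eval_ret]
    split_ifs with h1 h2 h3 h4 h5 h6 <;> simp
    · subst h1; exact hstart j (by omega)
    · subst h6; exact hfinish i (by omega)
    · exact hstep i (by omega) j (by omega)
  have harc : ∀ i < R.Q + 2, ∀ j < R.Q + 2, τ.real B [g, h, i, j] = R.arc i j := by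
    intro i hi j hj
    have := hL.real m1 (z := [g, h, i, j]) (by simp [hg, hh, hN, hi, hj])
    simp only [cellIndex, Bool.false_eq_true, if_false] at this
    rw [this]
    simp only [RBody.eval_ite, Test.holds_eq, eval_var, eval_scalar_view _ _ hQ9, hQ, eval_add,
      eval_const, RouteProblem.arc, List.getD_cons_succ, List.getD_cons_zero, RBody.eval_ret,
      RExp.eval_zero]
    split_ifs with h1 h2 h3 h4 h5 h6 <;> try rfl
    · subst h1; exact hstartCost j (by omega)
    · subst h6; exact hfinishCost i (by omega)
    · exact hstepCost i (by omega) j (by omega)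
  have hr : ∀ k < τ.nat K [], ∀ x < R.Q + 2, τ.nat (B + 1) [k + 1, g, h, x] =
      searchVal (fun j => R.adj j x ∧ (j = R.Q ∨ τ.nat (B + 1) [k, g, h, j] ≠ 0)) (R.Q + 2) := by
    intro k hk x hx
    have := hL.search m2 (z := [k, g, h, x]) (by simp [hk, hg, hh, hN, hx])
    simp only [cellIndex, if_true, List.modifyHead_cons, hN] at this
    rw [this]
    refine searchVal_congr_lt fun j hj => ?_
    simp [n0, n1, hQ9, hQ, hadj j hj x hx]
  refine ⟨⟨fun x _ => hL.nat_zero m2 rfl rfl, fun x _ => hL.real_zero m3 rfl rfl, hr, ?_⟩, ?_, ?_, ?_, ?_⟩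
  · intro k hk x hx
    have := hL.min m3 (z := [k, g, h, x]) (by simp [hk, hg, hh, hN, hx])
    simp only [cellIndex, if_true, List.modifyHead_cons, hN] at this
    rw [this]
    -- For an unreachable `x`, truncated subtraction gives the index `0`, which is still inside the
    -- arc table.
    have hlt : τ.nat (B + 1) [k + 1, g, h, x] - 1 < R.Q + 2 := by
      by_cases h0 : τ.nat (B + 1) [k + 1, g, h, x] = 0
      · omega
      · rw [hr k hk x hx] at h0 ⊢
        exact (searchVal_spec h0).1
    rw [← harc _ hlt x hx]
    simp only [n1, eval_read_four, eval_var, eval_add, eval_const, eval_sub, RExp.eval_add,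
      RExp.eval_read_four, Mem.view_real, List.getD_cons_succ, List.getD_cons_zero, ne_eq,
      not_false_eq_true]
    refine minVal_congr_lt (fun j hj => ?_) fun j hj => ?_
    · simp [n0, n1, hQ9, hQ, hadj j hj x hx]
    · simp [harc j hj x hx]
  · have := hL.search m4 (z := [g, h]) (by simp [hg, hh])
    simp only [cellIndex, Bool.false_eq_true, if_false] at this
    rw [this]
    refine searchVal_congr_lt fun j hj => ?_
    simp [n1, hQ9, hQ, hK9]
  · intro k hk x hx
    have := hL.search m5 (z := [k, g, h, x]) (by simp [hk, hg, hh, hN, hx])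
    simp only [cellIndex, Bool.false_eq_true, if_false, hN] at this
    rw [this]
    refine searchVal_congr_lt fun j hj => ?_
    simp [n0, n1, hQ9, hQ, hadj j hj x hx, harc j hj x hx]
  · have := hL.nat m6 (z := [0, g, h]) (by simp [hK', hg, hh])
    simp only [cellIndex, if_true, List.modifyHead_cons] at this
    rw [this]
    simp [hQ9, hQ]
  · intro i hi hi'
    have := hL.nat m6 (z := [i, g, h]) (by simp [hK', hg, hh]; omega)
    simp only [cellIndex, if_true, List.modifyHead_cons] at this
    rw [this]
    simp [n2, n3, n4, hi.ne']

end

/-! ## The core of the algorithms -/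

open NExp

/-- Sizes, darts and the states of augmenting sequences.  `size` is the number of values of each of
the two loop variables that index the subproblems. -/
def preludeProg (size : NExp) : List Stmt :=
  let dart (a b : ℕ) : Rule := .nat (.ite (.natLE (scalar 1) (var 0))
    (.ret (.read b ![.sub (var 0) (scalar 1)])) (.ret (.read a ![var 0])))
  let wrap : Test := .natLE (scalar 10) (.add (.read 20 ![var 0]) (.const 1))
  [⟨10, false, [], .nat (.ret (.add (scalar 1) (scalar 1)))⟩,
    ⟨11, false, [], .nat (.ret (.add (scalar 10) (.const 1)))⟩,
    ⟨12, false, [], .nat (.ret (.add (scalar 10) (.const 2)))⟩,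
    ⟨13, false, [], .nat (.ret (.add (scalar 10) (.const 3)))⟩,
    ⟨14, true, [11], .nat (.ret (.add (.read 14 ![var 0]) (scalar 10)))⟩,
    ⟨15, false, [], .nat (.ret (.read 14 ![scalar 11]))⟩,
    ⟨16, false, [], .nat (.ret (.add (scalar 15) (.const 2)))⟩,
    ⟨17, false, [], .nat (.ret (.const 1))⟩,
    ⟨18, false, [], .nat (.ret size)⟩,
    ⟨20, true, [15], .nat (.ite wrap (.ret (.const 0)) (.ret (.add (.read 20 ![var 0]) (.const 1))))⟩,
    ⟨21, true, [15], .nat (.ite wrap (.ret (.add (.read 21 ![var 0]) (.const 1)))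
      (.ret (.read 21 ![var 0])))⟩,
    ⟨22, false, [10], dart 4 5⟩,
    ⟨23, false, [10], dart 5 4⟩,
    ⟨24, false, [10], .nat (.ite (.natLE (scalar 1) (var 0)) (.ret (.sub (var 0) (scalar 1)))
      (.ret (var 0)))⟩,
    ⟨25, false, [10], .nat (.ite (.natLE (scalar 1) (var 0)) (.ret (.sub (var 0) (scalar 1)))
      (.ret (.add (var 0) (scalar 1))))⟩,
    ⟨20, false, [10], .real (.ite (.natLE (scalar 1) (var 0))
      (.ret (.read 1 ![.sub (var 0) (scalar 1)])) (.ret (.read 0 ![var 0])))⟩]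

/-- The memory contains the dart graph `G` with the costs `tc` at the tails. -/
structure Represents (τ : Mem) (G : DartGraph) (tc : ℕ → ℝ) : Prop where
  n : τ.nat 0 [] = G.n
  M : τ.nat 10 [] = G.M
  K : τ.nat 12 [] = G.M + 2
  K' : τ.nat 13 [] = G.M + 3
  Q : τ.nat 15 [] = (G.M + 1) * G.M
  N : τ.nat 16 [] = (G.M + 1) * G.M + 2
  one : τ.nat 17 [] = 1
  mod : ∀ q < (G.M + 1) * G.M, τ.nat 20 [q] = q % G.M
  div : ∀ q < (G.M + 1) * G.M, τ.nat 21 [q] = q / G.M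
  tl : ∀ d < G.M, τ.nat 22 [d] = G.tl d
  hd : ∀ d < G.M, τ.nat 23 [d] = G.hd d
  ed : ∀ d < G.M, τ.nat 24 [d] = G.ed d
  rev : ∀ d < G.M, τ.nat 25 [d] = G.rev d
  tc : ∀ d < G.M, τ.real 20 [d] = tc d

/-- Dart number `i` of the path. -/
abbrev pathDart (i : NExp) : NExp := .read 44 ![.sub (.read 42 ![var 0, var 1]) i, var 0, var 1]

/-- Dart number `i` of the augmenting sequence. -/
abbrev augDart (i : NExp) : NExp :=
  .read 20 ![.read 64 ![.sub (.read 62 ![var 0, var 1]) i, var 0, var 1]]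

/-- A cheapest path between the nodes given by the arrays `30` and `31`, in the edges flagged by the
array `32`, with the costs of the real array `30`. -/
def pathProg : List Stmt :=
  routeProg 40 18 18 10 12 12 13
    (.conj (.eq (.read 32 ![var 0, var 1, var 3]) (.const 1))
      (.eq (.read 22 ![var 3]) (.read 30 ![var 0, var 1])))
    (.conj (.eq (.read 32 ![var 0, var 1, var 3]) (.const 1))
      (.eq (.read 23 ![var 2]) (.read 22 ![var 3])))
    (.eq (.read 23 ![var 2]) (.read 31 ![var 0, var 1]))
    (.ret (.read 30 ![var 0, var 1, var 3]))
    (.max (.read 30 ![var 0, var 1, .read 25 ![var 2]]) (.read 30 ![var 0, var 1, var 3]))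
    (.ret (.read 30 ![var 0, var 1, .read 25 ![var 2]]))

/-- The edges, positions and levels of the path, and the reduced costs and remaining edges. -/
def reduceProg : List Stmt :=
  let onPath (i : ℕ) : Test := .natLE (.add (var i) (.const 2)) (.read 42 ![var 0, var 1])
  let excess : RExp := .add (.read 30 ![var 0, var 1, var 2])
    (.read 50 ![var 0, var 1, .read 22 ![var 2]])
  [⟨50, false, [18, 18, 10], .search 12 (.conj (onPath 3)
      (.eq (.read 24 ![pathDart (var 3)]) (.read 24 ![var 2])))⟩,
    ⟨51, false, [18, 18, 0], .search 12 (.conj (onPath 3)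
      (.eq (.read 23 ![pathDart (var 3)]) (var 2)))⟩,
    ⟨52, false, [18, 18, 0], .nat (.ite (.eq (var 2) (.read 30 ![var 0, var 1])) (.ret (.const 1))
      (.ite (.eq (.read 51 ![var 0, var 1, var 2]) (.const 0)) (.ret (.const 0))
        (.ret (.add (.read 51 ![var 0, var 1, var 2]) (.const 1)))))⟩,
    ⟨50, false, [18, 18, 0], .min 10 (.conj (.neg (.eq (.read 50 ![var 0, var 1, var 3]) (.const 0)))
      (.eq (.read 22 ![var 3]) (var 2))) (.sub .zero (.read 30 ![var 0, var 1, var 3])) .zero⟩,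
    ⟨51, false, [18, 18, 10], .real (.max .zero excess)⟩,
    ⟨53, false, [18, 18, 10], .nat (.flag (.conj (.eq (.read 33 ![var 0, var 1, var 2]) (.const 1))
      (.eq (.read 50 ![var 0, var 1, var 2]) (.const 0))))⟩]

/-- A cheapest augmenting sequence. -/
def augProg : List Stmt :=
  let x' : NExp := .read 20 ![var 2]
  let x : NExp := .read 20 ![var 3]
  let y' : NExp := .read 21 ![var 2]
  let y : NExp := .read 21 ![var 3]
  let hd (d : NExp) : NExp := .read 23 ![d]
  let pos (v : NExp) : NExp := .read 52 ![var 0, var 1, v]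
  let red (d : NExp) : RExp := .read 51 ![var 0, var 1, d]
  let rev (d : NExp) : NExp := .read 25 ![d]
  let tl (d : NExp) : NExp := .read 22 ![d]
  let free : Test := .eq (.read 53 ![var 0, var 1, x]) (.const 1)
  let off : Test := .eq (pos (hd x')) (.const 0)
  routeProg 60 18 18 15 16 12 13
    (.conj (.eq y (scalar 10)) (.conj free (.eq (tl x) (.read 30 ![var 0, var 1]))))
    (.conj free (.disj (.conj off (.conj (.eq (hd x') (tl x)) (.eq y' y)))
      (.conj (.neg off) (.conj (.neg (.eq (pos (tl x)) (.const 0)))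
        (.conj (.natLE (.add (pos (tl x)) (.const 1)) (pos (hd x'))) (.eq y x'))))))
    (.eq (hd x') (.read 31 ![var 0, var 1]))
    (.ret (red x))
    (.ite off (.max (red (rev x')) (red x))
      (.ite (.conj (.natLE (.add y' (.const 1)) (scalar 10)) (.eq (hd y') (tl x)))
        (.max (red (rev x')) (.add (red (rev x')) (.sub (red x) (red (rev y')))))
        (.ret (.add (red (rev x')) (red x)))))
    (.ret (red (rev x')))

/-- The edges and the cost of the augmented path. -/
def combineProg : List Stmt :=
  [⟨70, false, [18, 18, 10], .search 12 (.conj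
      (.natLE (.add (var 3) (.const 2)) (.read 62 ![var 0, var 1]))
      (.eq (.read 24 ![augDart (var 3)]) (.read 24 ![var 2])))⟩,
    ⟨71, false, [18, 18, 10], .nat (.flag (.disj
      (.neg (.eq (.read 50 ![var 0, var 1, var 2]) (.const 0)))
      (.neg (.eq (.read 70 ![var 0, var 1, var 2]) (.const 0)))))⟩,
    ⟨72, false, [18, 18], .nat (.flag (.conj (.neg (.eq (.read 42 ![var 0, var 1]) (.const 0)))
      (.neg (.eq (.read 62 ![var 0, var 1]) (.const 0)))))⟩,
    ⟨72, false, [18, 18], .real (.ret (.add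
      (.read 41 ![.read 42 ![var 0, var 1], var 0, var 1, .add (scalar 10) (.const 1)])
      (.read 61 ![.read 62 ![var 0, var 1], var 0, var 1, .add (scalar 15) (.const 1)])))⟩]

/-- Augmented paths for all subproblems. -/
def coreProg : List Stmt := pathProg ++ reduceProg ++ augProg ++ combineProg

theorem searchVal_ne_zero {p : ℕ → Prop} {B : ℕ} : searchVal p B ≠ 0 ↔ ∃ j < B, p j := by
  rw [Ne, searchVal_eq_zero]
  push Not
  rfl

theorem searchVal_of_le {p : ℕ → Prop} {B B' : ℕ} (hB : B ≤ B') (hp : ∀ j, p j → j < B) :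
    searchVal p B' = searchVal p B := by
  induction B', hB using Nat.le_induction with
  | base => rfl
  | succ B' hB' ih =>
    rw [searchVal, if_neg, ih]
    rintro ⟨-, h⟩
    have := hp _ h
    omega

namespace Represents

variable {τ : Mem} {G : DartGraph} {tc : ℕ → ℝ} {L : List Stmt} {g h : ℕ} {A₁ A₂ : Set ℕ}
  {c : ℕ → ℝ} {S T : ℕ}

theorem pathTables (hG : Represents τ G tc) (hL : Satisfies τ L) (hsub : pathProg ⊆ L)
    (hg : g < τ.nat 18 []) (hh : h < τ.nat 18 []) (hS : τ.nat 30 [g, h] = S)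
    (hT : τ.nat 31 [g, h] = T) (hA : ∀ d < G.M, (τ.nat 32 [g, h, d] = 1 ↔ G.ed d ∈ A₁))
    (hc : ∀ d < G.M, τ.real 30 [g, h, d] = c d) :
    (G.pathProblem A₁ c S T).RouteTables (G.M + 2) (fun k x => τ.nat 41 [k, g, h, x])
      (fun k x => τ.real 41 [k, g, h, x]) (τ.nat 42 [g, h])
      (fun k x => τ.nat 43 [k, g, h, x]) (fun i => τ.nat 44 [i, g, h]) := by
  rw [← hG.K]
  refine hL.routeTables hsub (by norm_num) (by norm_num) (by norm_num) (R := G.pathProblem A₁ c S T)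
    hG.M hG.K (by rw [hG.K, hG.K']) hg hh ?_ ?_ ?_ ?_ ?_ ?_
  · intro j hj
    have hj : j < G.M := hj
    simp [DartGraph.pathProblem, hS, hA j hj, hG.tl j hj]
  · intro i hi j hj
    have hi : i < G.M := hi
    have hj : j < G.M := hj
    simp [DartGraph.pathProblem, hA j hj, hG.tl j hj, hG.hd i hi]
  · intro i hi
    have hi : i < G.M := hi
    simp [DartGraph.pathProblem, hT, hG.hd i hi]
  · intro j hj
    have hj : j < G.M := hj
    simp [DartGraph.pathProblem, hc j hj]
  · intro i hi j hj
    have hi : i < G.M := hi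
    have hj : j < G.M := hj
    simp [DartGraph.pathProblem, hc j hj, hG.rev i hi, hc _ (G.rev_lt i hi)]
  · intro i hi
    have hi : i < G.M := hi
    simp [DartGraph.pathProblem, hG.rev i hi, hc _ (G.rev_lt i hi)]

theorem augTables (hG : Represents τ G tc) (hL : Satisfies τ L) (hsub : augProg ⊆ L)
    (hg : g < τ.nat 18 []) (hh : h < τ.nat 18 []) (hS : τ.nat 30 [g, h] = S)
    (hT : τ.nat 31 [g, h] = T) {A : Set ℕ} (hA : ∀ d < G.M, (τ.nat 53 [g, h, d] = 1 ↔ G.ed d ∈ A))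
    {pos : ℕ → ℕ} {red : ℕ → ℝ} (hpos : ∀ v < G.n, τ.nat 52 [g, h, v] = pos v)
    (hred : ∀ d < G.M, τ.real 51 [g, h, d] = red d) :
    (G.augProblem A pos red S T).RouteTables (G.M + 2) (fun k x => τ.nat 61 [k, g, h, x])
      (fun k x => τ.real 61 [k, g, h, x]) (τ.nat 62 [g, h])
      (fun k x => τ.nat 63 [k, g, h, x]) (fun i => τ.nat 64 [i, g, h]) := by
  rw [← hG.K]
  have hmod : ∀ q < (G.M + 1) * G.M, q % G.M < G.M := fun q hq =>
    Nat.mod_lt _ (Nat.pos_of_ne_zero fun h0 => by simp [h0] at hq)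
  refine hL.routeTables hsub (by norm_num) (by norm_num) (by norm_num)
    (R := G.augProblem A pos red S T) hG.Q hG.N (by rw [hG.K, hG.K']) hg hh ?_ ?_ ?_ ?_ ?_ ?_
  · intro j hj
    have hj : j < (G.M + 1) * G.M := hj
    have hx := hmod j hj
    simp [DartGraph.augProblem, hS, hG.mod j hj, hG.div j hj, hA _ hx, hG.tl _ hx, hG.M]
  · intro i hi j hj
    have hi : i < (G.M + 1) * G.M := hi
    have hj : j < (G.M + 1) * G.M := hj
    have hx := hmod j hj
    have hx' := hmod i hi
    simp [DartGraph.augProblem, hG.mod j hj, hG.div j hj, hA _ hx, hG.tl _ hx,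
      hG.mod i hi, hG.div i hi, hG.hd _ hx', hpos _ (G.tl_lt _ hx), hpos _ (DartGraph.hd_lt hx')]
  · intro i hi
    have hi : i < (G.M + 1) * G.M := hi
    simp [DartGraph.augProblem, hT, hG.mod i hi, hG.hd _ (hmod i hi)]
  · intro j hj
    have hj : j < (G.M + 1) * G.M := hj
    simp [DartGraph.augProblem, hG.mod j hj, hred _ (hmod j hj)]
  · intro i hi j hj
    have hi : i < (G.M + 1) * G.M := hi
    have hj : j < (G.M + 1) * G.M := hj
    have hx := hmod j hj
    have hx' := hmod i hi
    have hy : i / G.M < G.M → G.rev (i / G.M) < G.M := fun h' => G.rev_lt _ h'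
    simp only [DartGraph.augProblem, DartGraph.startPrice]
    simp [hG.mod j hj, hG.tl _ hx, hG.mod i hi, hG.div i hi, hG.hd _ hx', hG.M,
      hpos _ (DartGraph.hd_lt hx'), hG.rev _ hx', hred _ (G.rev_lt _ hx'), hred _ hx]
    congr 1
    -- The remembered dart may be the dummy `M`, for which the arrays mean nothing. The first
    -- condition of the test excludes it.
    by_cases h1 : i / G.M < G.M
    · simp only [h1, true_and, hG.hd _ h1, hG.rev _ h1, hred _ (hy h1)]
      split_ifs with h2
      · rw [← max_add_add_left, add_zero]
      · rfl
    · simp [h1]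
  · intro i hi
    have hi : i < (G.M + 1) * G.M := hi
    have hx' := hmod i hi
    simp [DartGraph.augProblem, hG.mod i hi, hG.rev _ hx', hred _ (G.rev_lt _ hx')]

end Represents

/-! ### Reduced costs and the solution of a subproblem, read off the memory -/

namespace Represents

variable {τ : Mem} {G : DartGraph} {tc : ℕ → ℝ} {L : List Stmt} {g h : ℕ} {A₁ A₂ : Set ℕ}
  {c : ℕ → ℝ} {S T : ℕ}

/-- The edges on the path are flagged. -/
theorem pathFlag (hG : Represents τ G tc) (hL : Satisfies τ L) (hsub : reduceProg ⊆ L)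
    (hg : g < τ.nat 18 []) (hh : h < τ.nat 18 []) {x : ℕ → ℕ} {l : ℕ}
    (hx : ∀ i, x i = τ.nat 44 [τ.nat 42 [g, h] - i, g, h]) (hl : τ.nat 42 [g, h] = l + 2)
    (hlK : l ≤ G.M) (hlt : ∀ i ≤ l, x i < G.M) {d : ℕ} (hd : d < G.M) :
    τ.nat 50 [g, h, d] ≠ 0 ↔ G.ed d ∈ G.edges x l := by
  simp only [reduceProg, List.cons_subset, List.nil_subset, and_true] at hsub
  have := hL.search hsub.1 (z := [g, h, d]) (by simp [hg, hh, hG.M, hd])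
  simp only [cellIndex, Bool.false_eq_true, if_false] at this
  rw [this, searchVal_ne_zero]
  constructor
  · rintro ⟨i, -, hi⟩
    simp [hl] at hi
    refine ⟨i, hi.1, ?_⟩
    have h2 := hi.2
    rw [← hl, ← hx, hG.ed _ (hlt i hi.1), hG.ed d hd] at h2
    exact h2
  · rintro ⟨i, hi, he⟩
    refine ⟨i, by rw [hG.K]; omega, ?_⟩
    simp [hl, hi]
    rw [← hl, ← hx, hG.ed _ (hlt i hi), hG.ed d hd, he]

theorem reducedCosts (hG : Represents τ G tc) (hL : Satisfies τ L) (hsub : reduceProg ⊆ L)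
    (hg : g < τ.nat 18 []) (hh : h < τ.nat 18 []) (hS : τ.nat 30 [g, h] = S)
    (hA : ∀ d < G.M, (τ.nat 33 [g, h, d] = 1 ↔ G.ed d ∈ A₂))
    (hc : ∀ d < G.M, τ.real 30 [g, h, d] = c d) {x : ℕ → ℕ} {l : ℕ}
    (hx : ∀ i, x i = τ.nat 44 [τ.nat 42 [g, h] - i, g, h]) (hl : τ.nat 42 [g, h] = l + 2)
    (hlK : l ≤ G.M) (hlt : ∀ i ≤ l, x i < G.M) :
    ∃ pos lev red, G.ReducedCosts c S x l pos lev red ∧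
      (∀ v < G.n, τ.nat 52 [g, h, v] = pos v) ∧ (∀ d < G.M, τ.real 51 [g, h, d] = red d) ∧
      ∀ d < G.M, (τ.nat 53 [g, h, d] = 1 ↔ G.ed d ∈ A₂ \ G.edges x l) := by
  have hflag : ∀ d < G.M, _ := fun d hd => hG.pathFlag hL hsub hg hh hx hl hlK hlt hd
  simp only [reduceProg, List.cons_subset, List.nil_subset, and_true] at hsub
  obtain ⟨-, m1, m2, m3, m4, m5⟩ := hsub
  -- Only minima are available, so a level is the negative of a minimum of negated costs that starts
  -- at `0`.
  let lev : ℕ → ℝ := fun v =>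
    -minVal (fun d => G.ed d ∈ G.edges x l ∧ G.tl d = v) (fun d => 0 - c d) 0 G.M
  have hlev : ∀ v < G.n, τ.real 50 [g, h, v] = -lev v := by
    intro v hv
    have := hL.min m3 (z := [g, h, v]) (by simp [hg, hh, hG.n, hv])
    simp only [cellIndex, Bool.false_eq_true, if_false] at this
    rw [this, hG.M, neg_neg]
    refine minVal_congr_lt (fun d hd => ?_) fun d hd => ?_
    · simp [hG.tl d hd, ← hflag d hd]
    · simp [hc d hd]
  refine ⟨fun v => if v = S then 1 else
    if searchVal (fun i => i ≤ l ∧ G.hd (x i) = v) (l + 1) = 0 then 0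
    else searchVal (fun i => i ≤ l ∧ G.hd (x i) = v) (l + 1) + 1, lev,
    fun d => max 0 (c d - lev (G.tl d)), ⟨fun v => rfl, fun v => ?_, fun d hd he => ?_, fun v => ?_,
      fun d => rfl⟩, fun v hv => ?_, fun d hd => ?_, fun d hd => ?_⟩
  · have := minVal_le_init (fun d => G.ed d ∈ G.edges x l ∧ G.tl d = v) (fun d => 0 - c d) 0 G.M
    simp only [lev]
    linarith
  · have := minVal_le (p := fun d' => G.ed d' ∈ G.edges x l ∧ G.tl d' = G.tl d)
      (v := fun d => 0 - c d) (c := 0) hd ⟨he, rfl⟩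
    simp only [lev]
    linarith
  · rcases minVal_mem (fun d => G.ed d ∈ G.edges x l ∧ G.tl d = v) (fun d => 0 - c d) 0 G.M with
      h1 | ⟨d, hd, ⟨h1, h2⟩, h3⟩
    · left
      simp only [lev, h1, neg_zero, le_refl]
    · right
      refine ⟨d, hd, h1, h2, ?_⟩
      simp only [lev, h3]
      linarith
  · have h1 := hL.search m1 (z := [g, h, v]) (by simp [hg, hh, hG.n, hv])
    have h2 := hL.nat m2 (z := [g, h, v]) (by simp [hg, hh, hG.n, hv])
    simp only [cellIndex, Bool.false_eq_true, if_false] at h1 h2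
    -- The program searches up to `M + 2`, but only indices up to `l` can pass the test.
    rw [hG.K, show searchVal _ (G.M + 2) =
        searchVal (fun i => i ≤ l ∧ G.hd (x i) = v) (G.M + 2) from ?_,
      searchVal_of_le (B := l + 1) (by omega) fun i hi => by omega] at h1
    · rw [h2]
      simp [hS, h1]
    · refine searchVal_congr_lt fun i hi => ?_
      simp [hl]
      intro hi
      rw [← hl, ← hx, hG.hd _ (hlt i hi)]
  · have := hL.real m4 (z := [g, h, d]) (by simp [hg, hh, hG.M, hd])
    simp only [cellIndex, Bool.false_eq_true, if_false] at this
    rw [this]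
    simp [hc d hd, hG.tl d hd, hlev _ (G.tl_lt d hd), sub_eq_add_neg]
  · have := hL.nat m5 (z := [g, h, d]) (by simp [hg, hh, hG.M, hd])
    simp only [cellIndex, Bool.false_eq_true, if_false] at this
    rw [this, NBody.eval_flag_eq_one]
    have h1 := hflag d hd
    simp [hA d hd, ← h1]

/-- Any competitor yields a path and an augmenting sequence of at most `M` darts each. With source
and sink they have at most `M + 2` states, up to which the tables are filled, so the best routes
found are no dearer. -/
theorem coreResult (hG : Represents τ G tc) (hL : Satisfies τ L) (hsub : coreProg ⊆ L)
    (hg : g < τ.nat 18 []) (hh : h < τ.nat 18 []) (hS : τ.nat 30 [g, h] = S)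
    (hT : τ.nat 31 [g, h] = T) (hA₁ : ∀ d < G.M, (τ.nat 32 [g, h, d] = 1 ↔ G.ed d ∈ A₁))
    (hA₂ : ∀ d < G.M, (τ.nat 33 [g, h, d] = 1 ↔ G.ed d ∈ A₂)) (hc0 : ∀ d, 0 ≤ c d)
    (hc : ∀ d < G.M, τ.real 30 [g, h, d] = c d) :
    G.CoreResult A₁ A₂ c S T (τ.nat 72 [g, h] = 1) (τ.real 72 [g, h])
      {e | ∃ d < G.M, G.ed d = e ∧ τ.nat 71 [g, h, d] = 1} := by
  simp only [coreProg, List.append_subset] at hsub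
  obtain ⟨⟨⟨s1, s2⟩, s3⟩, s4⟩ := hsub
  have t1 := hG.pathTables hL s1 hg hh hS hT hA₁ hc
  have hok : τ.nat 72 [g, h] = 1 ↔ τ.nat 42 [g, h] ≠ 0 ∧ τ.nat 62 [g, h] ≠ 0 := by
    simp only [combineProg, List.cons_subset, List.nil_subset, and_true] at s4
    have := hL.nat s4.2.2.1 (z := [g, h]) (by simp [hg, hh])
    simp only [cellIndex, Bool.false_eq_true, if_false] at this
    rw [this, NBody.eval_flag_eq_one]
    simp
  have hval : τ.real 72 [g, h] = τ.real 41 [τ.nat 42 [g, h], g, h, G.M + 1] +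
      τ.real 61 [τ.nat 62 [g, h], g, h, (G.M + 1) * G.M + 1] := by
    simp only [combineProg, List.cons_subset, List.nil_subset, and_true] at s4
    have := hL.real s4.2.2.2 (z := [g, h]) (by simp [hg, hh])
    simp only [cellIndex, Bool.false_eq_true, if_false] at this
    rw [this]
    simp [hG.M, hG.Q]
  set x : ℕ → ℕ := fun i => τ.nat 44 [τ.nat 42 [g, h] - i, g, h] with hx
  set q : ℕ → ℕ := fun i => τ.nat 64 [τ.nat 62 [g, h] - i, g, h] with hq
  have main : τ.nat 42 [g, h] ≠ 0 → ∃ l pos lev red,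
      (G.pathProblem A₁ c S T).IsBest (G.M + 2) x l ∧
      (G.pathProblem A₁ c S T).cost x l = τ.real 41 [τ.nat 42 [g, h], g, h, G.M + 1] ∧
      G.ReducedCosts c S x l pos lev red ∧
      (G.augProblem (A₂ \ G.edges x l) pos red S T).RouteTables (G.M + 2)
        (fun k x => τ.nat 61 [k, g, h, x]) (fun k x => τ.real 61 [k, g, h, x]) (τ.nat 62 [g, h])
        (fun k x => τ.nat 63 [k, g, h, x]) (fun i => τ.nat 64 [i, g, h]) ∧
      ∀ d < G.M, (τ.nat 50 [g, h, d] ≠ 0 ↔ G.ed d ∈ G.edges x l) := by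
    intro hkk
    obtain ⟨h2, hK, hbest, hcost⟩ := t1.isBest hkk
    have hlt : ∀ i ≤ τ.nat 42 [g, h] - 2, x i < G.M := hbest.isRoute.lt
    obtain ⟨pos, lev, red, h1, h3, h4, h5⟩ := hG.reducedCosts hL s2 hg hh hS hA₂ hc (x := x)
      (l := τ.nat 42 [g, h] - 2) (fun i => rfl) (by omega) (by omega) hlt
    exact ⟨_, pos, lev, red, hbest, hcost, h1, hG.augTables hL s3 hg hh hS hT h5 h3 h4,
      fun d hd => hG.pathFlag hL s2 hg hh (fun i => rfl) (by omega) (by omega) hlt hd⟩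
  constructor
  · intro hST hSn h'
    obtain ⟨hkk, hkk'⟩ := hok.1 h'
    obtain ⟨l, pos, lev, red, hbest, hcost, hred, t2, hflag⟩ := main hkk
    obtain ⟨h2, hK, hbest', hcost'⟩ := t2.isBest hkk'
    have hsol : {e | ∃ d < G.M, G.ed d = e ∧ τ.nat 71 [g, h, d] = 1} =
        G.edges x l ∪ G.edges (fun i => q i % G.M) (τ.nat 62 [g, h] - 2) := by
      have hqlt : ∀ i ≤ τ.nat 62 [g, h] - 2, q i < (G.M + 1) * G.M := hbest'.isRoute.lt
      have hmod : ∀ i ≤ τ.nat 62 [g, h] - 2, q i % G.M < G.M := fun i hi =>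
        Nat.mod_lt _ (Nat.pos_of_ne_zero fun h0 => by have := hqlt i hi; simp [h0] at this)
      simp only [combineProg, List.cons_subset, List.nil_subset, and_true] at s4
      have hflag' : ∀ d < G.M, (τ.nat 71 [g, h, d] = 1 ↔ G.ed d ∈
          G.edges x l ∪ G.edges (fun i => q i % G.M) (τ.nat 62 [g, h] - 2)) := by
        intro d hd
        have e1 := hL.nat s4.2.1 (z := [g, h, d]) (by simp [hg, hh, hG.M, hd])
        have e2 := hL.search s4.1 (z := [g, h, d]) (by simp [hg, hh, hG.M, hd])
        simp only [cellIndex, Bool.false_eq_true, if_false] at e1 e2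
        have e3 : τ.nat 70 [g, h, d] ≠ 0 ↔
            G.ed d ∈ G.edges (fun i => q i % G.M) (τ.nat 62 [g, h] - 2) := by
          rw [e2, searchVal_ne_zero]
          constructor
          · rintro ⟨i, -, hi⟩
            simp at hi
            have hi' : i ≤ τ.nat 62 [g, h] - 2 := by omega
            refine ⟨i, hi', ?_⟩
            have := hi.2
            rw [hG.mod _ (hqlt i hi'), hG.ed _ (hmod i hi'), hG.ed d hd] at this
            exact this
          · rintro ⟨i, hi, he⟩
            refine ⟨i, by rw [hG.K]; omega, ?_⟩
            simp only [Test.holds_conj, Test.holds_natLE, Test.holds_eq]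
            simp
            rw [hG.mod _ (hqlt i hi), hG.ed _ (hmod i hi), hG.ed d hd]
            exact ⟨by omega, he⟩
        rw [e1, NBody.eval_flag_eq_one, Set.mem_union, ← hflag d hd, ← e3]
        simp
      ext e
      constructor
      · rintro ⟨d, hd, rfl, h71⟩
        exact (hflag' d hd).1 h71
      · intro he
        obtain ⟨d, hd, rfl⟩ : ∃ d < G.M, G.ed d = e := by
          rcases he with ⟨i, hi, rfl⟩ | ⟨i, hi, rfl⟩
          · exact ⟨_, hbest.isRoute.lt i hi, rfl⟩
          · exact ⟨_, hmod i hi, rfl⟩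
        exact ⟨d, hd, rfl, (hflag' d hd).2 he⟩
    obtain ⟨c1, c2, Lv, c3, c4, c5⟩ := DartGraph.core_sound hred hc0 hST hSn hbest hbest'.isRoute
    rw [hsol]
    refine ⟨c1, c2, Lv, c3, c4, c5.trans ?_⟩
    rw [hval, hcost, hcost']
    rfl
  · intro hST hSn F₁ F₂ L₁ L₂ hF₁ hF₂ hr hconn hL₁0 hL₂0 hL₁ hL₂
    obtain ⟨p, j, hp, hj, hpc⟩ := DartGraph.pathProblem_complete hST hSn hF₁ hr hL₁0 hL₁
    have hkk := t1.exists_route hp (by omega)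
    obtain ⟨l, pos, lev, red, hbest, hcost, hred, t2, hflag⟩ := main hkk
    obtain ⟨p', j', hp', hj', hpc'⟩ :=
      DartGraph.core_complete hred hc0 hST hbest hF₂ hconn hL₂0 hL₂
    have hkk' := t2.exists_route hp' (by omega)
    obtain ⟨h2, hK, hbest', hcost'⟩ := t2.isBest hkk'
    refine ⟨hok.2 ⟨hkk, hkk'⟩, ?_⟩
    have e1 := hbest.cost_le p j hp (by omega)
    have e2 := hbest'.cost_le p' j' hp' (by omega)
    rw [hcost'] at e2
    rw [hval, ← hcost]
    exact add_le_add (e1.trans hpc) (e2.trans hpc')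

end Represents

/-! ## Networks as dart graphs -/

namespace Network

variable (N : Network)

/-- The first end of an edge, as a number. -/
def fstNat (e : ℕ) : ℕ := if h : e < N.m then N.fst ⟨e, h⟩ else 0

/-- The second end of an edge, as a number. -/
def sndNat (e : ℕ) : ℕ := if h : e < N.m then N.snd ⟨e, h⟩ else 0

/-- The dart graph of a network: the darts `e` and `e + m` are the two directions of the edge `e`. -/
def dartGraph : DartGraph where
  n := N.n
  M := N.m + N.m
  tl d := if N.m ≤ d then N.sndNat (d - N.m) else N.fstNat d
  hd d := if N.m ≤ d then N.fstNat (d - N.m) else N.sndNat d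
  ed d := if N.m ≤ d then d - N.m else d
  rev d := if N.m ≤ d then d - N.m else d + N.m
  tl_lt d hd := by
    split_ifs with h
    · rw [sndNat, dif_pos (by omega)]; exact Fin.is_lt _
    · rw [fstNat, dif_pos (by omega)]; exact Fin.is_lt _
  rev_lt d hd := by split_ifs <;> omega
  tl_rev d hd := by
    by_cases h : N.m ≤ d
    · rw [if_pos h, if_neg (by omega), if_pos h]
    · rw [if_neg h, if_pos (by omega), if_neg h, Nat.add_sub_cancel]
  hd_rev d hd := by
    by_cases h : N.m ≤ d
    · rw [if_pos h, if_neg (by omega), if_pos h]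
    · rw [if_neg h, if_pos (by omega), if_neg h, Nat.add_sub_cancel]
  ed_rev d hd := by split_ifs <;> omega
  rev_rev d hd := by split_ifs <;> omega
  eq_or_eq_rev d hd d' hd' h := by split_ifs at h ⊢ <;> omega

/-- The cost of a dart at its tail. -/
noncomputable def tailCost (d : ℕ) : ℝ :=
  if N.m ≤ d then (if h : d - N.m < N.m then (N.cost ⟨d - N.m, h⟩ (N.snd ⟨d - N.m, h⟩) : ℝ) else 0)
  else if h : d < N.m then (N.cost ⟨d, h⟩ (N.fst ⟨d, h⟩) : ℝ) else 0

theorem tailCost_nonneg (d : ℕ) : 0 ≤ N.tailCost d := by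
  unfold tailCost
  split_ifs <;> simp

variable {N}

/-- The edge numbers of a set of edges. -/
def nums (F : Finset (Fin N.m)) : Finset ℕ := F.map Fin.valEmbedding

theorem mem_nums {F : Finset (Fin N.m)} {e : Fin N.m} : (e : ℕ) ∈ nums F ↔ e ∈ F := by
  simp [nums, Fin.ext_iff.symm]

theorem exists_of_mem_nums {F : Finset (Fin N.m)} {e : ℕ} (h : e ∈ nums F) : ∃ e' ∈ F, (e' : ℕ) = e := by
  simpa [nums] using h

/-- Every dart is one of the two directions of an edge. -/
theorem dart_cases {d : ℕ} (hd : d < N.dartGraph.M) : ∃ e : Fin N.m, N.dartGraph.ed d = e ∧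
    ((N.dartGraph.tl d = N.fst e ∧ N.dartGraph.hd d = N.snd e ∧ N.tailCost d = N.cost e (N.fst e)) ∨
      (N.dartGraph.tl d = N.snd e ∧ N.dartGraph.hd d = N.fst e ∧
        N.tailCost d = N.cost e (N.snd e))) := by
  have hd : d < N.m + N.m := hd
  by_cases h : N.m ≤ d
  · have h' : d - N.m < N.m := by omega
    refine ⟨⟨d - N.m, h'⟩, ?_, .inr ⟨?_, ?_, ?_⟩⟩ <;>
      simp [dartGraph, fstNat, sndNat, tailCost, h, h']
  · have h' : d < N.m := by omega
    refine ⟨⟨d, h'⟩, ?_, .inl ⟨?_, ?_, ?_⟩⟩ <;>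
      simp [dartGraph, fstNat, sndNat, tailCost, h']

theorem exists_dart_fst (e : Fin N.m) : ∃ d < N.dartGraph.M, N.dartGraph.ed d = e ∧
    N.dartGraph.tl d = N.fst e ∧ N.dartGraph.hd d = N.snd e ∧ N.tailCost d = N.cost e (N.fst e) := by
  have he := e.is_lt
  refine ⟨e, show (e : ℕ) < N.m + N.m by omega, ?_⟩
  simp [dartGraph, fstNat, sndNat, tailCost]

theorem exists_dart_snd (e : Fin N.m) : ∃ d < N.dartGraph.M, N.dartGraph.ed d = e ∧
    N.dartGraph.tl d = N.snd e ∧ N.dartGraph.hd d = N.fst e ∧ N.tailCost d = N.cost e (N.snd e) := by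
  have he := e.is_lt
  refine ⟨e + N.m, show (e : ℕ) + N.m < N.m + N.m by omega, ?_⟩
  simp [dartGraph, fstNat, sndNat, tailCost]

theorem Joins.exists_dart {e : Fin N.m} {u v : Fin N.n} (h : N.Joins e u v) :
    ∃ d < N.dartGraph.M, N.dartGraph.ed d = e ∧ N.dartGraph.tl d = u ∧ N.dartGraph.hd d = v := by
  rcases h with ⟨rfl, rfl⟩ | ⟨rfl, rfl⟩
  · obtain ⟨d, h1, h2, h3, h4, -⟩ := exists_dart_fst e
    exact ⟨d, h1, h2, h3, h4⟩
  · obtain ⟨d, h1, h2, h3, h4, -⟩ := exists_dart_snd e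
    exact ⟨d, h1, h2, h3, h4⟩

theorem exists_joins {d : ℕ} (hd : d < N.dartGraph.M) : ∃ (e : Fin N.m) (u v : Fin N.n),
    N.Joins e u v ∧ N.dartGraph.ed d = e ∧ N.dartGraph.tl d = u ∧ N.dartGraph.hd d = v := by
  obtain ⟨e, he, ⟨h1, h2, -⟩ | ⟨h1, h2, -⟩⟩ := dart_cases hd
  · exact ⟨e, _, _, .inl ⟨rfl, rfl⟩, he, h1, h2⟩
  · exact ⟨e, _, _, .inr ⟨rfl, rfl⟩, he, h1, h2⟩

/-! ### Paths -/

theorem Walk.reach {F X : Set ℕ} {u v : Fin N.n} (p : N.Walk u v)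
    (hF : ∀ e ∈ p.edges, (e : ℕ) ∈ F) (hX : ∀ w ∈ p.support, (w : ℕ) ∈ X) :
    N.dartGraph.Reach F X u v := by
  induction p with
  | nil => exact .refl
  | cons e h p ih =>
    simp only [Walk.edges, Walk.support, List.mem_cons, forall_eq_or_imp] at hF hX
    obtain ⟨d, hd, he, h1, h2⟩ := h.exists_dart
    have hv : N.dartGraph.hd d ∈ X := by
      rw [h2]
      refine hX.2 _ ?_
      cases p <;> simp [Walk.support]
    have := DartGraph.reach_dart (F := F) (X := X) hd (by rw [he]; exact hF.1)
      (by rw [h1]; exact hX.1) hv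
    rw [h1, h2] at this
    exact this.trans (ih hF.2 hX.2)

/-- Cut a path off at a node. -/
theorem Walk.exists_isPath_of_mem {u v w : Fin N.n} (p : N.Walk u v) (hp : p.IsPath)
    (hw : w ∈ p.support) : ∃ p' : N.Walk w v, p'.IsPath ∧ p'.edges ⊆ p.edges ∧
      p'.support ⊆ p.support := by
  induction p with
  | nil =>
    simp only [Walk.support, List.mem_singleton] at hw
    subst hw
    exact ⟨.nil _, hp, by simp, by simp⟩
  | cons e h p ih =>
    simp only [Walk.support, List.mem_cons] at hw
    rcases hw with rfl | hw
    · exact ⟨.cons e h p, hp, List.Subset.refl _, List.Subset.refl _⟩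
    · obtain ⟨p', h1, h2, h3⟩ := ih (List.nodup_cons.1 hp).2 hw
      exact ⟨p', h1, fun x hx => .tail _ (h2 hx), fun x hx => .tail _ (h3 hx)⟩

/-- The path is built from its end. If a new first node already occurs on it, the path is cut off at
that node, so it stays simple. -/
theorem exists_path_of_reach {F X : Set ℕ} {a b : ℕ} (h : N.dartGraph.Reach F X a b) {u v : Fin N.n}
    (hu : a = u) (hv : b = v) (hb : b ∈ X) :
    ∃ p : N.Walk u v, p.IsPath ∧ (∀ e ∈ p.edges, (e : ℕ) ∈ F) ∧ ∀ w ∈ p.support, (w : ℕ) ∈ X := by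
  induction h using Relation.ReflTransGen.head_induction_on generalizing u with
  | refl =>
    obtain rfl : u = v := Fin.ext (hu.symm.trans hv)
    refine ⟨.nil u, ?_, by simp [Walk.edges], ?_⟩
    · simp [Walk.IsPath, Walk.support]
    · simpa [Walk.support, ← hu] using hb
  | head hs _ ih =>
    obtain ⟨ha, -, d, hd, he, rfl, rfl⟩ := hs
    obtain ⟨e, u', w, hj, h1, h2, h3⟩ := exists_joins hd
    obtain rfl : u = u' := Fin.ext (hu.symm.trans h2)
    obtain ⟨p, hp, hpF, hpX⟩ := ih h3
    by_cases hup : u ∈ p.support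
    · obtain ⟨p', h4, h5, h6⟩ := p.exists_isPath_of_mem hp hup
      exact ⟨p', h4, fun e he => hpF e (h5 he), fun w hw => hpX w (h6 hw)⟩
    · refine ⟨.cons e hj p, List.nodup_cons.2 ⟨hup, hp⟩, ?_, ?_⟩
      · simp only [Walk.edges, List.mem_cons, forall_eq_or_imp]
        exact ⟨h1 ▸ he, hpF⟩
      · simp only [Walk.support, List.mem_cons, forall_eq_or_imp]
        exact ⟨hu ▸ ha, hpX⟩

theorem ContainsDP.reach {F : Finset (Fin N.m)} (h : N.ContainsDP 1 F) :
    N.dartGraph.Reach (nums F) Set.univ N.s N.t := by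
  obtain ⟨p, hp, -⟩ := h
  exact (p 0).reach (fun e he => by simpa using mem_nums.2 ((hp 0).2 e he)) fun _ _ => trivial

/-- A single edge lies on at most one of the two paths, so the other one avoids it. -/
theorem ContainsEDP.eConn2 {F : Finset (Fin N.m)} (h : N.ContainsEDP 2 F) :
    N.dartGraph.EConn2 (nums F) N.s N.t := by
  obtain ⟨p, hp, hdisj⟩ := h
  intro e
  have key : ∀ i, (∀ e' ∈ (p i).edges, (e' : ℕ) ≠ e) →
      N.dartGraph.Reach (nums F \ {e}) Set.univ N.s N.t := fun i hi =>
    (p i).reach (fun e' he' => ⟨by simpa using mem_nums.2 ((hp i).2 e' he'), hi e' he'⟩)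
      fun _ _ => trivial
  by_cases h0 : ∀ e' ∈ (p 0).edges, (e' : ℕ) ≠ e
  · exact key 0 h0
  · push Not at h0
    obtain ⟨e₀, he₀, rfl⟩ := h0
    refine key 1 fun e' he' h' => ?_
    exact hdisj 0 1 (by decide) he₀ (Fin.ext h' ▸ he')

theorem ContainsDP.conn2 {F : Finset (Fin N.m)} (h : N.ContainsDP 2 F) :
    N.dartGraph.Conn2 (nums F) N.s N.t := by
  refine ⟨ContainsEDP.eConn2 ?_, fun x hxs hxt => ?_⟩
  · obtain ⟨p, hp, hdisj⟩ := h
    exact ⟨p, hp, fun i j hij => (hdisj i j hij).1⟩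
  · obtain ⟨p, hp, hdisj⟩ := h
    have key : ∀ i, (∀ w ∈ (p i).support, (w : ℕ) ≠ x) →
        N.dartGraph.Reach (nums F) {x}ᶜ N.s N.t := fun i hi =>
      (p i).reach (fun e' he' => by simpa using mem_nums.2 ((hp i).2 e' he')) hi
    by_cases h0 : ∀ w ∈ (p 0).support, (w : ℕ) ≠ x
    · exact key 0 h0
    · push Not at h0
      obtain ⟨w₀, hw₀, rfl⟩ := h0
      refine key 1 fun w hw h' => ?_
      obtain rfl : w = w₀ := Fin.ext h'
      rcases (hdisj 0 1 (by decide)).2 w hw₀ hw with rfl | rfl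
      · exact hxs rfl
      · exact hxt rfl

theorem containsEDP_of_eConn2 {F : Finset (Fin N.m)} (h : N.dartGraph.EConn2 (nums F) N.s N.t) :
    N.ContainsEDP 2 F := by
  obtain ⟨E₁, E₂, h1, h2, h3, h4, h5⟩ := DartGraph.EConn2.exists_disjoint (nums F)
    (fun h => N.s_ne_t (Fin.ext h)) h
  obtain ⟨p, hp, hpF, -⟩ := exists_path_of_reach h4 rfl rfl trivial
  obtain ⟨q, hq, hqF, -⟩ := exists_path_of_reach h5 rfl rfl trivial
  have hpq : p.edges.Disjoint q.edges := fun e he he' =>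
    Set.disjoint_left.1 h3 (hpF e he) (hqF e he')
  refine ⟨![p, q], ?_, ?_⟩
  · intro i
    fin_cases i
    · exact ⟨hp, fun e he => mem_nums.1 (by simpa using h1 (hpF e he))⟩
    · exact ⟨hq, fun e he => mem_nums.1 (by simpa using h2 (hqF e he))⟩
  · intro i j hij
    fin_cases i <;> fin_cases j <;> first | exact absurd rfl hij | exact hpq | exact hpq.symm

theorem containsDP_of_conn2 {F : Finset (Fin N.m)} (h : N.dartGraph.Conn2 (nums F) N.s N.t) :
    N.ContainsDP 2 F := by
  obtain ⟨E₁, E₂, X₁, X₂, h1, h2, h3, hX, -, -, h4, h5⟩ := h.exists_disjoint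
    (fun h => N.s_ne_t (Fin.ext h))
  -- Since `s` and `t` differ, `t` is entered by a last step, and steps stay inside `X`.
  have ht : ∀ {E X : Set ℕ}, N.dartGraph.Reach E X N.s N.t → (N.t : ℕ) ∈ X := by
    intro E X hr
    rcases Relation.ReflTransGen.cases_tail hr with h | ⟨_, -, -, h, -⟩
    · exact absurd (Fin.ext h).symm N.s_ne_t
    · exact h
  obtain ⟨p, hp, hpF, hpX⟩ := exists_path_of_reach h4 rfl rfl (ht h4)
  obtain ⟨q, hq, hqF, hqX⟩ := exists_path_of_reach h5 rfl rfl (ht h5)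
  have hpq : p.edges.Disjoint q.edges := fun e he he' =>
    Set.disjoint_left.1 h3 (hpF e he) (hqF e he')
  have hpq' : ∀ v ∈ p.support, v ∈ q.support → v = N.s ∨ v = N.t := fun v hv hv' => by
    simpa [Fin.ext_iff] using hX v (hpX v hv) (hqX v hv')
  refine ⟨![p, q], ?_, ?_⟩
  · intro i
    fin_cases i
    · exact ⟨hp, fun e he => mem_nums.1 (by simpa using h1 (hpF e he))⟩
    · exact ⟨hq, fun e he => mem_nums.1 (by simpa using h2 (hqF e he))⟩
  · intro i j hij
    fin_cases i <;> fin_cases j <;> first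
      | exact absurd rfl hij
      | exact ⟨hpq, hpq'⟩
      | exact ⟨hpq.symm, fun v hv hv' => hpq' v hv' hv⟩

/-! ### Levels -/

/-- The level of an edge set at a node, given by its number. -/
noncomputable def levelNat (F : Finset (Fin N.m)) (v : ℕ) : ℝ :=
  if h : v < N.n then (N.level F ⟨v, h⟩ : ℝ) else 0

theorem levelNat_nonneg (F : Finset (Fin N.m)) (v : ℕ) : 0 ≤ levelNat F v := by
  unfold levelNat
  split_ifs <;> simp

theorem levelNat_val (F : Finset (Fin N.m)) (v : Fin N.n) : levelNat F v = N.level F v := by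
  simp [levelNat]

theorem sum_levelNat (F : Finset (Fin N.m)) :
    ∑ v ∈ Finset.range N.dartGraph.n, levelNat F v = N.activationCost F := by
  change ∑ v ∈ Finset.range N.n, levelNat F v = _
  rw [Finset.sum_range, activationCost, NNReal.coe_sum]
  exact Finset.sum_congr rfl fun v _ => levelNat_val F v

theorem activates_levelNat (F : Finset (Fin N.m)) :
    N.dartGraph.Activates N.tailCost (levelNat F) (nums F) := by
  intro d hd he
  obtain ⟨e, h1, h⟩ := dart_cases hd
  have he : e ∈ F := by rw [h1] at he; exact mem_nums.1 (by simpa using he)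
  rcases h with ⟨h2, -, h3⟩ | ⟨h2, -, h3⟩
  · rw [h2, h3, levelNat_val, NNReal.coe_le_coe]
    exact Finset.le_sup (f := fun e' => N.cost e' (N.fst e)) (by simp [he])
  · rw [h2, h3, levelNat_val, NNReal.coe_le_coe]
    exact Finset.le_sup (f := fun e' => N.cost e' (N.snd e)) (by simp [he])

/-- A maximum over a nonempty finite set is attained. Hence there are only polynomially many
candidates for a level, one for each dart. -/
theorem exists_dart_eq_levelNat {F : Finset (Fin N.m)} {v : ℕ} (hv : v ∈ N.dartGraph.nodes (nums F)) :
    ∃ d < N.dartGraph.M, N.dartGraph.tl d = v ∧ N.tailCost d = levelNat F v := by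
  obtain ⟨d, hd, he, rfl⟩ := hv
  obtain ⟨w, hw⟩ : ∃ w : Fin N.n, N.dartGraph.tl d = w := ⟨⟨_, N.dartGraph.tl_lt d hd⟩, rfl⟩
  have hne : (F.filter fun e => N.fst e = w ∨ N.snd e = w).Nonempty := by
    obtain ⟨e, h1, h⟩ := dart_cases hd
    have he : e ∈ F := by rw [h1] at he; exact mem_nums.1 (by simpa using he)
    refine ⟨e, Finset.mem_filter.2 ⟨he, ?_⟩⟩
    rcases h with ⟨h2, -⟩ | ⟨h2, -⟩
    · exact .inl (Fin.ext (h2.symm.trans hw))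
    · exact .inr (Fin.ext (h2.symm.trans hw))
  obtain ⟨e, he', hsup⟩ := Finset.exists_mem_eq_sup _ hne fun e => N.cost e w
  rw [hw, levelNat_val, level, hsup]
  rcases (Finset.mem_filter.1 he').2 with rfl | rfl
  · obtain ⟨d, h1, -, h2, -, h3⟩ := exists_dart_fst e
    exact ⟨d, h1, h2, h3⟩
  · obtain ⟨d, h1, -, h2, -, h3⟩ := exists_dart_snd e
    exact ⟨d, h1, h2, h3⟩

/-- The level is the least nonnegative function that activates the edge set. -/
theorem activationCost_le {F : Finset (Fin N.m)} {L : ℕ → ℝ} (hL0 : ∀ v, 0 ≤ L v)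
    (hL : N.dartGraph.Activates N.tailCost L (nums F)) :
    (N.activationCost F : ℝ) ≤ ∑ v ∈ Finset.range N.dartGraph.n, L v := by
  change _ ≤ ∑ v ∈ Finset.range N.n, L v
  rw [Finset.sum_range, activationCost, NNReal.coe_sum]
  refine Finset.sum_le_sum fun v _ => ?_
  obtain ⟨l, hl⟩ : ∃ l : ℝ≥0, (l : ℝ) = L v := ⟨⟨L v, hL0 v⟩, rfl⟩
  rw [← hl, NNReal.coe_le_coe]
  refine Finset.sup_le fun e he => ?_
  rw [Finset.mem_filter] at he
  rw [← NNReal.coe_le_coe, hl]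
  rcases he.2 with rfl | rfl
  · obtain ⟨d, h1, h2, h3, -, h4⟩ := exists_dart_fst e
    rw [← h4, ← h3]
    exact hL d h1 (by rw [h2]; simpa using mem_nums.2 he.1)
  · obtain ⟨d, h1, h2, h3, -, h4⟩ := exists_dart_snd e
    rw [← h4, ← h3]
    exact hL d h1 (by rw [h2]; simpa using mem_nums.2 he.1)

end Network

/-! ## Running the programs -/

/-- Well-formedness of an algorithm: its statements form a well-formed program, do not overwrite the
input, and run over polynomially many values of the loop variables. -/
def wfAlgorithm (L : List Stmt) : Bool :=
  wfProg L && L.all fun s => decide (7 ≤ s.a) &&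
    (s.bounds ++ s.rule.bounds).all fun b => [0, 1, 10, 11, 12, 13, 15, 16, 17, 18].contains b

/-- The machine does not divide, so quotients and remainders are tabulated by counting up. -/
theorem succ_div_mod {M : ℕ} (hM : 0 < M) (q : ℕ) :
    (q + 1) / M = (if M ≤ q % M + 1 then q / M + 1 else q / M) ∧
      (q + 1) % M = if M ≤ q % M + 1 then 0 else q % M + 1 := by
  rw [Nat.div_mod_unique hM]
  have h1 := Nat.mod_add_div q M
  have h2 := Nat.mod_lt q hM
  split_ifs with h
  · exact ⟨by rw [mul_add]; omega, hM⟩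
  · exact ⟨by omega, by omega⟩

namespace Network

variable {N : Network} {E₀ : Finset (Fin N.m)} {τ : Mem} {L : List Stmt}

/-- The memory contains the input. -/
structure HasInput (N : Network) (E₀ : Finset (Fin N.m)) (τ : Mem) : Prop where
  nat : ∀ a < 7, ∀ l, τ.nat a l = (N.load E₀).nat a l
  real : ∀ a < 7, ∀ l, τ.real a l = (N.load E₀).real a l

theorem HasInput.n (h : N.HasInput E₀ τ) : τ.nat 0 [] = N.n := h.nat 0 (by norm_num) []

theorem HasInput.m (h : N.HasInput E₀ τ) : τ.nat 1 [] = N.m := h.nat 1 (by norm_num) []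

theorem HasInput.s (h : N.HasInput E₀ τ) : τ.nat 2 [] = N.s := h.nat 2 (by norm_num) []

theorem HasInput.t (h : N.HasInput E₀ τ) : τ.nat 3 [] = N.t := h.nat 3 (by norm_num) []

theorem HasInput.fst (h : N.HasInput E₀ τ) (e : ℕ) : τ.nat 4 [e] = N.fstNat e :=
  h.nat 4 (by norm_num) [e]

theorem HasInput.snd (h : N.HasInput E₀ τ) (e : ℕ) : τ.nat 5 [e] = N.sndNat e :=
  h.nat 5 (by norm_num) [e]

theorem HasInput.mem (h : N.HasInput E₀ τ) (e : Fin N.m) : τ.nat 6 [e] = 1 ↔ e ∈ E₀ := by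
  rw [h.nat 6 (by norm_num)]
  simp [load]

theorem load_nat_of_le {a : ℕ} (h : 7 ≤ a) (l : List ℕ) : (N.load E₀).nat a l = 0 := by
  simp only [load]
  split <;> omega

theorem load_real_of_le {a : ℕ} (h : 7 ≤ a) (l : List ℕ) : (N.load E₀).real a l = 0 := by
  simp only [load]
  split <;> first | omega | rfl

theorem load_view : (N.load E₀).view [] = N.load E₀ := by
  have h : (N.load E₀).nat 9 = fun _ => 0 := funext fun l => load_nat_of_le (by norm_num) l
  simp only [Mem.view, List.getD_nil, ite_self]
  rw [← h, Function.update_eq_self]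

/-- The prelude computes the dart graph. -/
theorem HasInput.represents (h : N.HasInput E₀ τ) (hL : Satisfies τ L) {size : NExp}
    (hsub : preludeProg size ⊆ L) : Represents τ N.dartGraph N.tailCost ∧
      τ.nat 11 [] = N.dartGraph.M + 1 ∧ τ.nat 18 [] = size.eval (τ.view []) := by
  simp only [preludeProg, List.cons_subset, List.nil_subset, and_true] at hsub
  obtain ⟨m10, m11, m12, m13, m14, m15, m16, m17, m18, m20, m21, m22, m23, m24, m25, r20⟩ := hsub
  have hM : N.dartGraph.M = N.m + N.m := rfl
  have e10 : τ.nat 10 [] = N.dartGraph.M := by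
    have := hL.nat m10 (z := []) (by simp)
    simpa [cellIndex, h.m, hM] using this
  have e11 : τ.nat 11 [] = N.dartGraph.M + 1 := by
    have := hL.nat m11 (z := []) (by simp)
    simpa [cellIndex, e10] using this
  have e12 : τ.nat 12 [] = N.dartGraph.M + 2 := by
    have := hL.nat m12 (z := []) (by simp)
    simpa [cellIndex, e10] using this
  have e13 : τ.nat 13 [] = N.dartGraph.M + 3 := by
    have := hL.nat m13 (z := []) (by simp)
    simpa [cellIndex, e10] using this
  -- Multiples of `M` arise by repeated addition; the last one is `(M + 1) * M`, the number of
  -- states of augmenting sequences.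
  have e14 : ∀ i ≤ N.dartGraph.M + 1, τ.nat 14 [i] = i * N.dartGraph.M := by
    intro i hi
    induction i with
    | zero => rw [hL.nat_zero m14 rfl rfl, zero_mul]
    | succ i ih =>
      have := hL.nat m14 (z := [i]) (by simp [e11]; omega)
      simp [cellIndex, e10, ih (by omega)] at this
      rw [this, Nat.succ_mul]
  have e15 : τ.nat 15 [] = (N.dartGraph.M + 1) * N.dartGraph.M := by
    have := hL.nat m15 (z := []) (by simp)
    simpa [cellIndex, e11, e14 _ le_rfl] using this
  have e16 : τ.nat 16 [] = (N.dartGraph.M + 1) * N.dartGraph.M + 2 := by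
    have := hL.nat m16 (z := []) (by simp)
    simpa [cellIndex, e15] using this
  have e17 : τ.nat 17 [] = 1 := by
    have := hL.nat m17 (z := []) (by simp)
    simpa [cellIndex] using this
  have e18 : τ.nat 18 [] = size.eval (τ.view []) := by
    have := hL.nat m18 (z := []) (by simp)
    simpa [cellIndex] using this
  have edm : ∀ q < (N.dartGraph.M + 1) * N.dartGraph.M,
      τ.nat 20 [q] = q % N.dartGraph.M ∧ τ.nat 21 [q] = q / N.dartGraph.M := by
    intro q hq
    induction q with
    | zero => rw [hL.nat_zero m20 rfl rfl, hL.nat_zero m21 rfl rfl]; simp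
    | succ q ih =>
      have hpos : 0 < N.dartGraph.M := Nat.pos_of_ne_zero fun h0 => by simp [h0] at hq
      obtain ⟨ih1, ih2⟩ := ih (by omega)
      have h1 := hL.nat m20 (z := [q]) (by simp [e15]; omega)
      have h2 := hL.nat m21 (z := [q]) (by simp [e15]; omega)
      simp [cellIndex, e10, ih1, ih2] at h1 h2
      rw [h1, h2, and_comm, eq_comm, @eq_comm _ _ ((q + 1) % _)]
      exact succ_div_mod hpos q
  refine ⟨⟨h.n, e10, e12, e13, e15, e16, e17, fun q hq => (edm q hq).1, fun q hq => (edm q hq).2,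
    fun d hd => ?_, fun d hd => ?_, fun d hd => ?_, fun d hd => ?_, fun d hd => ?_⟩, e11, e18⟩
  · have := hL.nat m22 (z := [d]) (by simp [e10, hd])
    simpa [cellIndex, h.m, h.fst, h.snd, dartGraph] using this
  · have := hL.nat m23 (z := [d]) (by simp [e10, hd])
    simpa [cellIndex, h.m, h.fst, h.snd, dartGraph] using this
  · have := hL.nat m24 (z := [d]) (by simp [e10, hd])
    simpa [cellIndex, h.m, dartGraph] using this
  · have := hL.nat m25 (z := [d]) (by simp [e10, hd])
    simpa [cellIndex, h.m, dartGraph] using this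
  · have := hL.real r20 (z := [d]) (by simp [e10, hd])
    simpa [cellIndex, h.m, tailCost, h.real, load] using this

/-- Well-formed algorithms run in polynomial time, and in the end all their statements hold. -/
theorem exists_run (hwf : wfAlgorithm L = true) {size : NExp} (hsub : preludeProg size ⊆ L)
    (hsize : ∀ (M : ℕ) (τ : Mem), τ.nat 10 [] = M → size.eval (τ.view []) ≤ M + 1) :
    ∃ b : Polynomial ℕ, ∀ (N : Network) (E₀ : Finset (Fin N.m)), ∃ T τ,
      Exec (compile L) (N.load E₀) T (τ.view []) ∧ T ≤ b.eval (N.n + N.m) ∧ Satisfies τ L ∧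
      N.HasInput E₀ τ := by
  simp only [wfAlgorithm, Bool.and_eq_true, List.all_eq_true, decide_eq_true_eq] at hwf
  obtain ⟨hwf, hall⟩ := hwf
  obtain ⟨C, D, H⟩ := exec_compile L hwf
  -- For `M = 2 * m` and `X = n + m`, the base bounds `(M + 1) * M + M + n + 10`.
  refine ⟨.C C * ((2 * .X + 1) * (2 * .X) + 3 * .X + 10) ^ D, fun N E₀ => ?_⟩
  obtain ⟨T, τ, h1, h2, h3, h4, h5⟩ := H (N.load E₀)
  rw [load_view] at h1
  have hin : N.HasInput E₀ τ := by
    constructor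
    · intro a ha l
      have := h3 false a (fun s hs h => by
        have h7 := (hall s hs).1
        rw [show s.a = a from congrArg Prod.snd h] at h7
        omega) l
      simpa [Mem.get] using this
    · intro a ha l
      have := h3 true a (fun s hs h => by
        have h7 := (hall s hs).1
        rw [show s.a = a from congrArg Prod.snd h] at h7
        omega) l
      simpa [Mem.get] using this
  have hsat : Satisfies τ L := by
    intro s hs
    refine ⟨h2 s hs, fun hsh l hl => ?_⟩
    rw [h4 s hs hsh l hl]
    have h7 := (hall s hs).1
    simp only [Mem.get, load_nat_of_le h7, load_real_of_le h7]
  refine ⟨T, τ, h1, ?_, hsat, hin⟩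
  obtain ⟨hG, e11, e18⟩ := hin.represents hsat hsub
  have hM : N.dartGraph.M = N.m + N.m := rfl
  -- One bound for every scalar that bounds a loop; `wfAlgorithm` admits only ten of them, all with
  -- known values or bounds.
  refine (h5 ((N.dartGraph.M + 1) * N.dartGraph.M + N.dartGraph.M + N.n + 5) ?_).trans ?_
  · intro s hs b hb
    have := (hall s hs).2 b hb
    have h18 := hsize _ τ hG.M
    rw [← e18] at h18
    have h0 : τ.nat 0 [] = N.n := hG.n
    simp only [List.contains_eq_mem, List.mem_cons, List.not_mem_nil, or_false,
      decide_eq_true_eq] at this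
    rcases this with rfl | rfl | rfl | rfl | rfl | rfl | rfl | rfl | rfl | rfl
    · omega
    · rw [hin.m]; omega
    · rw [hG.M]; omega
    · rw [e11]; omega
    · rw [hG.K]; omega
    · rw [hG.K']; omega
    · rw [hG.Q]; omega
    · rw [hG.N]; omega
    · rw [hG.one]; omega
    · omega
  · simp only [Polynomial.eval_mul, Polynomial.eval_C, Polynomial.eval_pow, Polynomial.eval_add,
      Polynomial.eval_X, Polynomial.eval_one, Polynomial.eval_ofNat]
    refine Nat.mul_le_mul_left _ (Nat.pow_le_pow_left ?_ D)
    rw [hM]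
    nlinarith [Nat.zero_le N.n, Nat.zero_le N.m, Nat.zero_le (N.n * N.m), Nat.zero_le (N.n * N.n)]

end Network

/-! ## The algorithms -/

/-- The edge with number `var 0` is flagged for one of its two darts in the subproblem `(g, h)`. -/
abbrev edgeFlag (g h : NExp) : Test :=
  .disj (.eq (.read 71 ![g, h, var 0]) (.const 1))
    (.eq (.read 71 ![g, h, .add (var 0) (scalar 1)]) (.const 1))

/-- The algorithm for the augmentation problem. -/
def augAlgorithm : List Stmt :=
  preludeProg (.const 1) ++
  [⟨30, false, [18, 18], .nat (.ret (scalar 2))⟩,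
    ⟨31, false, [18, 18], .nat (.ret (scalar 3))⟩,
    ⟨32, false, [18, 18, 10], .nat (.ret (.read 6 ![.read 24 ![var 2]]))⟩,
    ⟨33, false, [18, 18, 10], .nat (.ret (.const 1))⟩,
    ⟨30, false, [18, 18, 10], .real (.ret (.read 20 ![var 2]))⟩] ++
  coreProg ++
  [⟨7, false, [], .nat (.flag (.eq (.read 72 ![.const 0, .const 0]) (.const 1)))⟩,
    ⟨8, false, [1], .nat (.flag (.conj (edgeFlag (.const 0) (.const 0))
      (.neg (.eq (.read 6 ![var 0]) (.const 1)))))⟩]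

/-- The subproblems of the algorithms for two disjoint paths, indexed by pairs of darts. -/
def blockProg : List Stmt :=
  let tl (d : NExp) : NExp := .read 22 ![d]
  let tc (d : NExp) : RExp := .read 20 ![d]
  let rev (d : NExp) : NExp := .read 25 ![d]
  let below (d : NExp) : Test :=
    .conj (.disj (.neg (.eq (tl d) (tl (var 0)))) (.realLE (tc d) (tc (var 0))))
      (.disj (.neg (.eq (tl d) (tl (var 1)))) (.realLE (tc d) (tc (var 1))))
  [⟨30, false, [18, 18], .nat (.ret (tl (var 0)))⟩,
    ⟨31, false, [18, 18], .nat (.ret (tl (var 1)))⟩,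
    ⟨32, false, [18, 18, 10], .nat (.flag (.conj (below (var 2)) (below (rev (var 2)))))⟩,
    ⟨33, false, [18, 18, 10], .nat (.flag (.conj (below (var 2)) (below (rev (var 2)))))⟩,
    ⟨30, false, [18, 18, 10], .real (.ite
      (.disj (.eq (tl (var 2)) (tl (var 0))) (.eq (tl (var 2)) (tl (var 1))))
      (.ret .zero) (.ret (tc (var 2))))⟩]

/-- A cheapest chain of links. -/
def chainProg (link : Test) : List Stmt :=
  routeProg 80 17 17 10 12 12 13
    (.eq (.read 22 ![var 3]) (scalar 2))
    (.conj (.conj (.eq (.read 72 ![var 2, var 3]) (.const 1))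
      (.neg (.eq (.read 22 ![var 2]) (.read 22 ![var 3])))) link)
    (.eq (.read 22 ![var 2]) (scalar 3))
    (.ret (.read 20 ![var 3]))
    (.ret (.add (.read 72 ![var 2, var 3]) (.read 20 ![var 3])))
    (.ret .zero)

/-- The output of the algorithms for two disjoint paths. -/
def outputProg : List Stmt :=
  let dart (i : NExp) : NExp :=
    .read 84 ![.sub (.read 82 ![.const 0, .const 0]) i, .const 0, .const 0]
  [⟨90, false, [1], .search 12 (.conj
      (.natLE (.add (var 1) (.const 3)) (.read 82 ![.const 0, .const 0]))
      (edgeFlag (dart (var 1)) (dart (.add (var 1) (.const 1)))))⟩,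
    ⟨7, false, [], .nat (.flag (.neg (.eq (.read 82 ![.const 0, .const 0]) (.const 0))))⟩,
    ⟨8, false, [1], .nat (.flag (.neg (.eq (.read 90 ![var 0]) (.const 0))))⟩]

/-- The algorithm for two disjoint paths; `link` is an additional condition on links. -/
def chainAlgorithm (link : Test) : List Stmt :=
  preludeProg (scalar 10) ++ blockProg ++ coreProg ++ chainProg link ++ outputProg

/-- For edge-disjoint paths, all links are admitted. -/
def edgeLink : Test := .natLE (.const 0) (.const 0)

/-- For internally disjoint paths, only links between the source and the sink are admitted. -/
def nodeLink : Test := .conj (.eq (.read 22 ![var 2]) (scalar 2)) (.eq (.read 22 ![var 3]) (scalar 3))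

theorem wf_augAlgorithm : wfAlgorithm augAlgorithm = true := by decide +kernel

theorem wf_chainAlgorithm_edgeLink : wfAlgorithm (chainAlgorithm edgeLink) = true := by
  decide +kernel

theorem wf_chainAlgorithm_nodeLink : wfAlgorithm (chainAlgorithm nodeLink) = true := by
  decide +kernel

theorem NBody.eval_flag (σ : Mem) (b : Test) [Decidable (b.Holds σ)] :
    (NBody.flag b).eval σ = if b.Holds σ then 1 else 0 := by
  simp only [NBody.flag, NBody.eval_ite]
  congr

theorem DartGraph.Conn2.mono {G : DartGraph} {F F' : Set ℕ} {S T : ℕ} (h : G.Conn2 F S T)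
    (hF : F ⊆ F') : G.Conn2 F' S T :=
  ⟨fun e => (h.1 e).mono (Set.sdiff_subset_sdiff_left hF) subset_rfl,
    fun x hS hT => (h.2 x hS hT).mono hF subset_rfl⟩

/-! ### From flagged darts to output edge sets -/

namespace Network

variable {N : Network}

theorem exists_dart_iff {p : ℕ → Prop} (e : Fin N.m) :
    (∃ d < N.dartGraph.M, N.dartGraph.ed d = e ∧ p d) ↔ p e ∨ p (e + N.m) := by
  have he := e.is_lt
  constructor
  · rintro ⟨d, hd, h1, h2⟩
    have hd : d < N.m + N.m := hd
    simp only [dartGraph] at h1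
    split_ifs at h1 with h
    · right; rwa [show (e : ℕ) + N.m = d by omega]
    · left; rwa [← h1]
  · rintro (h | h)
    · exact ⟨e, show (e : ℕ) < N.m + N.m by omega, by simp [dartGraph], h⟩
    · exact ⟨e + N.m, show (e : ℕ) + N.m < N.m + N.m by omega, by simp [dartGraph], h⟩

theorem nums_output {τ : Mem} {sol : Set ℕ} (hsol : ∀ e ∈ sol, e < N.m)
    (h : ∀ e : Fin N.m, (τ.nat 8 [e] = 1 ↔ (e : ℕ) ∈ sol)) :
    (nums (N.output (τ.view [])) : Set ℕ) = sol := by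
  ext e
  constructor
  · intro he
    obtain ⟨e', h1, rfl⟩ := exists_of_mem_nums he
    simp only [output, Finset.mem_filter] at h1
    rw [Mem.view_nat_ne _ _ (by norm_num)] at h1
    exact (h e').1 h1.2
  · intro he
    have : (⟨e, hsol e he⟩ : Fin N.m) ∈ N.output (τ.view []) := by
      simp only [output, Finset.mem_filter, Finset.mem_univ, true_and]
      rw [Mem.view_nat_ne _ _ (by norm_num)]
      exact (h ⟨e, hsol e he⟩).2 he
    simpa using mem_nums.2 this

end Network

/-! ### Specification and correctness of the algorithms -/

namespace Network

variable {N : Network} {τ : Mem}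

theorem s_lt : (N.s : ℕ) < N.dartGraph.n := N.s.is_lt

theorem s_ne_t_val : (N.s : ℕ) ≠ N.t := fun h => N.s_ne_t (Fin.ext h)

theorem ed_lt {d : ℕ} (hd : d < N.dartGraph.M) : N.dartGraph.ed d < N.m := by
  obtain ⟨e, he, -⟩ := dart_cases hd
  rw [he]
  exact e.is_lt

/-- What the algorithm for the augmentation problem computes. -/
theorem augAlgorithm_spec {E₀ : Finset (Fin N.m)} (hL : Satisfies τ augAlgorithm)
    (hin : N.HasInput E₀ τ) : ∃ ok val sol,
      N.dartGraph.CoreResult (nums E₀) Set.univ N.tailCost N.s N.t ok val sol ∧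
      (ok → τ.nat 7 [] = 1) ∧ (¬ ok → τ.nat 7 [] = 0) ∧
      (nums (N.output (τ.view [])) : Set ℕ) = sol \ nums E₀ := by
  classical
  have hL' := hL
  simp only [augAlgorithm, Satisfies.append] at hL'
  obtain ⟨⟨⟨l1, l2⟩, l3⟩, l4⟩ := hL'
  obtain ⟨hG, -, e18⟩ := hin.represents l1 (List.Subset.refl _)
  have e18 : τ.nat 18 [] = 1 := by simpa using e18
  have hok : τ.nat 7 [] = if τ.nat 72 [0, 0] = 1 then 1 else 0 := by
    have := l4.nat (List.mem_cons_self ..) (z := []) (by simp)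
    simpa [cellIndex, NBody.eval_flag] using this
  refine ⟨τ.nat 72 [0, 0] = 1, _, {e | ∃ d < N.dartGraph.M, N.dartGraph.ed d = e ∧
    τ.nat 71 [0, 0, d] = 1}, hG.coreResult (g := 0) (h := 0) l3 (List.Subset.refl _)
      (by omega) (by omega) ?_ ?_ ?_ ?_ N.tailCost_nonneg ?_, fun h => by rw [hok, if_pos h],
      fun h => by rw [hok, if_neg h], nums_output ?_ fun e => ?_⟩
  · have := l2.nat (List.mem_cons_self ..) (z := [0, 0]) (by simp [e18])
    simpa [cellIndex, hin.s] using this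
  · have := l2.nat (.tail _ (List.mem_cons_self ..)) (z := [0, 0]) (by simp [e18])
    simpa [cellIndex, hin.t] using this
  · intro d hd
    have := l2.nat (.tail _ (.tail _ (List.mem_cons_self ..))) (z := [0, 0, d])
      (by simp [e18, hG.M, hd])
    simp [cellIndex, hG.ed d hd] at this
    rw [this]
    obtain ⟨e, he, -⟩ := dart_cases hd
    rw [he, hin.mem, Finset.mem_coe, mem_nums]
  · intro d hd
    have := l2.nat (.tail _ (.tail _ (.tail _ (List.mem_cons_self ..)))) (z := [0, 0, d])
      (by simp [e18, hG.M, hd])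
    simpa [cellIndex] using this
  · intro d hd
    have := l2.real (.tail _ (.tail _ (.tail _ (.tail _ (List.mem_cons_self ..)))))
      (z := [0, 0, d]) (by simp [e18, hG.M, hd])
    simpa [cellIndex, hG.tc d hd] using this
  · rintro e ⟨⟨d, hd, rfl, -⟩, -⟩
    exact ed_lt hd
  · have := l4.nat (.tail _ (List.mem_cons_self ..)) (z := [(e : ℕ)]) (by simp [hin.m])
    simp only [cellIndex, Bool.false_eq_true, if_false] at this
    rw [this, NBody.eval_flag_eq_one, Set.mem_sdiff, Set.mem_ofPred_eq,
      exists_dart_iff (p := fun d => τ.nat 71 [0, 0, d] = 1), Finset.mem_coe, mem_nums, ← hin.mem]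
    simp [hin.m]

/-- What the algorithms for two disjoint paths compute. -/
theorem chainAlgorithm_spec {E₀ : Finset (Fin N.m)} {link : Test} {p : ℕ → ℕ → Prop}
    (hL : Satisfies τ (chainAlgorithm link)) (hin : N.HasInput E₀ τ)
    (hp : ∀ i < N.dartGraph.M, ∀ j < N.dartGraph.M,
      Represents τ N.dartGraph N.tailCost → (link.Holds (τ.view [0, 0, i, j]) ↔ p i j)) :
    ∃ (ok : ℕ → ℕ → Prop) (val : ℕ → ℕ → ℝ) (sol : ℕ → ℕ → Set ℕ) (R : RouteProblem),
      (∀ g < N.dartGraph.M, ∀ h < N.dartGraph.M, N.dartGraph.CoreResult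
        (N.dartGraph.blockEdges N.tailCost g h) (N.dartGraph.blockEdges N.tailCost g h)
        (N.dartGraph.blockCost N.tailCost g h) (N.dartGraph.tl g) (N.dartGraph.tl h)
        (ok g h) (val g h) (sol g h)) ∧
      R = N.dartGraph.chainProblem
        (fun g h => (ok g h ∧ N.dartGraph.tl g ≠ N.dartGraph.tl h) ∧ p g h) val N.tailCost N.s N.t ∧
      ((τ.nat 7 [] = 0 ∧ ∀ q l, l ≤ N.dartGraph.M → ¬ R.IsRoute q l) ∨
      (τ.nat 7 [] = 1 ∧ ∃ q l, R.IsBest (N.dartGraph.M + 2) q l ∧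
        (nums (N.output (τ.view [])) : Set ℕ) = {e | ∃ i < l, e ∈ sol (q i) (q (i + 1))})) := by
  classical
  have hL' := hL
  simp only [chainAlgorithm, Satisfies.append] at hL'
  obtain ⟨⟨⟨⟨l1, l2⟩, l3⟩, l4⟩, l5⟩ := hL'
  obtain ⟨hG, -, e18⟩ := hin.represents l1 (List.Subset.refl _)
  have e18 : τ.nat 18 [] = N.dartGraph.M := by simpa [hG.M] using e18
  set G := N.dartGraph
  set R := G.chainProblem (fun g h => (τ.nat 72 [g, h] = 1 ∧ G.tl g ≠ G.tl h) ∧ p g h)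
    (fun g h => τ.real 72 [g, h]) N.tailCost N.s N.t with hR
  refine ⟨fun g h => τ.nat 72 [g, h] = 1, fun g h => τ.real 72 [g, h],
    fun g h => {e | ∃ d < G.M, G.ed d = e ∧ τ.nat 71 [g, h, d] = 1}, R, ?_, hR, ?_⟩
  · intro g hg h hh
    -- `blockEdges` refers to all darts of an edge. There are only two of them, `d` and its
    -- reversal, and the program tests both.
    have hedge : ∀ d < G.M, (G.ed d ∈ G.blockEdges N.tailCost g h ↔
        (((G.tl d = G.tl g → N.tailCost d ≤ N.tailCost g) ∧
          (G.tl d = G.tl h → N.tailCost d ≤ N.tailCost h)) ∧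
        ((G.tl (G.rev d) = G.tl g → N.tailCost (G.rev d) ≤ N.tailCost g) ∧
          (G.tl (G.rev d) = G.tl h → N.tailCost (G.rev d) ≤ N.tailCost h)))) := by
      intro d hd
      constructor
      · exact fun he => ⟨he d hd rfl, he _ (G.rev_lt d hd) (G.ed_rev d hd)⟩
      · rintro ⟨h1, h2⟩ d' hd' he
        rcases G.eq_or_eq_rev d' hd' d hd he with rfl | rfl
        exacts [h1, h2]
    refine hG.coreResult l3 (List.Subset.refl _) (by omega) (by omega) ?_ ?_ ?_ ?_ (fun d => ?_) ?_
    · have := l2.nat (List.mem_cons_self ..) (z := [g, h]) (by simp [e18, hg, hh])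
      simpa [cellIndex, hG.tl g hg] using this
    · have := l2.nat (.tail _ (List.mem_cons_self ..)) (z := [g, h]) (by simp [e18, hg, hh])
      simpa [cellIndex, hG.tl h hh] using this
    · intro d hd
      have := l2.nat (.tail _ (.tail _ (List.mem_cons_self ..))) (z := [g, h, d])
        (by simp [e18, hG.M, hg, hh, hd])
      simp only [cellIndex, Bool.false_eq_true, if_false] at this
      have hr := G.rev_lt d hd
      rw [this, NBody.eval_flag_eq_one, hedge d hd]
      simp [hG.tl d hd, hG.tl g hg, hG.tl h hh, hG.rev d hd, hG.tl _ hr, hG.tc d hd, hG.tc g hg,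
        hG.tc h hh, hG.tc _ hr, imp_iff_not_or]
    · intro d hd
      have := l2.nat (.tail _ (.tail _ (.tail _ (List.mem_cons_self ..)))) (z := [g, h, d])
        (by simp [e18, hG.M, hg, hh, hd])
      simp only [cellIndex, Bool.false_eq_true, if_false] at this
      have hr := G.rev_lt d hd
      rw [this, NBody.eval_flag_eq_one, hedge d hd]
      simp [hG.tl d hd, hG.tl g hg, hG.tl h hh, hG.rev d hd, hG.tl _ hr, hG.tc d hd, hG.tc g hg,
        hG.tc h hh, hG.tc _ hr, imp_iff_not_or]
    · unfold DartGraph.blockCost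
      split_ifs
      exacts [le_rfl, N.tailCost_nonneg d]
    · intro d hd
      have := l2.real (.tail _ (.tail _ (.tail _ (.tail _ (List.mem_cons_self ..)))))
        (z := [g, h, d]) (by simp [e18, hG.M, hg, hh, hd])
      simp [cellIndex, hG.tl d hd, hG.tl g hg, hG.tl h hh, hG.tc d hd] at this
      rw [this, DartGraph.blockCost]
  have tables : R.RouteTables (G.M + 2) (fun k x => τ.nat 81 [k, 0, 0, x])
      (fun k x => τ.real 81 [k, 0, 0, x]) (τ.nat 82 [0, 0])
      (fun k x => τ.nat 83 [k, 0, 0, x]) (fun i => τ.nat 84 [i, 0, 0]) := by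
    rw [← hG.K]
    refine l4.routeTables (List.Subset.refl _) (by norm_num) (by norm_num) (by norm_num)
      (R := R) hG.M hG.K (by rw [hG.K, hG.K']) (by rw [hG.one]; norm_num)
      (by rw [hG.one]; norm_num) ?_ ?_ ?_ ?_ ?_ ?_
    · intro j (hj : j < G.M)
      simp [hR, DartGraph.chainProblem, hG.tl j hj, hin.s]
    · intro i (hi : i < G.M) j (hj : j < G.M)
      simp [hR, DartGraph.chainProblem, hG.tl j hj, hG.tl i hi, hp i hi j hj hG]
    · intro i (hi : i < G.M)
      simp [hR, DartGraph.chainProblem, hG.tl i hi, hin.t]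
    · intro j (hj : j < G.M)
      simp [hR, DartGraph.chainProblem, hG.tc j hj]
    · intro i (hi : i < G.M) j (hj : j < G.M)
      simp [hR, DartGraph.chainProblem, hG.tc j hj]
    · intro i (hi : i < G.M)
      simp [hR, DartGraph.chainProblem]
  have h7 : τ.nat 7 [] = if τ.nat 82 [0, 0] = 0 then 0 else 1 := by
    have := l5.nat (.tail _ (List.mem_cons_self ..)) (z := []) (by simp)
    simpa [cellIndex, NBody.eval_flag] using this
  by_cases hkk : τ.nat 82 [0, 0] = 0
  · left
    rw [h7, if_pos hkk]
    exact ⟨rfl, fun q l hl hq => tables.exists_route hq (by omega) hkk⟩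
  · right
    rw [h7, if_neg hkk]
    obtain ⟨h2, hK, hbest, -⟩ := tables.isBest hkk
    refine ⟨rfl, _, _, hbest, nums_output ?_ fun e => ?_⟩
    · rintro e ⟨i, -, d, hd, rfl, -⟩
      exact ed_lt hd
    · have e1 := l5.nat (.tail _ (.tail _ (List.mem_cons_self ..))) (z := [(e : ℕ)])
        (by simp [hin.m])
      have e2 := l5.search (List.mem_cons_self ..) (z := [(e : ℕ)]) (by simp [hin.m])
      simp only [cellIndex, Bool.false_eq_true, if_false] at e1 e2
      rw [e1, NBody.eval_flag_eq_one]
      simp only [Test.holds_neg, Test.holds_eq, eval_const]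
      rw [show (NExp.read 90 ![var 0]).eval (τ.view [(e : ℕ)]) = τ.nat 90 [(e : ℕ)] by simp, e2,
        ← Ne, searchVal_ne_zero]
      simp only [Set.mem_ofPred_eq]
      have key : ∀ i, _ := fun i => exists_dart_iff (N := N)
        (p := fun d => τ.nat 71 [τ.nat 84 [τ.nat 82 [0, 0] - i, 0, 0],
          τ.nat 84 [τ.nat 82 [0, 0] - (i + 1), 0, 0], d] = 1) e
      constructor
      -- The scalar `82` holds `l + 2`, so the test `i + 3 ≤ l + 2` says `i < l`.
      · rintro ⟨i, -, hi⟩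
        simp [hin.m] at hi
        exact ⟨i, by omega, (key i).2 hi.2⟩
      · rintro ⟨i, hi, hd⟩
        have := (key i).1 hd
        refine ⟨i, by rw [hG.K]; omega, ?_⟩
        simp [hin.m]
        exact ⟨by omega, this⟩

/-- The path part of the bound is compared with a path in `E₀`, which is free. What remains is the
cost of the augmentation, and this is at most that of any feasible `F`, so nothing is lost. -/
theorem augAlgorithm_correct {E₀ : Finset (Fin N.m)} (hcost : N.activationCost E₀ = 0)
    (hpath : N.ContainsDP 1 E₀) (hL : Satisfies τ augAlgorithm) (hin : N.HasInput E₀ τ) :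
    (τ.nat 7 [] = 1 ∧ (Disjoint (N.output (τ.view [])) E₀ ∧
        N.ContainsDP 2 (E₀ ∪ N.output (τ.view []))) ∧
      ∀ F, Disjoint F E₀ ∧ N.ContainsDP 2 (E₀ ∪ F) →
        N.activationCost (N.output (τ.view [])) ≤ 1 * N.activationCost F) ∨
    (τ.nat 7 [] = 0 ∧ ∀ F, ¬ (Disjoint F E₀ ∧ N.ContainsDP 2 (E₀ ∪ F))) := by
  obtain ⟨ok, val, sol, hres, hok, hno, hout⟩ := augAlgorithm_spec hL hin
  have hE0 : ∑ v ∈ Finset.range N.dartGraph.n, levelNat E₀ v = 0 := by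
    rw [sum_levelNat, hcost, NNReal.coe_zero]
  have complete : ∀ F, Disjoint F E₀ ∧ N.ContainsDP 2 (E₀ ∪ F) →
      ok ∧ val ≤ N.activationCost F := by
    rintro F ⟨-, hF⟩
    -- The sum of both levels activates `E₀ ∪ F` and costs no more than `F`, as the levels of `E₀`
    -- vanish in total.
    obtain ⟨h5, h6⟩ := hres.complete s_ne_t_val s_lt subset_rfl
      (Set.subset_univ (nums (E₀ ∪ F) : Set ℕ)) hpath.reach hF.conn2
      (levelNat_nonneg E₀) (L₂ := fun v => levelNat E₀ v + levelNat F v)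
      (fun v => add_nonneg (levelNat_nonneg _ v) (levelNat_nonneg _ v))
      (activates_levelNat E₀) (fun d hd he => by
        obtain ⟨e, he', h7⟩ := exists_of_mem_nums he
        rcases Finset.mem_union.1 he' with h8 | h8
        · have := activates_levelNat E₀ d hd (by rw [← h7]; simpa using mem_nums.2 h8)
          linarith [levelNat_nonneg F (N.dartGraph.tl d)]
        · have := activates_levelNat F d hd (by rw [← h7]; simpa using mem_nums.2 h8)
          linarith [levelNat_nonneg E₀ (N.dartGraph.tl d)])
    rw [Finset.sum_add_distrib, hE0, sum_levelNat F, zero_add, zero_add] at h6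
    exact ⟨h5, h6⟩
  by_cases h : ok
  · left
    refine ⟨hok h, ⟨?_, ?_⟩, fun F hF => ?_⟩
    · rw [Finset.disjoint_left]
      intro e he he'
      have : (e : ℕ) ∈ (nums (N.output (τ.view [])) : Set ℕ) := by simpa using mem_nums.2 he
      rw [hout] at this
      exact this.2 (by simpa using mem_nums.2 he')
    · refine containsDP_of_conn2 ((hres.sound s_ne_t_val s_lt h).2.1.mono ?_)
      intro e he
      by_cases he' : e ∈ nums E₀
      · obtain ⟨e', h5, rfl⟩ := exists_of_mem_nums he'
        exact mem_nums.2 (Finset.mem_union_left _ h5)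
      · have : e ∈ (nums (N.output (τ.view [])) : Set ℕ) := by
          rw [hout]; exact ⟨he, by simpa using he'⟩
        obtain ⟨e', h5, rfl⟩ := exists_of_mem_nums (by simpa using this)
        exact mem_nums.2 (Finset.mem_union_right _ h5)
    · obtain ⟨-, -, L, hL0, hL, hsum⟩ := hres.sound s_ne_t_val s_lt h
      have h5 := activationCost_le (F := N.output (τ.view [])) hL0 fun d hd he =>
        hL d hd (by rw [hout] at he; exact he.1)
      rw [one_mul, ← NNReal.coe_le_coe]
      exact h5.trans (hsum.trans (complete F hF).2)
  · exact .inr ⟨hno h, fun F hF => h (complete F hF).1⟩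

/-- A chain has at most as many links as there are edges, so it fits into the `M + 2` layers of the
route computation. -/
theorem card_nums_le (F : Finset (Fin N.m)) : (nums F).card ≤ N.dartGraph.M := by
  rw [nums, Finset.card_map]
  have := F.card_le_univ
  rw [Fintype.card_fin] at this
  exact this.trans (Nat.le_add_left _ _)

theorem edgeAlgorithm_correct {E₀ : Finset (Fin N.m)}
    (hL : Satisfies τ (chainAlgorithm edgeLink)) (hin : N.HasInput E₀ τ) :
    (τ.nat 7 [] = 1 ∧ N.ContainsEDP 2 (N.output (τ.view [])) ∧
      ∀ F, N.ContainsEDP 2 F →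
        N.activationCost (N.output (τ.view [])) ≤ 3 / 2 * N.activationCost F) ∨
    (τ.nat 7 [] = 0 ∧ ∀ F, ¬ N.ContainsEDP 2 F) := by
  obtain ⟨ok, val, sol, R, hres, hR, h⟩ := chainAlgorithm_spec (p := fun _ _ => True) hL hin
    (fun i hi j hj _ => by simp [edgeLink])
  have complete : ∀ F, N.ContainsEDP 2 F → ∃ q l, R.IsRoute q l ∧ l ≤ N.dartGraph.M ∧
      R.cost q l ≤ 3 / 2 * N.activationCost F := by
    intro F hF
    rw [hR, ← sum_levelNat]
    obtain ⟨q, l, h1, h2, h3⟩ := DartGraph.chainProblem_complete_of_eConn2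
      (link := fun g h => (ok g h ∧ N.dartGraph.tl g ≠ N.dartGraph.tl h) ∧ True) hres
      (fun g h h1 h2 => ⟨⟨h1, h2⟩, trivial⟩) (levelNat_nonneg F) (activates_levelNat F)
      (fun v hv => exists_dart_eq_levelNat hv) s_ne_t_val hF.eConn2
    exact ⟨q, l, h1, h2.trans (card_nums_le F), h3⟩
  rcases h with ⟨h7, hno⟩ | ⟨h7, q, l, hbest, hout⟩
  · refine .inr ⟨h7, fun F hF => ?_⟩
    obtain ⟨q, l, h1, h2, -⟩ := complete F hF
    exact hno q l h2 h1
  · left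
    have hroute := hbest.isRoute
    rw [hR] at hroute
    obtain ⟨hconn, -, L, hL0, hLa, hsum⟩ := DartGraph.chainProblem_sound N.tailCost_nonneg hres
      (fun g h h' => h'.1) hroute
    rw [← hout] at hconn hLa
    rw [← hR] at hsum
    refine ⟨h7, containsEDP_of_eConn2 hconn, fun F hF => ?_⟩
    obtain ⟨q', l', h1, h2, h3⟩ := complete F hF
    have h4 := hbest.cost_le q' l' h1 (by omega)
    rw [← NNReal.coe_le_coe]
    push_cast
    exact (activationCost_le hL0 hLa).trans (hsum.trans (h4.trans h3))

theorem nodeAlgorithm_correct {E₀ : Finset (Fin N.m)}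
    (hL : Satisfies τ (chainAlgorithm nodeLink)) (hin : N.HasInput E₀ τ) :
    (τ.nat 7 [] = 1 ∧ N.ContainsDP 2 (N.output (τ.view [])) ∧
      ∀ F, N.ContainsDP 2 F →
        N.activationCost (N.output (τ.view [])) ≤ 3 / 2 * N.activationCost F) ∨
    (τ.nat 7 [] = 0 ∧ ∀ F, ¬ N.ContainsDP 2 F) := by
  obtain ⟨ok, val, sol, R, hres, hR, h⟩ := chainAlgorithm_spec
    (p := fun g h => N.dartGraph.tl g = N.s ∧ N.dartGraph.tl h = N.t) hL hin
    (fun i hi j hj hG => by simp [nodeLink, hG.tl i hi, hG.tl j hj, hin.s, hin.t])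
  have complete : ∀ F, N.ContainsDP 2 F → ∃ q, R.IsRoute q 1 ∧
      R.cost q 1 ≤ 3 / 2 * N.activationCost F := by
    intro F hF
    rw [hR, ← sum_levelNat]
    exact DartGraph.chainProblem_complete_of_conn2 hres
      (fun g h h1 h2 h3 => ⟨⟨h1, by rw [h2, h3]; exact s_ne_t_val⟩, h2, h3⟩) (levelNat_nonneg F)
      (activates_levelNat F) (fun v hv => exists_dart_eq_levelNat hv) s_ne_t_val hF.conn2
  have hM : ∀ {q : ℕ → ℕ} {l : ℕ}, R.IsRoute q l → 1 ≤ N.dartGraph.M := by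
    intro q l hq
    have := hq.lt 0 (Nat.zero_le _)
    rw [hR] at this
    exact (Nat.zero_le _).trans_lt this
  rcases h with ⟨h7, hno⟩ | ⟨h7, q, l, hbest, hout⟩
  · refine .inr ⟨h7, fun F hF => ?_⟩
    obtain ⟨q, h1, -⟩ := complete F hF
    exact hno q 1 (hM h1) h1
  · left
    have hroute := hbest.isRoute
    rw [hR] at hroute
    obtain ⟨-, hconn, L, hL0, hLa, hsum⟩ := DartGraph.chainProblem_sound N.tailCost_nonneg hres
      (fun g h h' => h'.1) hroute
    have hs : N.dartGraph.tl (q 0) = N.s := hroute.start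
    have ht : N.dartGraph.tl (q l) = N.t := hroute.finish
    -- Every admitted link leads from `s` to `t`. Two consecutive links would meet in a node that is
    -- both, and no link at all would mean `s = t`.
    obtain rfl : l = 1 := by
      rcases l with _ | _ | l
      · exact absurd (hs.symm.trans ht) s_ne_t_val
      · rfl
      · have h1 : N.dartGraph.tl (q 1) = N.t := (hroute.step 0 (by omega)).2.2
        have h2 : N.dartGraph.tl (q 1) = N.s := (hroute.step 1 (by omega)).2.1
        exact absurd (h2.symm.trans h1) s_ne_t_val
    have hc := hconn 0 (by omega)
    rw [hs, zero_add, ht] at hc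
    rw [← hout] at hLa
    rw [← hR] at hsum
    refine ⟨h7, containsDP_of_conn2 (hc.mono ?_), fun F hF => ?_⟩
    · rw [hout]
      exact fun e he => ⟨0, by omega, he⟩
    obtain ⟨q', h1, h3⟩ := complete F hF
    have h4 := hbest.cost_le q' 1 h1 (by have := hM h1; omega)
    rw [← NNReal.coe_le_coe]
    push_cast
    exact (activationCost_le hL0 hLa).trans (hsum.trans (h4.trans h3))

end Network

/-! ### The three claims about polynomial time algorithms -/

theorem solvableInPolyTime_augmentation : activation2DPAugmentation.SolvableInPolyTime := by
  obtain ⟨b, hb⟩ := Network.exists_run wf_augAlgorithm (size := .const 1)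
    (fun s hs => by simp [augAlgorithm, hs]) (fun M τ _ => by simp)
  refine ⟨compile augAlgorithm, b, fun I => ?_⟩
  obtain ⟨T, τ, h1, h2, h3, h4⟩ := hb I.net I.E₀
  refine ⟨T, τ.view [], h1, h2, ?_⟩
  rw [Mem.view_nat_ne _ _ (by norm_num)]
  exact Network.augAlgorithm_correct I.cost_zero I.contains_path h3 h4

theorem approxInPolyTime_edgeDisjoint : activation2EDP.ApproxInPolyTime (3 / 2) := by
  obtain ⟨b, hb⟩ := Network.exists_run wf_chainAlgorithm_edgeLink (size := scalar 10)
    (fun s hs => by simp [chainAlgorithm, hs]) (fun M τ h => by simp [h])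
  refine ⟨compile (chainAlgorithm edgeLink), b, fun N => ?_⟩
  obtain ⟨T, τ, h1, h2, h3, h4⟩ := hb N ∅
  refine ⟨T, τ.view [], h1, h2, ?_⟩
  rw [Mem.view_nat_ne _ _ (by norm_num)]
  exact Network.edgeAlgorithm_correct h3 h4

theorem approxInPolyTime_nodeDisjoint : activation2DP.ApproxInPolyTime (3 / 2) := by
  obtain ⟨b, hb⟩ := Network.exists_run wf_chainAlgorithm_nodeLink (size := scalar 10)
    (fun s hs => by simp [chainAlgorithm, hs]) (fun M τ h => by simp [h])
  refine ⟨compile (chainAlgorithm nodeLink), b, fun N => ?_⟩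
  obtain ⟨T, τ, h1, h2, h3, h4⟩ := hb N ∅
  refine ⟨T, τ.view [], h1, h2, ?_⟩
  rw [Mem.view_nat_ne _ _ (by norm_num)]
  exact Network.nodeAlgorithm_correct h3 h4

/-- Activation 2-DP Augmentation admits a polynomial time algorithm, and both Activation 2-DP and
Activation 2-EDP admit polynomial time `1.5`-approximation algorithms. -/
theorem theorem1 :
    activation2DPAugmentation.SolvableInPolyTime ∧
      activation2DP.ApproxInPolyTime (3 / 2) ∧
      activation2EDP.ApproxInPolyTime (3 / 2) :=
  ⟨solvableInPolyTime_augmentation, approxInPolyTime_nodeDisjoint, approxInPolyTime_edgeDisjoint⟩
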